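/- Let $D=t\partial_t$, and let $\mathcal{SD}$ be the Lie superalgebra of regular differential operators on the super circle $S^{1|1}$: it is spanned by the elements $t^rF(D)$, $r\in\mathbb Z$, where $F=\begin{pmatrix} f_0&f_+\\ f_-&f_1\end{pmatrix}$ has entries in $\mathbb C[w]$ and $F(D)=\partial_\theta\theta f_0(D)+\partial_\theta f_+(D)+\theta f_-(D)+\theta\partial_\theta f_1(D)$. Let $\widehat{\mathcal{SD}}=\mathcal{SD}\oplus\mathbb C C$ be its central extension with bracket $[A,B]+\Psi(A,B)C$, where $\Psi$ is the super-skew-symmetric two-cocycle with $\Psi(t^rF(D),t^sG(D))=0$ for $r+s\ne0$ and $\Psi(t^rF(D),t^{-r}G(D))=\sum_{-r\le j\le-1}\mathrm{Str}(F(j)G(j+r))$ for $r\ge0$, $\mathrm{Str}$ being the supertrace. The principal gradation is given by $\mathrm{wt}(C)=\mathrm{wt}(D)=0$, $\mathrm{wt}(t)=1$, $\mathrm{wt}(\theta)=\frac12$, $\mathrm{wt}(\partial_\theta)=-\frac12$. For signs $\epsilon_1,\epsilon_2\in\{+,-\}$ let $\sigma$ be the anti-involution of the associative superalgebra of regular differential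 operators on $S^{1|1}$ (so $\sigma(XY)=(-1)^{|X||Y|}\sigma(Y)\sigma(X)$) with $\sigma(t)=\epsilon_1t$, $\sigma(D)=-D-1$, $\sigma(\theta)=\epsilon_2\theta$, $\sigma(\partial_\theta)=-\epsilon_2\partial_\theta$, and let $$\mathfrak g={}^{\epsilon_1\epsilon_2}\widehat{\mathcal{SD}}=\{A\in\mathcal{SD}:\sigma(A)=-A\}\oplus\mathbb CC\subset\widehat{\mathcal{SD}},$$ with the gradation $\mathfrak g=\bigoplus_{j\in\frac12\mathbb Z}\mathfrak g_j$ induced by the principal one. Its degree-zero part $\mathfrak g_0$ is abelian. Let $\xi$ be a linear functional on $\mathfrak g_0$, put $c=\xi(C)$, and let $L(\mathfrak g,\xi)$ be the irreducible highest weight module of highest weight $\xi$, that is, the irreducible quotient of the module induced from the one-dimensional $\bigoplus_{j\ge0}\mathfrak g_j$-module on which $\mathfrak g_0$ acts by $\xi$ and $\mathfrak g_j$, $j>0$, by $0$. It is graded by $\frac12\mathbb Z$ with its highest weight vector in degree $0$, and is called quasifinite if all its graded components are finite-dimensional. Define formal power series in $x$ (with $\xi$ applied coefficientwise) $$\Delta_0(x)=-\xi\bigl(\sinh(x(D+\tfrac12))\bigr),\qquad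 \Delta_1(x)=-\xi\bigl((\theta\partial_\theta-\partial_\theta\theta)\cosh(x(D+\tfrac12))\bigr).$$ Theorem. In each of the four cases, $L({}^{\epsilon_1\epsilon_2}\widehat{\mathcal{SD}},\xi)$ is quasifinite if and only if there are nonzero polynomials $\alpha,\beta\in\mathbb C[w]$ with $\alpha$ odd and $\beta$ even in the case $++$, $\alpha$ even and $\beta$ odd in the case $+-$, $\alpha$ and $\beta$ both even in the case $-+$, and $\alpha$ and $\beta$ both odd in the case $--$, such that $$\beta\Bigl(\frac{d}{dx}\Bigr)\Delta_0(x)=0,\qquad \alpha\Bigl(\frac{d}{dx}\Bigr)\Bigl((e^{x/2}+e^{-x/2})\Delta_0(x)+(e^{x/2}-e^{-x/2})\Delta_1(x)-2c\Bigr)=0.$$ -/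

import Mathlib

open Polynomial

noncomputable section

namespace SuperCircle

/-!
The associative superalgebra of regular differential operators on the super circle, written as
`2 × 2` supermatrices with entries in the algebra of differential operators on the circle.
Row / column index `0` is even, `1` is odd.  The matrix units are
`M₀ = ∂_θ θ = E₀₀`, `M₁ = θ ∂_θ = E₁₁`, `M₊ = ∂_θ = E₀₁`, `M₋ = θ = E₁₀`.
-/

/-- Matrices `F(D)` with entries polynomials in `D = t ∂_t`. -/
abbrev Mat := Matrix (Fin 2) (Fin 2) ℂ[X]

/-- Finite sums `∑_r t ^ r F_r(D)`; the value at `r` is `F_r`. -/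
abbrev SD := ℤ →₀ Mat

/-- `F(D) ↦ F(D + s)`. -/
def shift (s : ℤ) (F : Mat) : Mat := F.map fun p => p.comp (X + C (s : ℂ))

/-- The coefficient of `t ^ (r + s)` in the supercommutator of `t ^ r F(D)` and `t ^ s G(D)`,
that is, `F(D + s) G(D) - (-1) ^ (|F| |G|) G(D + r) F(D)` (recall `F(D) t ^ s = t ^ s F(D + s)`), extended bilinearly from the
parity-homogeneous `F` and `G`: the `(i, k)` entry of a matrix has parity `i + k`. -/
def superComm (r s : ℤ) (F G : Mat) : Mat :=
  Matrix.of fun i j => ∑ k, (shift s F i k * G k j -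
    (-1) ^ (((i : ℕ) + (k : ℕ)) * ((k : ℕ) + (j : ℕ))) * (shift r G i k * F k j))

/-- The superbracket of the Lie superalgebra of differential operators on the super circle. -/
def bracket (A B : SD) : SD :=
  A.sum fun r F => B.sum fun s G => Finsupp.single (r + s) (superComm r s F G)

/-- The supertrace `Str(F(x) G(y))`. -/
def strMul (F G : Mat) (x y : ℂ) : ℂ :=
  ((F 0 0).eval x * (G 0 0).eval y + (F 0 1).eval x * (G 1 0).eval y)
    - ((F 1 0).eval x * (G 0 1).eval y + (F 1 1).eval x * (G 1 1).eval y)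

/-- The two-cocycle `Ψ`: it vanishes on `(t ^ r F(D), t ^ s G(D))` if `r + s ≠ 0`, it is
`∑_{-r ≤ j ≤ -1} Str(F(j) G(j + r))` if `r = -s ≥ 0`, and for `r = -s < 0` it is given by
super-skew-symmetry, which amounts to `-∑_{0 ≤ j < -r} Str(F(j) G(j + r))`. -/
def cocycle (A B : SD) : ℂ :=
  A.sum fun r F =>
    ∑ j ∈ Finset.Ico (-r) 0, strMul F (B (-r)) (j : ℂ) ((j + r : ℤ) : ℂ)
      - ∑ j ∈ Finset.Ico 0 (-r), strMul F (B (-r)) (j : ℂ) ((j + r : ℤ) : ℂ)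

/-- The coefficient map of the anti-involution below. -/
def sigmaMat (ε₁ ε₂ : ℤˣ) (r : ℤ) (F : Mat) : Mat :=
  let e : ℂ[X] := C (((ε₁ ^ r : ℤˣ) : ℤ) : ℂ)
  let d : ℂ[X] := C ((ε₂ : ℤ) : ℂ)
  let ρ : ℂ[X] → ℂ[X] := fun p => p.comp (-X - C ((r : ℂ) + 1))
  !![e * ρ (F 1 1), -(e * d * ρ (F 0 1)); e * d * ρ (F 1 0), e * ρ (F 0 0)]

theorem sigmaMat_zero (ε₁ ε₂ : ℤˣ) (r : ℤ) : sigmaMat ε₁ ε₂ r 0 = 0 := by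
  ext i j : 1
  fin_cases i <;> fin_cases j <;> simp [sigmaMat]

theorem sigmaMat_add (ε₁ ε₂ : ℤˣ) (r : ℤ) (F G : Mat) :
    sigmaMat ε₁ ε₂ r (F + G) = sigmaMat ε₁ ε₂ r F + sigmaMat ε₁ ε₂ r G := by
  ext i j : 1
  fin_cases i <;> fin_cases j <;> simp only [sigmaMat, Matrix.add_apply, add_comp] <;> simp <;> ring

theorem sigmaMat_smul (ε₁ ε₂ : ℤˣ) (r : ℤ) (c : ℂ) (F : Mat) :
    sigmaMat ε₁ ε₂ r (c • F) = c • sigmaMat ε₁ ε₂ r F := by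
  ext i j : 1
  fin_cases i <;> fin_cases j <;>
    simp only [sigmaMat, Matrix.smul_apply, smul_eq_C_mul, mul_comp, C_comp] <;>
    simp <;> ring

/-- The anti-involution `σ_{ε₁ ε₂}` with `σ(t) = ε₁ t`, `σ(D) = -D - 1`, `σ(θ) = ε₂ θ`,
`σ(∂_θ) = -ε₂ ∂_θ` and `σ(X Y) = (-1) ^ (|X| |Y|) σ(Y) σ(X)`.  These force
`σ(M₀) = M₁`, `σ(M₁) = M₀`, and
`σ(t ^ r M f(D)) = f(-D - 1) σ(M) (ε₁ t) ^ r = ε₁ ^ r t ^ r σ(M) f(-D - r - 1)`. -/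
def sigma (ε₁ ε₂ : ℤˣ) (A : SD) : SD :=
  Finsupp.onFinset A.support (fun r => sigmaMat ε₁ ε₂ r (A r)) fun r hr => by
    rw [Finsupp.mem_support_iff]
    intro h
    exact hr (by rw [h, sigmaMat_zero])

theorem sigma_apply (ε₁ ε₂ : ℤˣ) (A : SD) (r : ℤ) :
    sigma ε₁ ε₂ A r = sigmaMat ε₁ ε₂ r (A r) := rfl

/-- The central extension of the fixed subalgebra `{A | σ_{ε₁ ε₂}(A) = -A}`:
pairs `(A, c)` stand for `A + c C`, with `C` the central generator.  The signs
`(ε₁, ε₂) = (1, 1), (1, -1), (-1, 1), (-1, -1)` give the four algebras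
`⁺⁺SD^`, `⁺⁻SD^`, `⁻⁺SD^`, `⁻⁻SD^`. -/
def hatSD (ε₁ ε₂ : ℤˣ) : Submodule ℂ (SD × ℂ) where
  carrier := {x | sigma ε₁ ε₂ x.1 = -x.1}
  zero_mem' := by
    ext r : 1
    simp [sigma_apply, sigmaMat_zero]
  add_mem' {x y} hx hy := by
    simp only [Set.mem_ofPred_eq] at *
    ext r : 1
    have h1 := DFunLike.congr_fun hx r
    have h2 := DFunLike.congr_fun hy r
    simp only [sigma_apply, Finsupp.neg_apply] at h1 h2
    simp only [sigma_apply, Prod.fst_add, Finsupp.add_apply, Finsupp.neg_apply, sigmaMat_add, h1, h2]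
    abel
  smul_mem' c x hx := by
    simp only [Set.mem_ofPred_eq] at *
    ext r : 1
    have h1 := DFunLike.congr_fun hx r
    simp only [sigma_apply, Finsupp.neg_apply] at h1
    simp only [sigma_apply, Prod.smul_fst, Finsupp.smul_apply, Finsupp.neg_apply,
      sigmaMat_smul, h1, smul_neg]

theorem sigmaMat_superComm (ε₁ ε₂ : ℤˣ) (r s : ℤ) (F G : Mat) :
    sigmaMat ε₁ ε₂ (r + s) (superComm r s F G)
      = -superComm r s (sigmaMat ε₁ ε₂ r F) (sigmaMat ε₁ ε₂ s G) := by
  have e1 : ∀ p : ℂ[X], (p.comp (X + C (s : ℂ))).comp (-X - C (((r + s : ℤ) : ℂ) + 1))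
      = p.comp (-X - C ((r : ℂ) + 1)) := by
    intro p
    rw [comp_assoc]
    congr 1
    simp
    ring
  have e2 : ∀ p : ℂ[X], (p.comp (X + C (r : ℂ))).comp (-X - C (((r + s : ℤ) : ℂ) + 1))
      = p.comp (-X - C ((s : ℂ) + 1)) := by
    intro p
    rw [comp_assoc]
    congr 1
    simp
    ring
  have e3 : ∀ p : ℂ[X], (p.comp (-X - C ((r : ℂ) + 1))).comp (X + C (s : ℂ))
      = p.comp (-X - C (((r + s : ℤ) : ℂ) + 1)) := by
    intro p
    rw [comp_assoc]
    congr 1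
    simp
    ring
  have e4 : ∀ p : ℂ[X], (p.comp (-X - C ((s : ℂ) + 1))).comp (X + C (r : ℂ))
      = p.comp (-X - C (((r + s : ℤ) : ℂ) + 1)) := by
    intro p
    rw [comp_assoc]
    congr 1
    simp
    ring
  have e5 : (((ε₁ ^ (r + s) : ℤˣ) : ℤ) : ℂ)
      = (((ε₁ ^ r : ℤˣ) : ℤ) : ℂ) * (((ε₁ ^ s : ℤˣ) : ℤ) : ℂ) := by
    rw [zpow_add]
    push_cast
    ring
  have h2 : (-1 : ℂ[X]) ^ 2 = 1 := by norm_num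
  have h4 : (-1 : ℂ[X]) ^ 4 = 1 := by norm_num
  ext i j : 1
  rcases Int.units_eq_one_or ε₂ with rfl | rfl <;> fin_cases i <;> fin_cases j
  all_goals
    simp only [sigmaMat, superComm, shift, Fin.sum_univ_two, Matrix.of_apply, Matrix.map_apply,
      Matrix.neg_apply, Fin.isValue, Fin.zero_eta, Fin.mk_one, Matrix.cons_val',
      Matrix.cons_val_zero, Matrix.cons_val_one, Matrix.cons_val_fin_one, sub_comp, add_comp,
      mul_comp, neg_comp, C_comp, e1, e2, e3, e4, e5, C_mul]
    simp only [Fin.val_zero, Fin.val_one, Nat.reduceAdd, Nat.reduceMul, zero_add, add_zero,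
      mul_zero, mul_one, one_mul, pow_zero, pow_one, one_comp, neg_comp, neg_mul, h2, h4,
      Units.val_one, Units.val_neg, Int.cast_one, Int.cast_neg, C_neg, C_1]
    ring

theorem superComm_neg_neg (r s : ℤ) (F G : Mat) :
    superComm r s (-F) (-G) = superComm r s F G := by
  ext i j : 1
  simp [superComm, shift]

theorem bracket_apply (A B : SD) (n : ℤ) :
    bracket A B n = ∑ r ∈ A.support, ∑ s ∈ B.support,
      if r + s = n then superComm r s (A r) (B s) else 0 := by
  simp only [bracket, Finsupp.sum, Finsupp.finsetSum_apply, Finsupp.single_apply]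

theorem sigmaMat_sum (ε₁ ε₂ : ℤˣ) (r : ℤ) {ι : Type} (t : Finset ι) (f : ι → Mat) :
    sigmaMat ε₁ ε₂ r (∑ i ∈ t, f i) = ∑ i ∈ t, sigmaMat ε₁ ε₂ r (f i) :=
  map_sum (AddMonoidHom.mk' (sigmaMat ε₁ ε₂ r) (sigmaMat_add ε₁ ε₂ r)) f t

/-- The fixed subalgebra is closed under the superbracket. -/
theorem bracket_mem (ε₁ ε₂ : ℤˣ) {A B : SD} (hA : sigma ε₁ ε₂ A = -A) (hB : sigma ε₁ ε₂ B = -B) :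
    sigma ε₁ ε₂ (bracket A B) = -bracket A B := by
  ext n : 1
  rw [sigma_apply, Finsupp.neg_apply, bracket_apply, sigmaMat_sum, ← Finset.sum_neg_distrib]
  refine Finset.sum_congr rfl fun r _ => ?_
  rw [sigmaMat_sum, ← Finset.sum_neg_distrib]
  refine Finset.sum_congr rfl fun s _ => ?_
  split_ifs with h
  · subst h
    have h1 := DFunLike.congr_fun hA r
    have h2 := DFunLike.congr_fun hB s
    rw [sigma_apply, Finsupp.neg_apply] at h1 h2
    rw [sigmaMat_superComm, h1, h2, superComm_neg_neg]
  · rw [sigmaMat_zero, neg_zero]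

section

variable (ε₁ ε₂ : ℤˣ)

/-- The superbracket of the central extension, `[A + a C, B + b C] = [A, B] + Ψ(A, B) C`. -/
def hatBracket (x y : hatSD ε₁ ε₂) : hatSD ε₁ ε₂ :=
  ⟨(bracket x.1.1 y.1.1, cocycle x.1.1 y.1.1), bracket_mem ε₁ ε₂ x.2 y.2⟩

/-- The central generator `C`. -/
def central : hatSD ε₁ ε₂ :=
  ⟨(0, 1), by
    show sigma ε₁ ε₂ 0 = -0
    ext r : 1
    simp [sigma_apply, sigmaMat_zero]⟩

/-- The principal gradation with degrees doubled: `gr n` is the component of degree `n / 2`, where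
`wt(C) = wt(D) = 0`, `wt(t) = 1`, `wt(θ) = 1/2`, `wt(∂_θ) = -1/2`.  The component is even or odd
according to the parity of `n`. -/
def gr (n : ℤ) : Submodule ℂ (hatSD ε₁ ε₂) where
  carrier := {x | (∀ (r : ℤ) (i j : Fin 2), x.1.1 r i j ≠ 0 →
    2 * r + ((i : ℕ) : ℤ) - ((j : ℕ) : ℤ) = n) ∧ (x.1.2 ≠ 0 → n = 0)}
  zero_mem' := by simp
  add_mem' {x y} hx hy := by
    refine ⟨fun r i j h => ?_, fun h => ?_⟩
    · by_cases h1 : x.1.1 r i j = 0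
      · refine hy.1 r i j fun h2 => h ?_
        simp [h1, h2]
      · exact hx.1 r i j h1
    · by_cases h1 : x.1.2 = 0
      · refine hy.2 fun h2 => h ?_
        simp [h1, h2]
      · exact hx.2 h1
  smul_mem' c x hx := by
    refine ⟨fun r i j h => hx.1 r i j fun h1 => h ?_, fun h => hx.2 fun h1 => h ?_⟩ <;> simp [h1]

/-- The defining relations `x y - (-1) ^ (|x| |y|) y x = [x, y]`, for homogeneous `x` and `y`, of
the universal enveloping algebra. -/
inductive EnvRel : TensorAlgebra ℂ (hatSD ε₁ ε₂) → TensorAlgebra ℂ (hatSD ε₁ ε₂) → Prop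
  | super {m n : ℤ} {x y : hatSD ε₁ ε₂} (hx : x ∈ gr ε₁ ε₂ m) (hy : y ∈ gr ε₁ ε₂ n) :
      EnvRel
        (TensorAlgebra.ι ℂ x * TensorAlgebra.ι ℂ y)
        (((m * n).negOnePow : ℤ) • (TensorAlgebra.ι ℂ y * TensorAlgebra.ι ℂ x)
          + TensorAlgebra.ι ℂ (hatBracket ε₁ ε₂ x y))

/-- The universal enveloping (super)algebra. -/
abbrev Env : Type := RingQuot (EnvRel ε₁ ε₂)

/-- The canonical map into the universal enveloping algebra. -/
def toEnv : hatSD ε₁ ε₂ →ₗ[ℂ] Env ε₁ ε₂ :=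
  (RingQuot.mkAlgHom ℂ (EnvRel ε₁ ε₂)).toLinearMap ∘ₗ TensorAlgebra.ι ℂ

/-- `IsMonomial n u`: `u = x₁ ⋯ x_k` with `x_i` homogeneous of degrees (doubled) of sum `n`. -/
inductive IsMonomial : ℤ → Env ε₁ ε₂ → Prop
  | one : IsMonomial 0 1
  | mul {m n : ℤ} {x : hatSD ε₁ ε₂} {u : Env ε₁ ε₂} (hx : x ∈ gr ε₁ ε₂ m)
      (hu : IsMonomial n u) : IsMonomial (m + n) (toEnv ε₁ ε₂ x * u)

variable (ξ : Module.Dual ℂ (gr ε₁ ε₂ 0))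

/-- The left ideal of the enveloping algebra generated by the elements of positive degree and by
`h - ξ(h)` for `h` in the Cartan subalgebra. -/
def vermaIdeal : Submodule (Env ε₁ ε₂) (Env ε₁ ε₂) :=
  Submodule.span (Env ε₁ ε₂)
    ({u | ∃ n : ℤ, 0 < n ∧ ∃ x ∈ gr ε₁ ε₂ n, u = toEnv ε₁ ε₂ x} ∪
      {u | ∃ h : gr ε₁ ε₂ 0, u = toEnv ε₁ ε₂ h - algebraMap ℂ (Env ε₁ ε₂) (ξ h)})

/-- The Verma module: the module induced from the one-dimensional module of the nonnegative part on
which the positive part acts by `0` and the Cartan subalgebra acts by `ξ`. -/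
abbrev Verma : Type := Env ε₁ ε₂ ⧸ vermaIdeal ε₁ ε₂ ξ

/-- The sum of all proper submodules of the Verma module, its largest proper submodule. -/
def maxSubmodule : Submodule (Env ε₁ ε₂) (Verma ε₁ ε₂ ξ) :=
  sSup {N | N ≠ ⊤}

/-- The irreducible highest weight module `L(ξ)`, the irreducible quotient of the Verma module. -/
abbrev Irr : Type := Verma ε₁ ε₂ ξ ⧸ maxSubmodule ε₁ ε₂ ξ

/-- The highest weight vector `v_ξ`. -/
def hwVector : Irr ε₁ ε₂ ξ :=
  (maxSubmodule ε₁ ε₂ ξ).mkQ ((vermaIdeal ε₁ ε₂ ξ).mkQ 1)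

/-- The graded component of `L(ξ)` of degree `n / 2`, with `v_ξ` in degree `0`. -/
def irrGr (n : ℤ) : Submodule ℂ (Irr ε₁ ε₂ ξ) :=
  Submodule.span ℂ {w | ∃ u, IsMonomial ε₁ ε₂ n u ∧ w = u • hwVector ε₁ ε₂ ξ}

/-- `L(ξ)` is quasifinite: all graded components are finite-dimensional. -/
def IsQuasifinite : Prop :=
  ∀ n : ℤ, FiniteDimensional ℂ (irrGr ε₁ ε₂ ξ n)

/-- The diagonal operator `∂_θ θ p(D) + θ ∂_θ q(D)`. -/
def diagOp (p q : ℂ[X]) : SD := Finsupp.single 0 !![p, 0; 0, q]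

theorem diagOp_mem {p : ℂ[X]} :
    sigma ε₁ ε₂ (diagOp p (-p.comp (-X - 1))) = -diagOp p (-p.comp (-X - 1)) := by
  ext r : 1
  by_cases hr : r = 0
  · subst hr
    have e : (p.comp (-X - 1)).comp (-X - 1) = p := by
      rw [comp_assoc]
      simp
    rw [sigma_apply, Finsupp.neg_apply, diagOp, Finsupp.single_eq_same]
    ext i j : 1
    fin_cases i <;> fin_cases j <;> simp [sigmaMat, e]
  · rw [sigma_apply, Finsupp.neg_apply, diagOp, Finsupp.single_eq_of_ne (by simpa using hr),
      sigmaMat_zero, neg_zero]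

/-- `∂_θ θ p(D) + θ ∂_θ q(D)` as an element of the Cartan subalgebra, for `q(w) = -p(-w - 1)`. -/
def cartan (p q : ℂ[X]) (h : q = -p.comp (-X - 1)) : gr ε₁ ε₂ 0 :=
  ⟨⟨(diagOp p q, 0), by
      subst h
      exact diagOp_mem ε₁ ε₂⟩, by
    refine ⟨fun r i j hij => ?_, fun h => (h rfl).elim⟩
    by_cases hr : r = 0
    · subst hr
      fin_cases i <;> fin_cases j <;> simp_all [diagOp]
    · exact (hij (by simp [diagOp, Ne.symm hr])).elim⟩

/-- `D + 1/2`. -/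
def dHalf : ℂ[X] := X + C (1 / 2)

theorem dHalf_comp : dHalf.comp (-X - 1) = -dHalf := by
  have : (C (1 / 2 : ℂ) : ℂ[X]) + C (1 / 2) = 1 := by
    rw [← C_add]
    norm_num
  simp only [dHalf, add_comp, X_comp, C_comp]
  linear_combination this

/-- The coefficient of `x ^ n` in `sinh(x (D + 1/2)) = (e^{x (D + 1/2)} - e^{-x (D + 1/2)}) / 2`. -/
def sinhCoeff (n : ℕ) : ℂ[X] := C (1 / (2 * (n.factorial : ℂ))) * (dHalf ^ n - (-dHalf) ^ n)

/-- The coefficient of `x ^ n` in `cosh(x (D + 1/2)) = (e^{x (D + 1/2)} + e^{-x (D + 1/2)}) / 2`. -/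
def coshCoeff (n : ℕ) : ℂ[X] := C (1 / (2 * (n.factorial : ℂ))) * (dHalf ^ n + (-dHalf) ^ n)

theorem sinhCoeff_comp (n : ℕ) : sinhCoeff n = -(sinhCoeff n).comp (-X - 1) := by
  simp only [sinhCoeff, mul_comp, C_comp, sub_comp, pow_comp, neg_comp, dHalf_comp, neg_neg]
  ring

theorem coshCoeff_comp (n : ℕ) : coshCoeff n = -(-coshCoeff n).comp (-X - 1) := by
  simp only [coshCoeff, mul_comp, C_comp, add_comp, pow_comp, neg_comp, dHalf_comp, neg_neg]
  ring

/-- `Δ₀(x) = -ξ(sinh(x (D + 1/2)))`, a formal power series in `x`. -/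
def Delta0 : PowerSeries ℂ :=
  PowerSeries.mk fun n => -ξ (cartan ε₁ ε₂ (sinhCoeff n) (sinhCoeff n) (sinhCoeff_comp n))

/-- `Δ₁(x) = -ξ((θ ∂_θ - ∂_θ θ) cosh(x (D + 1/2)))`, a formal power series in `x`. -/
def Delta1 : PowerSeries ℂ :=
  PowerSeries.mk fun n => -ξ (cartan ε₁ ε₂ (-coshCoeff n) (coshCoeff n) (coshCoeff_comp n))

/-- The central charge `c = ξ(C)`. -/
def centralCharge : ℂ :=
  ξ ⟨central ε₁ ε₂, ⟨fun _ _ _ h => (h rfl).elim, fun _ => rfl⟩⟩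

end

/-- `p(d/dx) Φ` for a polynomial `p` and a formal power series `Φ` in `x`. -/
def diffOp (p : ℂ[X]) (Φ : PowerSeries ℂ) : PowerSeries ℂ :=
  aeval (PowerSeries.derivative ℂ : Derivation ℂ (PowerSeries ℂ) (PowerSeries ℂ)).toLinearMap p Φ

/-- The formal power series `e^{a x}`. -/
def expSeries (a : ℂ) : PowerSeries ℂ := PowerSeries.rescale a (PowerSeries.exp ℂ)

/-- `p(-w) = ε p(w)`: the polynomial `p` is even if `ε = 1` and odd if `ε = -1`. -/
def HasParity (ε : ℤˣ) (p : ℂ[X]) : Prop := p.comp (-X) = C ((ε : ℤ) : ℂ) * p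

end SuperCircle

end

noncomputable section

/-! ### Graded Lie superalgebras and a Verma module built without a PBW basis -/

namespace SuperCircle

/-! Degrees are doubled, so the physical degree -1/2 is `-1`. The whole criterion is decided there.
The component of degree -1/2 consists of the elements t^{-1} θ F(D) and the elements ∂_θ G(D). The
condition σ(A) = -A says exactly that F has parity `-(ε₁ * ε₂)` and that G is a polynomial of parity
`ε₂` in D + 1/2.

Necessity: if L is quasifinite, each of these two infinite-dimensional families contains a nonzero
element killing the highest weight vector v; this yields α and β.

Translation: L is irreducible, so y v = 0 for y of degree -1/2 if and only if ξ([x, y]) = 0 for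
every x of degree 1/2; otherwise y v would be a nonzero singular vector (`mem_annih_hwVector_iff`).
The elements θ pair only with the elements ∂_θ, so the two families give two separate linear
conditions on ξ (`lowElt_mem_annih_iff`, `upElt_mem_annih_iff`). A functional μ on ℂ[w] is encoded
by the series μ(e^{xw}); then d/dx becomes multiplication by w and e^{ax} becomes translation by a.
The condition for β is exactly β(d/dx)Δ₀ = 0. The condition for α is the stated equation without the
constant 2c, because the cocycle vanishes on the pairs involved. The constant is harmless: replacing
α by w²α keeps the parity, and two derivatives kill constants.

Sufficiency: the two annihilators of degree -1/2 bracket to annihilators of every type t^r in all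
negative degrees. Bracketing with the Cartan subalgebra makes the annihilating polynomials absorb
multiplication by arbitrary polynomials, so each g_n v is an image of quotients ℂ[w]/(p) and is
finite-dimensional (`IsHighestWeight.finOrbit`). This property passes from v to every word applied
to v, and each component of L is then finite-dimensional (`finiteDimensional_negSpan`).

Irreducibility needs v ≠ 0, that is, the sum of the proper submodules of the Verma module must be
proper. For this the Lie superalgebra is made to act on the enveloping algebra of its negative part,
which gives a functional reading off the coefficient of v (`hwCoeff`). Weight decompositions are
replaced by polynomials in a grading element (`awayFrom`). -/

/-- The sign `(-1) ^ (m n)`. -/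
def eps (m n : ℤ) : ℂ := (((m * n).negOnePow : ℤ) : ℂ)

theorem eps_comm (m n : ℤ) : eps m n = eps n m := by rw [eps, eps, mul_comm]

theorem eps_add_left (a b c : ℤ) : eps (a + b) c = eps a c * eps b c := by
  simp [eps, add_mul, Int.negOnePow_add]

theorem eps_add_right (a b c : ℤ) : eps c (a + b) = eps c a * eps c b := by
  simp [eps, mul_add, Int.negOnePow_add]

theorem eps_mul_self (m n : ℤ) : eps m n * eps m n = 1 := by
  rcases Int.units_eq_one_or ((m * n).negOnePow) with h | h <;> simp [eps, h]

theorem eps_even_left {m : ℤ} (n : ℤ) (h : Even m) : eps m n = 1 := by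
  simp [eps, Int.negOnePow_even _ (h.mul_right n)]

theorem eps_odd_left {m : ℤ} (n : ℤ) (h : Odd m) : eps m n = ((n.negOnePow : ℤ) : ℂ) := by
  rcases Int.even_or_odd n with hn | hn
  · simp [eps, Int.negOnePow_even _ hn, Int.negOnePow_even _ (hn.mul_left m)]
  · simp [eps, Int.negOnePow_odd _ hn, Int.negOnePow_odd _ (h.mul hn)]

/-- A `ℤ`-graded Lie superalgebra whose parity is the parity of the degree, presented by a
bilinear bracket, together with the operators that multiply each component by a scalar. -/
structure GradedLieSuper (V : Type) [AddCommGroup V] [Module ℂ V] where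
  br : V →ₗ[ℂ] V →ₗ[ℂ] V
  deg : ℤ → Submodule ℂ V
  scale : (ℤ → ℂ) → V →ₗ[ℂ] V
  iSup_deg : ⨆ n, deg n = ⊤
  scale_apply : ∀ (c : ℤ → ℂ) {n : ℤ} {x : V}, x ∈ deg n → scale c x = c n • x
  br_mem : ∀ {m n : ℤ} {x y : V}, x ∈ deg m → y ∈ deg n → br x y ∈ deg (m + n)
  skew : ∀ {m n : ℤ} {x y : V}, x ∈ deg m → y ∈ deg n → br x y = -eps m n • br y x
  jacobi : ∀ {k m n : ℤ} {x y z : V}, x ∈ deg k → y ∈ deg m → z ∈ deg n →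
    br x (br y z) = br (br x y) z - eps m n • br (br x z) y

namespace GradedLieSuper

variable {V : Type} [AddCommGroup V] [Module ℂ V] (S : GradedLieSuper V)

theorem ext_deg {M : Type} [AddCommGroup M] [Module ℂ M] {f g : V →ₗ[ℂ] M}
    (h : ∀ n, ∀ x ∈ S.deg n, f x = g x) : f = g := by
  have : ⊤ ≤ LinearMap.eqLocus f g := by
    rw [← S.iSup_deg]
    exact iSup_le fun n x hx => h n x hx
  ext x
  exact this (Submodule.mem_top (x := x))

/-- Relations of the enveloping algebra of the negative part, on the tensor algebra of the whole
space. -/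
inductive NegRel : TensorAlgebra ℂ V → TensorAlgebra ℂ V → Prop
  | nonneg {n : ℤ} {x : V} (hn : 0 ≤ n) (hx : x ∈ S.deg n) : NegRel (TensorAlgebra.ι ℂ x) 0
  | super {m n : ℤ} {x y : V} (hm : m < 0) (hn : n < 0) (hx : x ∈ S.deg m) (hy : y ∈ S.deg n) :
      NegRel (TensorAlgebra.ι ℂ x * TensorAlgebra.ι ℂ y)
        (eps m n • (TensorAlgebra.ι ℂ y * TensorAlgebra.ι ℂ x) + TensorAlgebra.ι ℂ (S.br x y))

/-- The enveloping algebra of the negative part. -/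
abbrev NegEnv : Type := RingQuot S.NegRel

/-- The canonical map to the enveloping algebra of the negative part; it kills the components of
nonnegative degree. -/
def toNegEnv : V →ₗ[ℂ] S.NegEnv :=
  (RingQuot.mkAlgHom ℂ S.NegRel).toLinearMap ∘ₗ TensorAlgebra.ι ℂ

theorem toNegEnv_of_nonneg {n : ℤ} {x : V} (hn : 0 ≤ n) (hx : x ∈ S.deg n) :
    S.toNegEnv x = 0 := by
  have := RingQuot.mkAlgHom_rel ℂ (NegRel.nonneg (S := S) hn hx)
  simpa [toNegEnv] using this

theorem toNegEnv_mul {m n : ℤ} {x y : V} (hm : m < 0) (hn : n < 0) (hx : x ∈ S.deg m)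
    (hy : y ∈ S.deg n) : S.toNegEnv x * S.toNegEnv y =
      eps m n • (S.toNegEnv y * S.toNegEnv x) + S.toNegEnv (S.br x y) := by
  have := RingQuot.mkAlgHom_rel ℂ (NegRel.super (S := S) hm hn hx hy)
  simpa [toNegEnv] using this

/-- Generators of nonnegative degree are zero in this algebra, so stability under left
multiplication by the negative ones suffices. -/
theorem NegEnv.induction {P : Submodule ℂ S.NegEnv} (h1 : 1 ∈ P)
    (hm : ∀ n < 0, ∀ y ∈ S.deg n, ∀ u ∈ P, S.toNegEnv y * u ∈ P) (u : S.NegEnv) : u ∈ P := by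
  obtain ⟨t, rfl⟩ := RingQuot.mkAlgHom_surjective ℂ S.NegRel u
  suffices H : ∀ u ∈ P, RingQuot.mkAlgHom ℂ S.NegRel t * u ∈ P by simpa using H 1 h1
  induction t using TensorAlgebra.induction with
  | algebraMap r =>
    intro u hu
    rw [AlgHom.commutes, ← Algebra.smul_def]
    exact P.smul_mem r hu
  | ι x =>
    intro u hu
    have : ⊤ ≤ P.comap ((LinearMap.mul ℂ S.NegEnv).flip u ∘ₗ S.toNegEnv) := by
      rw [← S.iSup_deg]
      refine iSup_le fun n y hy => ?_
      rcases lt_or_ge n 0 with h | h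
      · exact hm n h y hy u hu
      · simp [S.toNegEnv_of_nonneg h hy]
    exact this (Submodule.mem_top (x := x))
  | mul a b ha hb =>
    intro u hu
    rw [map_mul, mul_assoc]
    exact ha _ (hb _ hu)
  | add a b ha hb =>
    intro u hu
    rw [map_add, add_mul]
    exact P.add_mem (ha _ hu) (hb _ hu)

/-- The augmentation of the enveloping algebra of the negative part. -/
def negAug : S.NegEnv →ₐ[ℂ] ℂ :=
  RingQuot.liftAlgHom ℂ ⟨TensorAlgebra.lift ℂ (0 : V →ₗ[ℂ] ℂ), by
    intro a b h
    induction h <;> simp⟩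

theorem negAug_toNegEnv (x : V) : S.negAug (S.toNegEnv x) = 0 := by
  simp [negAug, toNegEnv]

/-- The action of the negative part on the linear maps from the Lie superalgebra (with the adjoint
action) to the enveloping algebra of the negative part. -/
def homAct : V →ₗ[ℂ] Module.End ℂ (V →ₗ[ℂ] S.NegEnv) :=
  LinearMap.mk₂ ℂ (fun y φ =>
    -- The first truncation makes nonnegative y act by zero, as the relations of `NegEnv` require.
    -- The even and odd parts of y are separated because only the odd part sees the parity of the
    -- argument.
    φ ∘ₗ S.br.flip (S.scale (fun n => if n < 0 then 1 else 0) y)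
      + LinearMap.mulLeft ℂ (S.toNegEnv (S.scale (fun n => if Even n then 1 else 0) y)) ∘ₗ φ
      + LinearMap.mulLeft ℂ (S.toNegEnv (S.scale (fun n => if Even n then 0 else 1) y)) ∘ₗ φ ∘ₗ
          S.scale (fun n => ((n.negOnePow : ℤ) : ℂ)))
    (by intros; ext; simp [add_mul]; abel)
    (by intros; ext; simp)
    (by intros; ext; simp [mul_add]; abel)
    (by intros; ext; simp)

/-- This is the rule x (y u) = [x, y] u ± y (x u) of a Verma module, read as an action of y on the
map x ↦ x u. -/
theorem homAct_apply {k m : ℤ} {x y : V} (hm : m < 0) (hx : x ∈ S.deg k) (hy : y ∈ S.deg m)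
    (φ : V →ₗ[ℂ] S.NegEnv) :
    S.homAct y φ x = φ (S.br x y) + eps k m • (S.toNegEnv y * φ x) := by
  rcases Int.even_or_odd m with h | h
  · simp [homAct, S.scale_apply _ hy, hm, h, eps_comm k m, eps_even_left]
  · have h' : ¬ Even m := by simpa using h
    simp [homAct, S.scale_apply _ hx, S.scale_apply _ hy, hm, h', eps_comm k m, eps_odd_left _ h]

theorem homAct_of_nonneg {m : ℤ} {y : V} (hm : 0 ≤ m) (hy : y ∈ S.deg m) : S.homAct y = 0 := by
  ext φ x
  have h := S.toNegEnv_of_nonneg hm hy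
  simp only [homAct, LinearMap.mk₂_apply, S.scale_apply _ hy, hm.not_gt, if_false]
  split_ifs <;> simp [h]

/-- The Jacobi identity accounts for the terms with brackets, and the relation in `NegEnv` for the
terms with left multiplications; the mixed terms cancel. -/
theorem homAct_super {m n : ℤ} {y z : V} (hm : m < 0) (hn : n < 0) (hy : y ∈ S.deg m)
    (hz : z ∈ S.deg n) :
    S.homAct y * S.homAct z = eps m n • (S.homAct z * S.homAct y) + S.homAct (S.br y z) := by
  refine LinearMap.ext fun φ => S.ext_deg fun k x hx => ?_
  simp only [Module.End.mul_apply, LinearMap.add_apply, LinearMap.smul_apply]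
  rw [S.homAct_apply hm hx hy, S.homAct_apply hn hx hz, S.homAct_apply hn hx hz,
    S.homAct_apply hm hx hy, S.homAct_apply hn (S.br_mem hx hy) hz,
    S.homAct_apply hm (S.br_mem hx hz) hy,
    S.homAct_apply (by omega : m + n < 0) hx (S.br_mem hy hz), S.jacobi hx hy hz,
    eq_sub_of_add_eq' (S.toNegEnv_mul hm hn hy hz).symm]
  simp only [mul_add, smul_add, map_sub, map_smul, eps_add_left, eps_add_right, sub_mul, smul_sub,
    mul_smul_comm, smul_mul_assoc, smul_smul, mul_assoc]
  rw [eps_comm n m]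
  have h1 := eps_mul_self m n
  have e1 : eps m n * (eps k m * eps m n) = eps k m := by linear_combination eps k m * h1
  rw [e1]
  module

/-- The linear maps from the Lie superalgebra to the enveloping algebra of the negative part form
a module over the latter. -/
def homRep : S.NegEnv →ₐ[ℂ] Module.End ℂ (V →ₗ[ℂ] S.NegEnv) :=
  RingQuot.liftAlgHom ℂ ⟨TensorAlgebra.lift ℂ S.homAct, by
    intro a b h
    induction h with
    | nonneg hn hx => simp [S.homAct_of_nonneg hn hx]
    | super hm hn hx hy => simp [S.homAct_super hm hn hx hy]⟩

theorem homRep_toNegEnv (x : V) : S.homRep (S.toNegEnv x) = S.homAct x := by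
  simp [homRep, toNegEnv]

variable (χ : V →ₗ[ℂ] ℂ)

/-- The action of the Lie superalgebra on its Verma module, identified with the enveloping algebra
of the negative part. -/
def vermaAct : V →ₗ[ℂ] S.NegEnv →ₗ[ℂ] S.NegEnv :=
  -- The map x ↦ x · 1 is fixed by the highest weight condition; acting on it by u through `homRep`
  -- produces x ↦ x · u. Well-definedness in u is thus automatic.
  ((LinearMap.applyₗ (S.toNegEnv + (Algebra.linearMap ℂ S.NegEnv) ∘ₗ χ)) ∘ₗ
    S.homRep.toLinearMap).flip

theorem vermaAct_one (x : V) :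
    S.vermaAct χ x 1 = S.toNegEnv x + algebraMap ℂ S.NegEnv (χ x) := by
  simp [vermaAct]

theorem vermaAct_mul {k m : ℤ} {x y : V} (hm : m < 0) (hx : x ∈ S.deg k) (hy : y ∈ S.deg m)
    (u : S.NegEnv) : S.vermaAct χ x (S.toNegEnv y * u) =
      S.vermaAct χ (S.br x y) u + eps k m • (S.toNegEnv y * S.vermaAct χ x u) := by
  simp [vermaAct, homRep_toNegEnv, S.homAct_apply hm hx hy, mul_add]
  abel

variable {χ} (hχ : ∀ n ≠ 0, ∀ x ∈ S.deg n, χ x = 0)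
  (hχ0 : ∀ x ∈ S.deg 0, ∀ y ∈ S.deg 0, χ (S.br x y) = 0)

-- Both sides satisfy the same recursion under left multiplication of u by a negative element, so
-- the recursive action agrees with the regular one on the negative part.
include hχ in
theorem vermaAct_neg {k : ℤ} {x : V} (hk : k < 0) (hx : x ∈ S.deg k) (u : S.NegEnv) :
    S.vermaAct χ x u = S.toNegEnv x * u := by
  have := NegEnv.induction S (P := ⨅ k : Set.Iio (0 : ℤ), ⨅ x : S.deg k,
    LinearMap.eqLocus (S.vermaAct χ x) (LinearMap.mulLeft ℂ (S.toNegEnv x))) ?_ ?_ u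
  · simp only [Submodule.mem_iInf] at this
    exact this ⟨k, hk⟩ ⟨x, hx⟩
  · simp only [Submodule.mem_iInf]
    rintro ⟨k, hk⟩ ⟨x, hx⟩
    simp [vermaAct_one, hχ k hk.ne x hx]
  · simp only [Submodule.mem_iInf]
    rintro n hn y hy u hu ⟨k, hk⟩ ⟨x, hx⟩
    have hk' : k < 0 := hk
    have h1 := hu ⟨k, hk⟩ ⟨x, hx⟩
    have h2 := hu ⟨k + n, by simp; omega⟩ ⟨S.br x y, S.br_mem hx hy⟩
    simp only [LinearMap.mem_eqLocus, LinearMap.mulLeft_apply] at h1 h2 ⊢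
    rw [S.vermaAct_mul χ hn hx hy, h1, h2, ← mul_assoc, ← mul_assoc, S.toNegEnv_mul hk' hn hx hy,
      add_mul, smul_mul_assoc, add_comm]

-- Induction on u: the step is the Jacobi identity. At u = 1 a negative factor reduces the claim to
-- the recursion, and two nonnegative factors act by commuting scalars.
include hχ hχ0 in
theorem vermaAct_super {k l : ℤ} {x y : V} (hx : x ∈ S.deg k) (hy : y ∈ S.deg l) :
    S.vermaAct χ x * S.vermaAct χ y =
      eps k l • (S.vermaAct χ y * S.vermaAct χ x) + S.vermaAct χ (S.br x y) := by
  refine LinearMap.ext fun u => ?_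
  have := NegEnv.induction S (P := ⨅ k : ℤ, ⨅ l : ℤ, ⨅ x : S.deg k, ⨅ y : S.deg l,
    LinearMap.eqLocus (S.vermaAct χ x * S.vermaAct χ y : Module.End ℂ S.NegEnv)
      (eps k l • (S.vermaAct χ y * S.vermaAct χ x : Module.End ℂ S.NegEnv)
        + S.vermaAct χ (S.br x y))) ?_ ?_ u
  · simp only [Submodule.mem_iInf] at this
    exact this k l ⟨x, hx⟩ ⟨y, hy⟩
  · simp only [Submodule.mem_iInf]
    rintro k l ⟨x, hx⟩ ⟨y, hy⟩
    simp only [LinearMap.mem_eqLocus, Module.End.mul_apply, LinearMap.add_apply,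
      LinearMap.smul_apply]
    rcases lt_or_ge k 0 with hk | hk
    · rw [S.vermaAct_neg hχ hk hx, S.vermaAct_neg hχ hk hx, S.vermaAct_mul χ hk hy hx,
        S.skew hx hy, map_smul, LinearMap.smul_apply, smul_add, smul_smul, eps_comm l k,
        eps_mul_self]
      module
    rcases lt_or_ge l 0 with hl | hl
    · rw [S.vermaAct_neg hχ hl hy, S.vermaAct_neg hχ hl hy, S.vermaAct_mul χ hl hx hy]
      module
    have hxy : χ (S.br x y) = 0 := by
      by_cases h : k + l = 0
      · obtain rfl : k = 0 := by omega
        obtain rfl : l = 0 := by omega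
        exact hχ0 x hx y hy
      · exact hχ _ h _ (S.br_mem hx hy)
    simp only [vermaAct_one, S.toNegEnv_of_nonneg hk hx, S.toNegEnv_of_nonneg hl hy, hxy,
      S.toNegEnv_of_nonneg (by omega) (S.br_mem hx hy), zero_add, map_zero, add_zero,
      Algebra.algebraMap_eq_smul_one, map_smul, smul_smul]
    -- The product χ(x) χ(y) can be nonzero only in degree zero, where the sign is 1.
    by_cases h : k = 0
    · subst h
      simp [eps, mul_comm]
    · simp [hχ k h x hx]
  · simp only [Submodule.mem_iInf]
    rintro m hm z hz u hu k l ⟨x, hx⟩ ⟨y, hy⟩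
    have h1 := hu k l ⟨x, hx⟩ ⟨y, hy⟩
    have h2 := hu k (l + m) ⟨x, hx⟩ ⟨S.br y z, S.br_mem hy hz⟩
    have h3 := hu (k + m) l ⟨S.br x z, S.br_mem hx hz⟩ ⟨y, hy⟩
    simp only [LinearMap.mem_eqLocus, Module.End.mul_apply, LinearMap.add_apply,
      LinearMap.smul_apply] at h1 h2 h3 ⊢
    rw [S.vermaAct_mul χ hm hx hz, S.vermaAct_mul χ hm hy hz,
      S.vermaAct_mul χ hm (S.br_mem hx hy) hz]
    simp only [map_add, map_smul]
    rw [S.vermaAct_mul χ hm hx hz, S.vermaAct_mul χ hm hy hz, h1, h2, h3, S.jacobi hx hy hz]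
    simp only [map_sub, map_smul, LinearMap.sub_apply, LinearMap.smul_apply, mul_add, smul_add,
      eps_add_left, eps_add_right, mul_smul_comm, smul_smul]
    rw [eps_comm m l]
    have e1 : eps l m * (eps k l * eps l m) = eps k l := by
      linear_combination eps k l * eps_mul_self l m
    rw [e1]
    module

end GradedLieSuper
end SuperCircle

/-! ### Words in negative elements, and finiteness of their spans -/

namespace SuperCircle

/-- The vectors annihilated by a polynomial in `f` that does not vanish at `μ`. -/
def awayFrom {L : Type} [AddCommGroup L] [Module ℂ L] (f : Module.End ℂ L) (μ : ℂ) :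
    Submodule ℂ L where
  carrier := {w | ∃ q : ℂ[X], q.eval μ ≠ 0 ∧ aeval f q w = 0}
  zero_mem' := ⟨1, by simp, by simp⟩
  add_mem' := by
    rintro v w ⟨p, hp, hpv⟩ ⟨q, hq, hqw⟩
    refine ⟨p * q, by simp [hp, hq], ?_⟩
    have h1 : aeval f (p * q) v = 0 := by rw [mul_comm, map_mul, Module.End.mul_apply, hpv, map_zero]
    have h2 : aeval f (p * q) w = 0 := by rw [map_mul, Module.End.mul_apply, hqw, map_zero]
    rw [map_add, h1, h2, add_zero]
  smul_mem' := by
    rintro c w ⟨q, hq, hqw⟩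
    exact ⟨q, hq, by rw [map_smul, hqw, smul_zero]⟩

theorem mem_awayFrom_of_eigen {L : Type} [AddCommGroup L] [Module ℂ L] {f : Module.End ℂ L}
    {μ ν : ℂ} (h : μ ≠ ν) {w : L} (hw : f w = ν • w) : w ∈ awayFrom f μ :=
  ⟨X - C ν, by simpa [sub_eq_zero] using h, by simp [hw]⟩

theorem aeval_eigen {L : Type} [AddCommGroup L] [Module ℂ L] {f : Module.End ℂ L}
    {μ : ℂ} {w : L} (hw : f w = μ • w) (q : ℂ[X]) : aeval f q w = q.eval μ • w := by
  induction q using Polynomial.induction_on' with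
  | add p q hp hq => simp [hp, hq, add_smul]
  | monomial n a =>
    have : ∀ n : ℕ, (f ^ n) w = μ ^ n • w := by
      intro n
      induction n with
      | zero => simp
      | succ n ih => rw [pow_succ', Module.End.mul_apply, ih, map_smul, hw, smul_smul, pow_succ]
    simp [aeval_monomial, this, smul_smul, Algebra.algebraMap_eq_smul_one]

/-- This replaces the independence of eigenspaces: sums of eigenvectors with eigenvalues other than
μ lie in `awayFrom f μ`. -/
theorem eq_zero_of_mem_awayFrom {L : Type} [AddCommGroup L] [Module ℂ L] {f : Module.End ℂ L}
    {μ : ℂ} {w : L} (hw : f w = μ • w) (h : w ∈ awayFrom f μ) : w = 0 := by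
  obtain ⟨q, hq, hqw⟩ := h
  rw [aeval_eigen hw] at hqw
  exact (smul_eq_zero.1 hqw).resolve_left hq

namespace GradedLieSuper

variable {V : Type} [AddCommGroup V] [Module ℂ V] (S : GradedLieSuper V)
  {L : Type} [AddCommGroup L] [Module ℂ L]

/-- `ρ` is a representation of the Lie superalgebra. -/
def IsRep (ρ : V →ₗ[ℂ] Module.End ℂ L) : Prop :=
  ∀ {k l : ℤ} {x y : V}, x ∈ S.deg k → y ∈ S.deg l → ∀ w : L,
    ρ x (ρ y w) = eps k l • ρ y (ρ x w) + ρ (S.br x y) w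

/-- Words in elements of negative degree applied to a vector of `W`. -/
inductive NegWord (ρ : V →ₗ[ℂ] Module.End ℂ L) (W : Submodule ℂ L) : ℤ → L → Prop
  | base {w : L} (hw : w ∈ W) : NegWord ρ W 0 w
  | act {k l : ℤ} {y : V} {w : L} (hl : l < 0) (hy : y ∈ S.deg l) (hw : NegWord ρ W k w) :
      NegWord ρ W (k + l) (ρ y w)

/-- The span of the words of degree `k`. -/
def negSpan (ρ : V →ₗ[ℂ] Module.End ℂ L) (W : Submodule ℂ L) (k : ℤ) : Submodule ℂ L :=
  Submodule.span ℂ {w | S.NegWord ρ W k w}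

variable {S} {ρ : V →ₗ[ℂ] Module.End ℂ L} {W : Submodule ℂ L}

theorem NegWord.le {k : ℤ} {w : L} (h : S.NegWord ρ W k w) : k ≤ 0 := by
  induction h with
  | base => exact le_rfl
  | act hl _ _ ih => omega

theorem NegWord.base_or_lt {k : ℤ} {w : L} (h : S.NegWord ρ W k w) : (k = 0 ∧ w ∈ W) ∨ k < 0 := by
  cases h with
  | base hw => exact .inl ⟨rfl, hw⟩
  | act hl _ h => exact .inr (by have := h.le; omega)

theorem act_mem_negSpan_of_neg {k l : ℤ} {y : V} {w : L} (hl : l < 0) (hy : y ∈ S.deg l)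
    (hw : w ∈ S.negSpan ρ W k) : ρ y w ∈ S.negSpan ρ W (k + l) := by
  refine (Submodule.span_le (p := (S.negSpan ρ W (k + l)).comap (ρ y))).2 ?_ hw
  intro w hw
  exact Submodule.subset_span (NegWord.act hl hy hw)

/-- A nonnegative element is commuted to the right past the negative letters until it reaches W. The
brackets that appear may have any degree, hence the generalization over m; this plays the part of
the triangular decomposition. -/
theorem act_mem_negSpan (hρ : S.IsRep ρ) (h0 : ∀ h ∈ S.deg 0, ∀ w ∈ W, ρ h w ∈ W)
    (hpos : ∀ n > 0, ∀ x ∈ S.deg n, ∀ w ∈ W, ρ x w = 0) {k m : ℤ} {x : V} {w : L}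
    (hx : x ∈ S.deg m) (hw : w ∈ S.negSpan ρ W k) : ρ x w ∈ S.negSpan ρ W (k + m) := by
  refine (Submodule.span_le (p := (S.negSpan ρ W (k + m)).comap (ρ x))).2 ?_ hw
  clear hw
  intro w hw
  change ρ x w ∈ S.negSpan ρ W (k + m)
  rcases lt_or_ge m 0 with hm | hm
  · exact act_mem_negSpan_of_neg hm hx (Submodule.subset_span hw)
  clear hm
  induction hw generalizing m x with
  | base hw =>
    rcases lt_trichotomy m 0 with hm | rfl | hm
    · exact Submodule.subset_span (NegWord.act hm hx (.base hw))
    · exact Submodule.subset_span (NegWord.base (h0 x hx _ hw))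
    · rw [hpos m hm x hx _ hw]
      exact zero_mem _
  | @act k l y w hl hy hw ih =>
    rw [hρ hx hy]
    refine add_mem (Submodule.smul_mem _ _ ?_) ?_
    · have := act_mem_negSpan_of_neg hl hy (ih hx)
      rwa [show k + l + m = k + m + l by ring]
    · have := ih (S.br_mem hx hy)
      rwa [show k + l + m = k + (m + l) by ring]

theorem act_mem_iSup_negSpan (hρ : S.IsRep ρ) (h0 : ∀ h ∈ S.deg 0, ∀ w ∈ W, ρ h w ∈ W)
    (hpos : ∀ n > 0, ∀ x ∈ S.deg n, ∀ w ∈ W, ρ x w = 0) (x : V) {w : L}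
    (hw : w ∈ ⨆ k, S.negSpan ρ W k) : ρ x w ∈ ⨆ k, S.negSpan ρ W k := by
  have : ⊤ ≤ (⨆ k, S.negSpan ρ W k).comap (ρ.flip w) := by
    rw [← S.iSup_deg]
    refine iSup_le fun n x hx => ?_
    refine (iSup_le (a := (⨆ k, S.negSpan ρ W k).comap (ρ x)) fun k w hw => ?_) hw
    exact Submodule.mem_iSup_of_mem (k + n) (act_mem_negSpan hρ h0 hpos hx hw)
  exact this (Submodule.mem_top (x := x))

theorem negWord_eigen (hρ : S.IsRep ρ) {d : V} (hd0 : d ∈ S.deg 0)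
    (hd : ∀ n, ∀ x ∈ S.deg n, S.br d x = ((n : ℂ) / 2) • x) {μ : ℂ}
    (hμ : ∀ w ∈ W, ρ d w = μ • w) {k : ℤ} {w : L} (hw : S.NegWord ρ W k w) :
    ρ d w = (μ + (k : ℂ) / 2) • w := by
  induction hw with
  | base hw => simp [hμ _ hw]
  | @act k l y w hl hy hw ih =>
    rw [hρ hd0 hy, ih, hd _ _ hy, eps_even_left _ (by simp), map_smul, map_smul,
      LinearMap.smul_apply, one_smul, ← add_smul]
    congr 1
    push_cast
    ring

/-- Each component of the Lie superalgebra moves `w` within a finite-dimensional space. -/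
def FinOrbit (S : GradedLieSuper V) (ρ : V →ₗ[ℂ] Module.End ℂ L) (w : L) : Prop :=
  ∀ n, FiniteDimensional ℂ ((S.deg n).map (ρ.flip w))

/-- From x y w = ± y x w + [x, y] w, the orbit of y w lies in y (g_n w) + g_{n+l} w. -/
theorem FinOrbit.act (hρ : S.IsRep ρ) {l : ℤ} {y : V} (hy : y ∈ S.deg l) {w : L}
    (hw : S.FinOrbit ρ w) : S.FinOrbit ρ (ρ y w) := by
  intro n
  have := hw n
  have := hw (n + l)
  refine Submodule.finiteDimensional_of_le
    (S₂ := ((S.deg n).map (ρ.flip w)).map (ρ y) ⊔ (S.deg (n + l)).map (ρ.flip w)) ?_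
  rintro _ ⟨x, hx, rfl⟩
  rw [LinearMap.flip_apply, hρ hx hy]
  refine Submodule.add_mem_sup (Submodule.smul_mem _ _ ?_) ?_
  · exact Submodule.mem_map_of_mem (Submodule.mem_map_of_mem (f := ρ.flip w) hx)
  · exact Submodule.mem_map_of_mem (f := ρ.flip w) (S.br_mem hx hy)

theorem NegWord.finOrbit (hρ : S.IsRep ρ) (hW : ∀ w ∈ W, S.FinOrbit ρ w) {k : ℤ} {w : L}
    (h : S.NegWord ρ W k w) : S.FinOrbit ρ w := by
  induction h with
  | base hw => exact hW _ hw
  | act _ hy _ ih => exact ih.act hρ hy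

/-- Induction on depth: stripping the leftmost letter of a word leaves a word of smaller depth, and
only finitely many degrees are possible for that letter. -/
theorem finiteDimensional_negSpan (hρ : S.IsRep ρ) [FiniteDimensional ℂ W]
    (hW : ∀ w ∈ W, S.FinOrbit ρ w) (k : ℤ) : FiniteDimensional ℂ (S.negSpan ρ W k) := by
  suffices H : ∀ n : ℕ, ∀ k : ℤ, -n ≤ k → FiniteDimensional ℂ (S.negSpan ρ W k) from
    H k.natAbs k (by omega)
  intro n
  induction n with
  | zero =>
    intro k hk
    refine Submodule.finiteDimensional_of_le (S₂ := W) (Submodule.span_le.2 fun w hw => ?_)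
    rcases NegWord.base_or_lt hw with h | h
    · exact h.2
    · simp at hk
      omega
  | succ n ih =>
    intro k hk
    have key : ∀ l ∈ Finset.Icc (-(n + 1 : ℤ)) (-1),
        FiniteDimensional ℂ (Submodule.map₂ ρ (S.deg l) (S.negSpan ρ W (k - l))) := by
      intro l hl
      rw [Finset.mem_Icc] at hl
      have := ih (k - l) (by push_cast at hk; omega)
      -- The finite spanning set is chosen among the words themselves, since `FinOrbit` is available
      -- for words.
      obtain ⟨s, hs, hs'⟩ := (Submodule.fg_span_iff_fg_span_finset_subset _).1
        (Module.Finite.iff_fg.1 this)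
      have : FiniteDimensional ℂ ↥(s.sup fun w => (S.deg l).map (ρ.flip w)) :=
        Module.Finite.iff_fg.2 (Submodule.fg_finset_sup _ _ fun w hw =>
          Module.Finite.iff_fg.1 (NegWord.finOrbit hρ hW (hs hw) l))
      refine Submodule.finiteDimensional_of_le
        (S₂ := s.sup fun w => (S.deg l).map (ρ.flip w)) (Submodule.map₂_le.2 fun x hx w hw => ?_)
      rw [negSpan, hs'] at hw
      refine (Submodule.span_le (p := (s.sup fun w => (S.deg l).map (ρ.flip w)).comap (ρ x))).2
        (fun w hw => ?_) hw
      exact Finset.le_sup (f := fun w => (S.deg l).map (ρ.flip w)) hw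
        (Submodule.mem_map_of_mem (f := ρ.flip w) hx)
    have : FiniteDimensional ℂ ↥(W ⊔ (Finset.Icc (-(n + 1 : ℤ)) (-1)).sup fun l =>
        Submodule.map₂ ρ (S.deg l) (S.negSpan ρ W (k - l))) := by
      have : FiniteDimensional ℂ ↥((Finset.Icc (-(n + 1 : ℤ)) (-1)).sup fun l =>
          Submodule.map₂ ρ (S.deg l) (S.negSpan ρ W (k - l))) :=
        Module.Finite.iff_fg.2 (Submodule.fg_finset_sup _ _ fun l hl =>
          Module.Finite.iff_fg.1 (key l hl))
      infer_instance
    refine Submodule.finiteDimensional_of_le (S₂ := W ⊔ (Finset.Icc (-(n + 1 : ℤ)) (-1)).sup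
      fun l => Submodule.map₂ ρ (S.deg l) (S.negSpan ρ W (k - l)))
      (Submodule.span_le.2 fun w hw => ?_)
    cases hw with
    | base hw => exact Submodule.mem_sup_left hw
    | @act k l y w hl hy hw =>
      refine Submodule.mem_sup_right ?_
      have hle := hw.le
      refine Finset.le_sup (f := fun l' => Submodule.map₂ ρ (S.deg l')
        (S.negSpan ρ W (k + l - l'))) (b := l) (by simp; push_cast at hk; omega) ?_
      refine Submodule.apply_mem_map₂ _ hy ?_
      rw [add_sub_cancel_right]
      exact Submodule.subset_span hw

end GradedLieSuper
end SuperCircle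

/-! ### The superbracket as a supercommutator in an associative algebra -/

namespace SuperCircle

theorem shift_add (s : ℤ) (F G : Mat) : shift s (F + G) = shift s F + shift s G := by
  ext1 i j; simp [shift]

theorem shift_smul (s : ℤ) (c : ℂ) (F : Mat) : shift s (c • F) = c • shift s F := by
  ext1 i j; simp [shift, smul_comp]

theorem shift_mul (s : ℤ) (F G : Mat) : shift s (F * G) = shift s F * shift s G := by
  ext1 i j; simp [shift, Matrix.mul_apply]

theorem shift_shift (s u : ℤ) (F : Mat) : shift u (shift s F) = shift (s + u) F := by
  ext1 i j
  simp only [shift, Matrix.map_apply, comp_assoc]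
  congr 1
  simp
  ring

/-- The bilinear extension to `SD` of a family of bilinear maps of coefficients. -/
def bilinearSum (f : ℤ → ℤ → Mat →ₗ[ℂ] Mat →ₗ[ℂ] SD) : SD →ₗ[ℂ] SD →ₗ[ℂ] SD :=
  Finsupp.lsum ℂ fun r => (Finsupp.lsum ℂ : (ℤ → Mat →ₗ[ℂ] SD) ≃ₗ[ℂ] _).toLinearMap ∘ₗ
    LinearMap.pi (f r)

theorem bilinearSum_apply (f : ℤ → ℤ → Mat →ₗ[ℂ] Mat →ₗ[ℂ] SD) (A B : SD) :
    bilinearSum f A B = A.sum fun r F => B.sum fun s G => f r s F G := by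
  simp [bilinearSum, Finsupp.sum, LinearMap.sum_apply]

/-- The product of differential operators on the super circle. -/
def mulL : SD →ₗ[ℂ] SD →ₗ[ℂ] SD :=
  bilinearSum fun r s => LinearMap.mk₂ ℂ (fun F G => Finsupp.single (r + s) (shift s F * G))
    (by intros; simp [shift_add, add_mul])
    (by intros; rw [shift_smul, smul_mul_assoc, Finsupp.smul_single])
    (by intros; simp [mul_add])
    (by intros; rw [mul_smul_comm, Finsupp.smul_single])

theorem mulL_apply (A B : SD) : mulL A B =
    A.sum fun r F => B.sum fun s G => Finsupp.single (r + s) (shift s F * G) := by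
  simp [mulL, bilinearSum_apply]

theorem mulL_single (r s : ℤ) (F G : Mat) : mulL (Finsupp.single r F) (Finsupp.single s G) =
    Finsupp.single (r + s) (shift s F * G) := by
  rw [mulL_apply, Finsupp.sum_single_index, Finsupp.sum_single_index] <;> simp [shift]

theorem mulL_assoc (A B C : SD) : mulL (mulL A B) C = mulL A (mulL B C) := by
  induction A using Finsupp.induction_linear with
  | zero => simp
  | add A A' hA hA' => simp [hA, hA']
  | single r F =>
    induction B using Finsupp.induction_linear with
    | zero => simp
    | add A A' hA hA' => simp [hA, hA']
    | single s G =>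
      induction C using Finsupp.induction_linear with
      | zero => simp
      | add A A' hA hA' => simp [hA, hA']
      | single u H =>
        rw [mulL_single, mulL_single, mulL_single, mulL_single, shift_mul, shift_shift, add_assoc,
          mul_assoc]

theorem superComm_add_left (r s : ℤ) (F F' G : Mat) :
    superComm r s (F + F') G = superComm r s F G + superComm r s F' G := by
  ext1 i j
  simp only [superComm, shift_add, Matrix.of_apply, Matrix.add_apply, ← Finset.sum_add_distrib]
  exact Finset.sum_congr rfl fun _ _ => by ring

theorem superComm_add_right (r s : ℤ) (F G G' : Mat) :
    superComm r s F (G + G') = superComm r s F G + superComm r s F G' := by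
  ext1 i j
  simp only [superComm, shift_add, Matrix.of_apply, Matrix.add_apply, ← Finset.sum_add_distrib]
  exact Finset.sum_congr rfl fun _ _ => by ring

theorem superComm_smul_left (r s : ℤ) (c : ℂ) (F G : Mat) :
    superComm r s (c • F) G = c • superComm r s F G := by
  ext1 i j
  simp only [superComm, shift_smul, Matrix.of_apply, Matrix.smul_apply, Finset.smul_sum,
    smul_eq_C_mul]
  exact Finset.sum_congr rfl fun _ _ => by ring

theorem superComm_smul_right (r s : ℤ) (c : ℂ) (F G : Mat) :
    superComm r s F (c • G) = c • superComm r s F G := by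
  ext1 i j
  simp only [superComm, shift_smul, Matrix.of_apply, Matrix.smul_apply, Finset.smul_sum,
    smul_eq_C_mul]
  exact Finset.sum_congr rfl fun _ _ => by ring

/-- The superbracket as a bilinear map. -/
def bracketL : SD →ₗ[ℂ] SD →ₗ[ℂ] SD :=
  bilinearSum fun r s => LinearMap.mk₂ ℂ (fun F G => Finsupp.single (r + s) (superComm r s F G))
    (by intros; simp [superComm_add_left])
    (by intros; simp [superComm_smul_left])
    (by intros; simp [superComm_add_right])
    (by intros; simp [superComm_smul_right])

theorem bracketL_apply (A B : SD) : bracketL A B = bracket A B := by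
  simp [bracketL, bilinearSum_apply, bracket]

theorem bracket_single (r s : ℤ) (F G : Mat) : bracket (Finsupp.single r F) (Finsupp.single s G) =
    Finsupp.single (r + s) (superComm r s F G) := by
  have h1 : superComm r s F 0 = 0 := by simpa using superComm_smul_right r s 0 F G
  have h2 : ∀ s G, superComm r s 0 G = 0 := fun s G => by
    simpa using superComm_smul_left r s 0 F G
  rw [bracket, Finsupp.sum_single_index, Finsupp.sum_single_index] <;> simp [h1, h2]

/-- Parity-homogeneous supermatrices. -/
def HasMatParity {R : Type} [Zero R] (n : ℤ) (F : Matrix (Fin 2) (Fin 2) R) : Prop :=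
  ∀ i j, F i j ≠ 0 → Even ((i : ℤ) + (j : ℤ) - n)

theorem neg_one_pow_eq_eps {a b : ℕ} {m n : ℤ} (ha : Even ((a : ℤ) - n)) (hb : Even ((b : ℤ) - m)) :
    (-1 : ℂ[X]) ^ (a * b) = C (eps m n) := by
  have h : Even (m * n - (a * b : ℕ)) := by
    obtain ⟨x, hx⟩ := ha
    obtain ⟨y, hy⟩ := hb
    exact ⟨-y * a - x * m, by push_cast; linear_combination -a * hy - m * hx⟩
  have e : eps m n = (-1) ^ (a * b) := by
    rw [eps, show m * n = (m * n - (a * b : ℕ)) + (a * b : ℕ) by ring, Int.negOnePow_add,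
      Int.negOnePow_even _ h]
    simp [Int.natAbs_mul]
  rw [e]
  simp

/-- For parity-homogeneous matrices the entrywise signs collapse to one global sign wherever the
product of entries is nonzero. -/
theorem superComm_eq {m n : ℤ} (r s : ℤ) {F G : Mat} (hF : HasMatParity m F)
    (hG : HasMatParity n G) :
    superComm r s F G = shift s F * G - eps m n • (shift r G * F) := by
  ext1 i j
  simp only [superComm, Matrix.of_apply, Matrix.sub_apply, Matrix.mul_apply, Matrix.smul_apply,
    Finset.smul_sum, ← Finset.sum_sub_distrib]
  refine Finset.sum_congr rfl fun k _ => ?_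
  congr 1
  by_cases h1 : G i k = 0
  · simp [shift, h1]
  by_cases h2 : F k j = 0
  · simp [h2]
  rw [neg_one_pow_eq_eps (by exact_mod_cast hG i k h1) (by exact_mod_cast hF k j h2),
    smul_eq_C_mul]

/-- The principal gradation (with degrees doubled) of `SD`. -/
def sdDeg (n : ℤ) : Submodule ℂ SD where
  carrier := {A | ∀ (r : ℤ) (i j : Fin 2), A r i j ≠ 0 → 2 * r + (i : ℤ) - (j : ℤ) = n}
  zero_mem' := by simp
  add_mem' {A B} hA hB := by
    intro r i j h
    by_cases h1 : A r i j = 0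
    · exact hB r i j fun h2 => h (by simp [h1, h2])
    · exact hA r i j h1
  smul_mem' c A hA r i j h := hA r i j fun h1 => h (by simp [h1])

theorem matParity_of_mem_sdDeg {n : ℤ} {A : SD} (hA : A ∈ sdDeg n) (r : ℤ) :
    HasMatParity n (A r) := fun i j h => by
  have := hA r i j h
  exact ⟨j - r, by omega⟩

theorem sdDeg_le {n : ℤ} {P : Submodule ℂ SD}
    (h : ∀ r F, HasMatParity n F → Finsupp.single r F ∈ P) : sdDeg n ≤ P := fun A hA => by
  rw [← Finsupp.sum_single A]
  exact Submodule.sum_mem _ fun r _ => h r _ (matParity_of_mem_sdDeg hA r)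

theorem sdDeg_ext {n : ℤ} {M : Type} [AddCommGroup M] [Module ℂ M] {f g : SD →ₗ[ℂ] M}
    (h : ∀ r F, HasMatParity n F → f (Finsupp.single r F) = g (Finsupp.single r F)) {A : SD}
    (hA : A ∈ sdDeg n) : f A = g A :=
  sdDeg_le (P := LinearMap.eqLocus f g) (fun r F hF => h r F hF) hA

theorem bracketL_eq {m n : ℤ} {A B : SD} (hA : A ∈ sdDeg m) (hB : B ∈ sdDeg n) :
    bracketL A B = mulL A B - eps m n • mulL B A := by
  suffices H : ∀ r F, HasMatParity m F → bracketL (Finsupp.single r F) B =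
      mulL (Finsupp.single r F) B - eps m n • mulL B (Finsupp.single r F) by
    have := sdDeg_ext (f := bracketL.flip B) (g := mulL.flip B - eps m n • mulL B)
      (fun r F hF => by simpa using H r F hF) hA
    simpa using this
  intro r F hF
  have := sdDeg_ext (f := bracketL (Finsupp.single r F))
    (g := mulL (Finsupp.single r F) - eps m n • mulL.flip (Finsupp.single r F)) (fun s G hG => by
      simp [bracketL_apply, bracket_single, mulL_single, superComm_eq r s hF hG, add_comm s r,
        -Finsupp.single_mul]) hB
  simpa using this

theorem mulL_mem {m n : ℤ} {A B : SD} (hA : A ∈ sdDeg m) (hB : B ∈ sdDeg n) :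
    mulL A B ∈ sdDeg (m + n) := by
  rw [mulL_apply]
  refine Submodule.sum_mem _ fun r _ => Submodule.sum_mem _ fun s _ => ?_
  intro t i j h
  by_cases ht : r + s = t
  · subst ht
    simp only [Finsupp.single_eq_same, Matrix.mul_apply] at h
    obtain ⟨k, -, hk⟩ := Finset.exists_ne_zero_of_sum_ne_zero h
    have h1 := hB s k j (right_ne_zero_of_mul hk)
    have h2 := hA r i k fun h0 => left_ne_zero_of_mul hk (by simp [shift, h0])
    linarith
  · simp [ht] at h

theorem bracketL_mem {m n : ℤ} {A B : SD} (hA : A ∈ sdDeg m) (hB : B ∈ sdDeg n) :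
    bracketL A B ∈ sdDeg (m + n) := by
  rw [bracketL_eq hA hB]
  refine sub_mem (mulL_mem hA hB) (Submodule.smul_mem _ _ ?_)
  rw [add_comm]
  exact mulL_mem hB hA

theorem eps_eq_or (m n : ℤ) : eps m n = 1 ∨ eps m n = -1 := by
  rcases Int.units_eq_one_or ((m * n).negOnePow) with h | h <;> simp [eps, h]

theorem bracketL_skew {m n : ℤ} {A B : SD} (hA : A ∈ sdDeg m) (hB : B ∈ sdDeg n) :
    bracketL A B = -eps m n • bracketL B A := by
  rw [bracketL_eq hA hB, bracketL_eq hB hA, eps_comm n m]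
  rcases eps_eq_or m n with h | h <;> rw [h] <;> module

/-- A formal consequence of associativity once brackets are expanded as supercommutators; the three
signs are checked case by case. -/
theorem bracketL_jacobi {k m n : ℤ} {A B C : SD} (hA : A ∈ sdDeg k) (hB : B ∈ sdDeg m)
    (hC : C ∈ sdDeg n) : bracketL A (bracketL B C) =
      bracketL (bracketL A B) C - eps m n • bracketL (bracketL A C) B := by
  rw [bracketL_eq hA (bracketL_mem hB hC), bracketL_eq (bracketL_mem hA hB) hC,
    bracketL_eq (bracketL_mem hA hC) hB, bracketL_eq hB hC, bracketL_eq hA hB, bracketL_eq hA hC]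
  simp only [map_sub, map_smul, LinearMap.sub_apply, LinearMap.smul_apply, mulL_assoc,
    eps_add_left, eps_add_right, eps_comm n m]
  rcases eps_eq_or m n with h | h <;> rcases eps_eq_or k n with h' | h' <;>
    rcases eps_eq_or k m with h'' | h'' <;> rw [h, h', h''] <;> module

end SuperCircle

/-! ### The two-cocycle: skew-symmetry and the cyclic identity -/

namespace SuperCircle

/-- The oriented sum of `f` from `a` to `b`. -/
def orientedSum (a b : ℤ) (f : ℤ → ℂ) : ℂ := ∑ j ∈ Finset.Ico a b, f j - ∑ j ∈ Finset.Ico b a, f j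

theorem sum_Ico_eq_sub {f g : ℤ → ℂ} (h : ∀ j, g (j + 1) - g j = f j) {a b : ℤ} (hab : a ≤ b) :
    ∑ j ∈ Finset.Ico a b, f j = g b - g a := by
  induction b, hab using Int.leInduction with
  | base => simp
  | succ b hb ih =>
    have : Finset.Ico a (b + 1) = insert b (Finset.Ico a b) := by ext; simp; omega
    rw [this, Finset.sum_insert (by simp), ih, ← h b]
    ring

theorem orientedSum_eq_sub {f g : ℤ → ℂ} (h : ∀ j, g (j + 1) - g j = f j) (a b : ℤ) :
    orientedSum a b f = g b - g a := by
  rcases le_total a b with hab | hab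
  · rw [orientedSum, sum_Ico_eq_sub h hab, Finset.Ico_eq_empty (by omega)]
    simp
  · rw [orientedSum, sum_Ico_eq_sub h hab, Finset.Ico_eq_empty (by omega)]
    simp

theorem exists_antidifference (f : ℤ → ℂ) : ∃ g : ℤ → ℂ, ∀ j, g (j + 1) - g j = f j := by
  refine ⟨fun c => orientedSum 0 c f, fun j => ?_⟩
  rcases lt_or_ge j 0 with h | h
  · have h1 : Finset.Ico j 0 = insert j (Finset.Ico (j + 1) 0) := by ext; simp; omega
    simp only [orientedSum]
    rw [h1, Finset.sum_insert (by simp), Finset.Ico_eq_empty (by omega : ¬ 0 < j + 1),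
      Finset.Ico_eq_empty (by omega : ¬ 0 < j)]
    simp
  · have h1 : Finset.Ico 0 (j + 1) = insert j (Finset.Ico 0 j) := by ext; simp; omega
    simp only [orientedSum]
    rw [h1, Finset.sum_insert (by simp), Finset.Ico_eq_empty (by omega : ¬ j < 0),
      Finset.Ico_eq_empty (by omega : ¬ j + 1 < 0)]
    simp

/-- Oriented sums are differences of an antidifference, so they add like integrals, whatever the
order of the endpoints. -/
theorem orientedSum_add (a b c : ℤ) (f : ℤ → ℂ) :
    orientedSum a b f + orientedSum b c f = orientedSum a c f := by
  obtain ⟨g, hg⟩ := exists_antidifference f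
  simp [orientedSum_eq_sub hg]

theorem orientedSum_comp_add (a b s : ℤ) (f : ℤ → ℂ) :
    orientedSum a b (fun j => f (j + s)) = orientedSum (a + s) (b + s) f := by
  obtain ⟨g, hg⟩ := exists_antidifference f
  rw [orientedSum_eq_sub hg, orientedSum_eq_sub (g := fun j => g (j + s))]
  intro j
  rw [← hg]
  ring_nf

theorem orientedSum_swap (a b : ℤ) (f : ℤ → ℂ) : orientedSum a b f = -orientedSum b a f := by
  simp [orientedSum]

theorem orientedSum_mul (a b : ℤ) (f : ℤ → ℂ) (c : ℂ) :
    orientedSum a b (fun j => c * f j) = c * orientedSum a b f := by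
  simp [orientedSum, mul_sub, Finset.mul_sum]

theorem orientedSum_add_fun (a b : ℤ) (f g : ℤ → ℂ) :
    orientedSum a b (fun j => f j + g j) = orientedSum a b f + orientedSum a b g := by
  simp only [orientedSum, Finset.sum_add_distrib]
  ring

/-- The supertrace. -/
def str (P : Matrix (Fin 2) (Fin 2) ℂ) : ℂ := P 0 0 - P 1 1

/-- The matrix `F(x)`. -/
def evalMat (x : ℂ) (F : Mat) : Matrix (Fin 2) (Fin 2) ℂ := F.map (eval x)

theorem strMul_eq (F G : Mat) (x y : ℂ) : strMul F G x y = str (evalMat x F * evalMat y G) := by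
  simp [strMul, str, evalMat, Matrix.mul_apply]

theorem evalMat_mul (x : ℂ) (F G : Mat) : evalMat x (F * G) = evalMat x F * evalMat x G := by
  ext i j; simp [evalMat, Matrix.mul_apply]

theorem evalMat_shift (x : ℂ) (s : ℤ) (F : Mat) : evalMat x (shift s F) = evalMat (x + s) F := by
  ext i j; simp [evalMat, shift]

theorem HasMatParity.evalMat {n : ℤ} {F : Mat} (hF : HasMatParity n F) (x : ℂ) :
    HasMatParity n (evalMat x F) := fun i j h => hF i j fun h0 => h (by simp [SuperCircle.evalMat, h0])

theorem HasMatParity.mul {R : Type} [CommRing R] {m n : ℤ} {P Q : Matrix (Fin 2) (Fin 2) R}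
    (hP : HasMatParity m P) (hQ : HasMatParity n Q) : HasMatParity (m + n) (P * Q) := by
  intro i j h
  rw [Matrix.mul_apply] at h
  obtain ⟨k, -, hk⟩ := Finset.exists_ne_zero_of_sum_ne_zero h
  obtain ⟨a, ha⟩ := hP i k (left_ne_zero_of_mul hk)
  obtain ⟨b, hb⟩ := hQ k j (right_ne_zero_of_mul hk)
  exact ⟨a + b - k, by omega⟩

theorem HasMatParity.eq_zero {R : Type} [Zero R] {n : ℤ} {P : Matrix (Fin 2) (Fin 2) R}
    (hP : HasMatParity n P) (i j : Fin 2) (h : ¬ Even ((i : ℤ) + (j : ℤ) - n)) : P i j = 0 :=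
  not_not.1 fun h0 => h (hP i j h0)

theorem str_mul_comm {m n : ℤ} {P Q : Matrix (Fin 2) (Fin 2) ℂ} (hP : HasMatParity m P)
    (hQ : HasMatParity n Q) : str (P * Q) = eps m n * str (Q * P) := by
  have off : ∀ {n : ℤ} {P : Matrix (Fin 2) (Fin 2) ℂ}, HasMatParity n P → Even n →
      P 0 1 = 0 ∧ P 1 0 = 0 := fun h he =>
    ⟨h.eq_zero _ _ (by simpa [Int.even_sub, parity_simps] using he),
      h.eq_zero _ _ (by simpa [Int.even_sub, parity_simps] using he)⟩
  have diag : ∀ {n : ℤ} {P : Matrix (Fin 2) (Fin 2) ℂ}, HasMatParity n P → Odd n →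
      P 0 0 = 0 ∧ P 1 1 = 0 := fun h he =>
    ⟨h.eq_zero _ _ (by simpa [Int.even_sub, parity_simps] using he),
      h.eq_zero _ _ (by simpa [Int.even_sub, parity_simps] using he)⟩
  simp only [str, Matrix.mul_apply, Fin.sum_univ_two]
  rcases Int.even_or_odd m with hm | hm <;> rcases Int.even_or_odd n with hn | hn
  · rw [eps_even_left _ hm, (off hP hm).1, (off hP hm).2]
    ring
  · rw [(off hP hm).1, (off hP hm).2, (diag hQ hn).1, (diag hQ hn).2]
    ring
  · rw [(off hQ hn).1, (off hQ hn).2, (diag hP hm).1, (diag hP hm).2]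
    ring
  · rw [eps_odd_left _ hm, Int.negOnePow_odd _ hn, (diag hP hm).1, (diag hP hm).2]
    push_cast
    ring

theorem cocycle_eq (A B : SD) : cocycle A B = A.sum fun r F =>
    orientedSum (-r) 0 fun j => strMul F (B (-r)) j ((j + r : ℤ) : ℂ) := rfl

/-- The cocycle as a bilinear map. -/
def cocycleL : SD →ₗ[ℂ] SD →ₗ[ℂ] ℂ :=
  LinearMap.mk₂ ℂ cocycle
    (by
      intro A A' B
      simp only [cocycle_eq]
      refine Finsupp.sum_add_index' (fun r => ?_) fun r F F' => ?_
      · simp [orientedSum, strMul]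
      · rw [← orientedSum_add_fun]
        congr 1
        funext j
        simp [strMul]
        ring)
    (by
      intro c A B
      simp only [cocycle_eq]
      rw [Finsupp.sum_smul_index' (fun r => by simp [orientedSum, strMul]), Finsupp.smul_sum]
      refine Finsupp.sum_congr fun r _ => ?_
      rw [smul_eq_mul, ← orientedSum_mul]
      congr 1
      funext j
      simp [strMul]
      ring)
    (by
      intro A B B'
      simp only [cocycle_eq]
      rw [← Finsupp.sum_add]
      refine Finsupp.sum_congr fun r _ => ?_
      rw [← orientedSum_add_fun]
      congr 1
      funext j
      simp [strMul]
      ring)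
    (by
      intro c A B
      simp only [cocycle_eq]
      rw [Finsupp.smul_sum]
      refine Finsupp.sum_congr fun r _ => ?_
      rw [smul_eq_mul, ← orientedSum_mul]
      congr 1
      funext j
      simp [strMul]
      ring)

theorem cocycleL_apply (A B : SD) : cocycleL A B = cocycle A B := rfl

theorem cocycleL_single (r : ℤ) (F G : Mat) :
    cocycleL (Finsupp.single r F) (Finsupp.single (-r) G) =
      orientedSum (-r) 0 fun j => str (evalMat j F * evalMat (j + r) G) := by
  rw [cocycleL_apply, cocycle_eq, Finsupp.sum_single_index]
  · simp [strMul_eq]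
  · simp [orientedSum, strMul]

theorem cocycleL_single_of_ne {r s : ℤ} (h : r + s ≠ 0) (F G : Mat) :
    cocycleL (Finsupp.single r F) (Finsupp.single s G) = 0 := by
  rw [cocycleL_apply, cocycle_eq, Finsupp.sum_single_index]
  · rw [Finsupp.single_eq_of_ne (by omega)]
    simp [orientedSum, strMul]
  · simp [orientedSum, strMul]

/-- Translating the summation by r exchanges the two arguments and reverses the interval from -r to
0; supercyclicity of the supertrace supplies the sign. -/
theorem cocycleL_skew {m n : ℤ} {A B : SD} (hA : A ∈ sdDeg m) (hB : B ∈ sdDeg n) :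
    cocycleL A B = -eps m n * cocycleL B A := by
  suffices H : ∀ r F, HasMatParity m F → ∀ s G, HasMatParity n G →
      cocycleL (Finsupp.single r F) (Finsupp.single s G) =
        -eps m n * cocycleL (Finsupp.single s G) (Finsupp.single r F) by
    have := sdDeg_ext (f := cocycleL.flip B) (g := -eps m n • cocycleL B) (fun r F hF => by
      have := sdDeg_ext (f := cocycleL (Finsupp.single r F))
        (g := -eps m n • cocycleL.flip (Finsupp.single r F)) (fun s G hG => by
          simpa using H r F hF s G hG) hB
      simpa using this) hA
    simpa using this
  intro r F hF s G hG
  by_cases h : r + s = 0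
  · obtain rfl : s = -r := by omega
    have h1 := cocycleL_single (-r) G F
    rw [neg_neg] at h1
    rw [cocycleL_single, h1, orientedSum_swap, neg_mul]
    congr 1
    rw [← orientedSum_mul]
    have := orientedSum_comp_add 0 (-r) r fun j => eps m n * str (evalMat j G * evalMat (j + (-r : ℤ)) F)
    rw [zero_add, neg_add_cancel] at this
    rw [← this]
    congr 1
    funext j
    rw [str_mul_comm (hF.evalMat _) (hG.evalMat _)]
    push_cast
    rw [add_neg_cancel_right]
  · rw [cocycleL_single_of_ne h, cocycleL_single_of_ne (by omega), mul_zero]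

/-- After translation all three terms sum the same function Str(F(j) G(j - s) H(j + r)), over the
intervals from -r to s, from -r to 0 and from 0 to s; the identity is additivity of the interval. It
contains the whole cocycle condition. -/
theorem cocycleL_cyclic {k m n : ℤ} {A B D : SD} (hA : A ∈ sdDeg k) (hB : B ∈ sdDeg m)
    (hD : D ∈ sdDeg n) : cocycleL (mulL A B) D =
      cocycleL A (mulL B D) - eps (k + m) n * cocycleL (mulL D A) B := by
  suffices H : ∀ r F, HasMatParity k F → ∀ s G, HasMatParity m G → ∀ u H, HasMatParity n H →
      cocycleL (mulL (Finsupp.single r F) (Finsupp.single s G)) (Finsupp.single u H) =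
      cocycleL (Finsupp.single r F) (mulL (Finsupp.single s G) (Finsupp.single u H)) -
        eps (k + m) n * cocycleL (mulL (Finsupp.single u H) (Finsupp.single r F))
          (Finsupp.single s G) by
    have := sdDeg_ext (f := cocycleL.flip D ∘ₗ mulL.flip B)
      (g := cocycleL.flip (mulL B D) - eps (k + m) n • (cocycleL.flip B ∘ₗ mulL D))
      (fun r F hF => by
        have := sdDeg_ext (f := cocycleL.flip D ∘ₗ mulL (Finsupp.single r F))
          (g := cocycleL (Finsupp.single r F) ∘ₗ mulL.flip D
            - eps (k + m) n • (cocycleL (mulL D (Finsupp.single r F)))) (fun s G hG => by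
            have := sdDeg_ext
              (f := cocycleL (mulL (Finsupp.single r F) (Finsupp.single s G)))
              (g := cocycleL (Finsupp.single r F) ∘ₗ mulL (Finsupp.single s G)
                - eps (k + m) n • (cocycleL.flip (Finsupp.single s G) ∘ₗ
                  mulL.flip (Finsupp.single r F))) (fun u H' hH => by
                simpa using H r F hF s G hG u H' hH) hD
            simpa using this) hB
        simpa using this) hA
    simpa using this
  intro r F hF s G hG u H hH
  simp only [mulL_single]
  by_cases h : r + s + u = 0
  · obtain rfl : u = -(r + s) := by omega
    rw [cocycleL_single, show s + -(r + s) = -r by ring, cocycleL_single,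
      show -(r + s) + r = -s by ring]
    have h1 := cocycleL_single (-s) (shift r H * F) G
    rw [neg_neg] at h1
    rw [h1, ← orientedSum_mul, sub_eq_add_neg, ← orientedSum_swap]
    have h2 := orientedSum_comp_add (-(r + s)) 0 s fun j =>
      str (evalMat j F * evalMat (j - s) G * evalMat (j + r) H)
    have h3 : ∀ j : ℤ, eps (k + m) n * str (evalMat j (shift r H * F) * evalMat (j + (-s : ℤ)) G) =
        str (evalMat j F * evalMat (j - s) G * evalMat (j + r) H) := by
      intro j
      rw [str_mul_comm ((hF.evalMat _).mul (hG.evalMat _)) (hH.evalMat _), evalMat_mul,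
        evalMat_shift, mul_assoc]
      push_cast
      rw [← sub_eq_add_neg]
    have h4 : ∀ j : ℤ, str (evalMat j F * evalMat (j + r) (shift (-(r + s)) G * H)) =
        str (evalMat j F * evalMat (j - s) G * evalMat (j + r) H) := by
      intro j
      rw [evalMat_mul, evalMat_shift, mul_assoc]
      push_cast
      rw [show (j : ℂ) + r + -(r + s) = j - s by ring]
    have h5 : ∀ j : ℤ, str (evalMat j (shift s F * G) * evalMat (j + (r + s : ℤ)) H) =
        str (evalMat (j + s : ℤ) F * evalMat ((j + s : ℤ) - s) G * evalMat ((j + s : ℤ) + r) H) := by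
      intro j
      rw [evalMat_mul, evalMat_shift]
      push_cast
      rw [add_sub_cancel_right, show (j : ℂ) + s + r = j + (r + s) by ring]
    simp only [h3, h4, h5]
    rw [h2, show -(r + s) + s = -r by ring, zero_add, orientedSum_add]
  · rw [cocycleL_single_of_ne h, cocycleL_single_of_ne (by omega), cocycleL_single_of_ne (by omega)]
    simp

end SuperCircle

/-! ### The central extension as a graded Lie superalgebra -/

namespace SuperCircle

/-- The operator on `SD` that multiplies the component of degree `n` by `c n`. -/
def scaleSD (c : ℤ → ℂ) : SD →ₗ[ℂ] SD where
  toFun A := Finsupp.onFinset A.support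
    (fun r => Matrix.of fun i j => c (2 * r + (i : ℤ) - (j : ℤ)) • A r i j) fun r hr => by
      rw [Finsupp.mem_support_iff]
      intro h
      exact hr (by ext1 i j; simp [h])
  map_add' A B := by ext1 r; ext1 i j; simp
  map_smul' a A := by ext1 r; ext1 i j; simp [smul_smul, mul_comm]

theorem scaleSD_apply (c : ℤ → ℂ) (A : SD) (r : ℤ) (i j : Fin 2) :
    scaleSD c A r i j = c (2 * r + (i : ℤ) - (j : ℤ)) • A r i j := rfl

theorem scaleSD_sigma {ε₁ ε₂ : ℤˣ} (c : ℤ → ℂ) {A : SD} (hA : sigma ε₁ ε₂ A = -A) :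
    sigma ε₁ ε₂ (scaleSD c A) = -scaleSD c A := by
  ext1 r
  have h := DFunLike.congr_fun hA r
  rw [sigma_apply] at h ⊢
  ext1 i j
  have h' := congr_fun (congr_fun h i) j
  fin_cases i <;> fin_cases j <;> simp [sigmaMat, scaleSD_apply] at h' ⊢ <;> rw [h'] <;>
    exact smul_neg _ _

variable (ε₁ ε₂ : ℤˣ)

/-- The operator on the central extension that multiplies the component of degree `n` by `c n`. -/
def scaleHat (c : ℤ → ℂ) : hatSD ε₁ ε₂ →ₗ[ℂ] hatSD ε₁ ε₂ :=
  ((scaleSD c).prodMap (c 0 • LinearMap.id)).restrict fun _ hx => scaleSD_sigma c hx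

theorem scaleHat_fst (c : ℤ → ℂ) (x : hatSD ε₁ ε₂) : (scaleHat ε₁ ε₂ c x).1.1 = scaleSD c x.1.1 :=
  rfl

theorem scaleHat_snd (c : ℤ → ℂ) (x : hatSD ε₁ ε₂) : (scaleHat ε₁ ε₂ c x).1.2 = c 0 * x.1.2 := rfl

theorem scaleHat_apply (c : ℤ → ℂ) {n : ℤ} {x : hatSD ε₁ ε₂} (hx : x ∈ gr ε₁ ε₂ n) :
    scaleHat ε₁ ε₂ c x = c n • x := by
  refine Subtype.ext (Prod.ext ?_ ?_)
  · ext1 r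
    ext1 i j
    rw [scaleHat_fst, scaleSD_apply]
    by_cases h : x.1.1 r i j = 0
    · simp [h]
    · rw [hx.1 r i j h]
      rfl
  · rw [scaleHat_snd]
    by_cases h : x.1.2 = 0
    · simp [h]
    · rw [hx.2 h]
      rfl

theorem scaleHat_single_mem (n : ℤ) (x : hatSD ε₁ ε₂) :
    scaleHat ε₁ ε₂ (Pi.single n 1) x ∈ gr ε₁ ε₂ n := by
  refine ⟨fun r i j h => ?_, fun h => ?_⟩
  · by_contra h0
    exact h (by rw [scaleHat_fst, scaleSD_apply, Pi.single_eq_of_ne h0, zero_smul])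
  · by_contra h0
    exact h (by rw [scaleHat_snd, Pi.single_eq_of_ne (Ne.symm h0), zero_mul])

theorem iSup_gr : ⨆ n, gr ε₁ ε₂ n = ⊤ := by
  rw [eq_top_iff]
  intro x _
  -- Degree 0 is inserted by hand to catch the central coordinate, which the support of the first
  -- component does not see.
  let N : Finset ℤ := insert 0 ((x.1.1.support ×ˢ (Finset.univ : Finset (Fin 2 × Fin 2))).image
    fun p => 2 * p.1 + (p.2.1 : ℤ) - (p.2.2 : ℤ))
  have h : x = ∑ n ∈ N, scaleHat ε₁ ε₂ (Pi.single n 1) x := by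
    refine Subtype.ext (Prod.ext ?_ ?_)
    · ext1 r
      ext1 i j
      simp only [AddSubmonoidClass.coe_finsetSum, Prod.fst_sum, Finsupp.finsetSum_apply,
        Matrix.sum_apply, scaleHat_fst, scaleSD_apply]
      rw [← Finset.sum_smul]
      by_cases h : x.1.1 r i j = 0
      · simp [h]
      · rw [Finset.sum_eq_single (2 * r + (i : ℤ) - (j : ℤ))]
        · simp
        · intro b _ hb
          exact Pi.single_eq_of_ne (Ne.symm hb) _
        · intro hN
          refine absurd (Finset.mem_insert_of_mem (Finset.mem_image.2 ⟨(r, i, j), ?_, rfl⟩)) hN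
          simp only [Finset.mem_product, Finset.mem_univ, and_true, Finsupp.mem_support_iff]
          exact fun h0 => h (by rw [h0]; rfl)
    · simp only [AddSubmonoidClass.coe_finsetSum, Prod.snd_sum, scaleHat_snd]
      rw [← Finset.sum_mul, Finset.sum_eq_single 0]
      · simp
      · intro b _ hb
        exact Pi.single_eq_of_ne (Ne.symm hb) _
      · intro hN
        exact absurd (Finset.mem_insert_self _ _) hN
  rw [h]
  exact Submodule.sum_mem _ fun n _ =>
    Submodule.mem_iSup_of_mem n (scaleHat_single_mem ε₁ ε₂ n x)

/-- The superbracket of the central extension as a bilinear map. -/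
def hatBracketL : hatSD ε₁ ε₂ →ₗ[ℂ] hatSD ε₁ ε₂ →ₗ[ℂ] hatSD ε₁ ε₂ :=
  LinearMap.mk₂ ℂ (hatBracket ε₁ ε₂)
    (fun x y z => by
      refine Subtype.ext (Prod.ext ?_ ?_)
      · simp [hatBracket, ← bracketL_apply]
      · simp [hatBracket, ← cocycleL_apply])
    (fun c x y => by
      refine Subtype.ext (Prod.ext ?_ ?_)
      · simp [hatBracket, ← bracketL_apply]
      · simp [hatBracket, ← cocycleL_apply])
    (fun x y z => by
      refine Subtype.ext (Prod.ext ?_ ?_)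
      · simp [hatBracket, ← bracketL_apply]
      · simp [hatBracket, ← cocycleL_apply])
    (fun c x y => by
      refine Subtype.ext (Prod.ext ?_ ?_)
      · simp [hatBracket, ← bracketL_apply]
      · simp [hatBracket, ← cocycleL_apply])

theorem hatBracketL_fst (x y : hatSD ε₁ ε₂) :
    (hatBracketL ε₁ ε₂ x y).1.1 = bracketL x.1.1 y.1.1 := by
  rw [bracketL_apply]; rfl

theorem hatBracketL_snd (x y : hatSD ε₁ ε₂) :
    (hatBracketL ε₁ ε₂ x y).1.2 = cocycleL x.1.1 y.1.1 := rfl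

theorem cocycleL_of_ne {m n : ℤ} {A B : SD} (hA : A ∈ sdDeg m) (hB : B ∈ sdDeg n) (h : m + n ≠ 0) :
    cocycleL A B = 0 := by
  rw [cocycleL_apply, cocycle_eq]
  refine Finset.sum_eq_zero fun r _ => ?_
  have : ∀ x y : ℂ, strMul (A r) (B (-r)) x y = 0 := by
    intro x y
    have key : ∀ i k, (A r i k).eval x * (B (-r) k i).eval y = 0 := by
      intro i k
      by_cases h1 : A r i k = 0
      · simp [h1]
      by_cases h2 : B (-r) k i = 0
      · simp [h2]
      have := hA r i k h1
      have := hB (-r) k i h2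
      omega
    simp [strMul, key]
  simp [orientedSum, this]

theorem hatBracketL_mem {m n : ℤ} {x y : hatSD ε₁ ε₂} (hx : x ∈ gr ε₁ ε₂ m) (hy : y ∈ gr ε₁ ε₂ n) :
    hatBracketL ε₁ ε₂ x y ∈ gr ε₁ ε₂ (m + n) := by
  refine ⟨?_, fun h => ?_⟩
  · rw [hatBracketL_fst]
    exact bracketL_mem hx.1 hy.1
  · by_contra h0
    exact h (cocycleL_of_ne hx.1 hy.1 h0)

theorem hatBracketL_skew {m n : ℤ} {x y : hatSD ε₁ ε₂} (hx : x ∈ gr ε₁ ε₂ m)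
    (hy : y ∈ gr ε₁ ε₂ n) :
    hatBracketL ε₁ ε₂ x y = -eps m n • hatBracketL ε₁ ε₂ y x := by
  refine Subtype.ext (Prod.ext ?_ ?_)
  · simpa [hatBracketL_fst] using bracketL_skew hx.1 hy.1
  · simpa [hatBracketL_snd] using cocycleL_skew hx.1 hy.1

/-- Apply the cyclic identity to AB·D and AD·B. The terms that do not match directly cancel because
signs square to 1. -/
theorem cocycleL_jacobi {k m n : ℤ} {A B D : SD} (hA : A ∈ sdDeg k) (hB : B ∈ sdDeg m)
    (hD : D ∈ sdDeg n) : cocycleL A (bracketL B D) =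
      cocycleL (bracketL A B) D - eps m n * cocycleL (bracketL A D) B := by
  rw [bracketL_eq hB hD, bracketL_eq hA hB, bracketL_eq hA hD]
  simp only [map_sub, map_smul, LinearMap.sub_apply, LinearMap.smul_apply, smul_eq_mul]
  rw [cocycleL_cyclic hA hB hD, cocycleL_cyclic hA hD hB]
  simp only [eps_add_left, eps_comm n m]
  linear_combination -eps k m * cocycleL (mulL B A) D * eps_mul_self m n

/-- The central extension as a graded Lie superalgebra. -/
def hatLie : GradedLieSuper (hatSD ε₁ ε₂) where
  br := hatBracketL ε₁ ε₂
  deg := gr ε₁ ε₂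
  scale := scaleHat ε₁ ε₂
  iSup_deg := iSup_gr ε₁ ε₂
  scale_apply := scaleHat_apply ε₁ ε₂
  br_mem := hatBracketL_mem ε₁ ε₂
  skew := hatBracketL_skew ε₁ ε₂
  jacobi := fun hx hy hz => by
    refine Subtype.ext (Prod.ext ?_ ?_)
    · simpa [hatBracketL_fst] using bracketL_jacobi hx.1 hy.1 hz.1
    · simpa [hatBracketL_snd, hatBracketL_fst] using cocycleL_jacobi hx.1 hy.1 hz.1

end SuperCircle

/-! ### Modules over the enveloping algebra, and the adjoint action of the Cartan subalgebra -/

namespace SuperCircle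

variable (ε₁ ε₂ : ℤˣ)

theorem toEnv_mul {m n : ℤ} {x y : hatSD ε₁ ε₂} (hx : x ∈ gr ε₁ ε₂ m) (hy : y ∈ gr ε₁ ε₂ n) :
    toEnv ε₁ ε₂ x * toEnv ε₁ ε₂ y = eps m n • (toEnv ε₁ ε₂ y * toEnv ε₁ ε₂ x)
      + toEnv ε₁ ε₂ (hatBracketL ε₁ ε₂ x y) := by
  have := RingQuot.mkAlgHom_rel ℂ (EnvRel.super (ε₁ := ε₁) (ε₂ := ε₂) hx hy)
  rw [map_mul, map_add, map_zsmul, map_mul] at this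
  have h2 : eps m n • (toEnv ε₁ ε₂ y * toEnv ε₁ ε₂ x) =
      ((m * n).negOnePow : ℤ) • (toEnv ε₁ ε₂ y * toEnv ε₁ ε₂ x) := by
    rw [eps, Algebra.smul_def, zsmul_eq_mul]
    congr 1
  rw [h2]
  exact this

variable {ε₁ ε₂}

theorem Env.induction {P : Submodule ℂ (Env ε₁ ε₂)} (h1 : 1 ∈ P)
    (hm : ∀ n, ∀ y ∈ gr ε₁ ε₂ n, ∀ u ∈ P, toEnv ε₁ ε₂ y * u ∈ P) (u : Env ε₁ ε₂) : u ∈ P := by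
  obtain ⟨t, rfl⟩ := RingQuot.mkAlgHom_surjective ℂ (EnvRel ε₁ ε₂) u
  suffices H : ∀ u ∈ P, RingQuot.mkAlgHom ℂ (EnvRel ε₁ ε₂) t * u ∈ P by simpa using H 1 h1
  induction t using TensorAlgebra.induction with
  | algebraMap r =>
    intro u hu
    rw [AlgHom.commutes, ← Algebra.smul_def]
    exact P.smul_mem r hu
  | ι x =>
    intro u hu
    have : ⊤ ≤ P.comap ((LinearMap.mul ℂ (Env ε₁ ε₂)).flip u ∘ₗ toEnv ε₁ ε₂) := by
      rw [← iSup_gr ε₁ ε₂]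
      exact iSup_le fun n y hy => hm n y hy u hu
    exact this (Submodule.mem_top (x := x))
  | mul a b ha hb =>
    intro u hu
    rw [map_mul, mul_assoc]
    exact ha _ (hb _ hu)
  | add a b ha hb =>
    intro u hu
    rw [map_add, add_mul]
    exact P.add_mem (ha _ hu) (hb _ hu)

section Module

variable (L : Type) [AddCommGroup L] [Module ℂ L] [Module (Env ε₁ ε₂) L]
  [IsScalarTower ℂ (Env ε₁ ε₂) L]

variable (ε₁ ε₂) in
/-- The representation on a module over the enveloping algebra. -/
def envAct : hatSD ε₁ ε₂ →ₗ[ℂ] Module.End ℂ L :=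
  (Algebra.lsmul ℂ ℂ L : Env ε₁ ε₂ →ₐ[ℂ] Module.End ℂ L).toLinearMap ∘ₗ toEnv ε₁ ε₂

variable {L}

theorem envAct_apply (x : hatSD ε₁ ε₂) (w : L) : envAct ε₁ ε₂ L x w = toEnv ε₁ ε₂ x • w := rfl

variable (L) in
theorem envAct_isRep : (hatLie ε₁ ε₂).IsRep (envAct ε₁ ε₂ L) := by
  intro k l x y hx hy w
  simp only [envAct_apply]
  rw [← mul_smul, toEnv_mul ε₁ ε₂ hx hy, add_smul, smul_assoc, mul_smul]
  rfl

theorem aeval_envAct (x : hatSD ε₁ ε₂) (q : ℂ[X]) (w : L) :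
    aeval (envAct ε₁ ε₂ L x) q w = (aeval (toEnv ε₁ ε₂ x) q : Env ε₁ ε₂) • w := by
  have := aeval_algHom_apply (Algebra.lsmul ℂ ℂ L : Env ε₁ ε₂ →ₐ[ℂ] Module.End ℂ L)
    (toEnv ε₁ ε₂ x) q
  exact congr_arg (fun f : Module.End ℂ L => f w) this

/-- Lets stability under the Lie superalgebra be used as stability under the enveloping algebra. -/
theorem smul_mem_of_envAct_mem {P : Submodule ℂ L}
    (h : ∀ x : hatSD ε₁ ε₂, ∀ w ∈ P, envAct ε₁ ε₂ L x w ∈ P) (u : Env ε₁ ε₂) {w : L} (hw : w ∈ P) :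
    u • w ∈ P := by
  have := Env.induction
    (P := P.comap ((Algebra.lsmul ℂ ℂ L : Env ε₁ ε₂ →ₐ[ℂ] Module.End ℂ L).toLinearMap.flip w))
    (by simpa using hw) (fun n y _ u hu => by
      have := h y _ hu
      simpa [envAct_apply, mul_smul] using this) u
  simpa using this

end Module

theorem bracketL_single_zero (G : Mat) (A : SD) (r : ℤ) :
    bracketL (Finsupp.single 0 G) A r = superComm 0 r G (A r) := by
  have h0 : ∀ r s F, superComm r s F 0 = 0 := fun r s F => by
    simpa using superComm_smul_right r s 0 F 0
  induction A using Finsupp.induction_linear with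
  | zero => simp [h0]
  | add A B hA hB => simp [hA, hB, superComm_add_right]
  | single s F =>
    rw [bracketL_apply, bracket_single, zero_add]
    by_cases h : s = r
    · subst h
      simp
    · simp [Finsupp.single_eq_of_ne (Ne.symm h), h0]

theorem superComm_diag (r : ℤ) (g : Fin 2 → ℂ[X]) (F : Mat) (i j : Fin 2) :
    superComm 0 r (Matrix.diagonal g) F i j = ((g i).comp (X + C (r : ℂ)) - g j) * F i j := by
  have h : HasMatParity 0 (Matrix.diagonal g) := by
    intro i j h
    by_cases hij : i = j
    · subst hij
      exact ⟨i, by ring⟩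
    · simp [hij] at h
  have hs : shift r (Matrix.diagonal g) = Matrix.diagonal fun i => (g i).comp (X + C (r : ℂ)) := by
    ext1 i j
    by_cases hij : i = j <;> simp [shift, hij]
  have hs0 : ∀ F, shift 0 F = F := by
    intro F
    ext1 i j
    simp [shift]
  simp only [superComm, hs, hs0, Matrix.of_apply]
  rw [Finset.sum_sub_distrib, Finset.sum_eq_single i, Finset.sum_eq_single j]
  · simp
    ring
  · intro k _ hk
    simp [hk]
  · simp
  · intro k _ hk
    simp [Ne.symm hk]
  · simp

theorem cocycleL_single_zero (G : Mat) (A : SD) : cocycleL (Finsupp.single 0 G) A = 0 := by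
  rw [cocycleL_apply, cocycle_eq, Finsupp.sum_single_index] <;> simp [orientedSum]

theorem diagOp_eq (p q : ℂ[X]) : diagOp p q = Finsupp.single 0 (Matrix.diagonal ![p, q]) := by
  rw [diagOp]
  congr 1
  ext1 i j
  fin_cases i <;> fin_cases j <;> simp

theorem bracketL_cartan (p q : ℂ[X]) (h : q = -p.comp (-X - 1)) (A : SD) (r : ℤ) (i j : Fin 2) :
    bracketL (cartan ε₁ ε₂ p q h : hatSD ε₁ ε₂).1.1 A r i j =
      ((![p, q] i).comp (X + C (r : ℂ)) - ![p, q] j) * A r i j := by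
  change bracketL (diagOp p q) A r i j = _
  rw [diagOp_eq, bracketL_single_zero, superComm_diag]

theorem cocycleL_cartan (p q : ℂ[X]) (h : q = -p.comp (-X - 1)) (A : SD) :
    cocycleL (cartan ε₁ ε₂ p q h : hatSD ε₁ ε₂).1.1 A = 0 := by
  change cocycleL (diagOp p q) A = 0
  rw [diagOp_eq, cocycleL_single_zero]

/-- In degree 0 only diagonal entries at t^0 survive, and σ determines the second one from the
first. -/
theorem exists_cartan {x : hatSD ε₁ ε₂} (hx : x ∈ gr ε₁ ε₂ 0) :
    ∃ (p : ℂ[X]) (c : ℂ), x = (cartan ε₁ ε₂ p _ rfl : hatSD ε₁ ε₂) + c • central ε₁ ε₂ := by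
  refine ⟨x.1.1 0 0 0, x.1.2, Subtype.ext (Prod.ext ?_ ?_)⟩
  · ext1 r
    have hσ := DFunLike.congr_fun x.2 0
    rw [sigma_apply] at hσ
    have h00 := congr_fun (congr_fun hσ 0) 0
    have h11 := congr_fun (congr_fun hσ 1) 1
    ext1 i j
    by_cases hr : 0 = r
    · subst hr
      have hij : i ≠ j → x.1.1 0 i j = 0 := fun hij => by
        by_contra h0
        have := hx.1 0 i j h0
        exact hij (Fin.ext (by omega))
      fin_cases i <;> fin_cases j
      · simp [cartan, diagOp, central]
      · simpa [cartan, diagOp, central] using hij (by simp)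
      · simpa [cartan, diagOp, central] using hij (by simp)
      · simp [sigmaMat] at h11
        simp [cartan, diagOp, central, h11]
    · have : x.1.1 r i j = 0 := by
        by_contra h0
        have := hx.1 r i j h0
        omega
      simp [cartan, diagOp, central, this, Ne.symm hr]
  · simp [cartan, central]

theorem hatBracketL_central (y : hatSD ε₁ ε₂) : hatBracketL ε₁ ε₂ (central ε₁ ε₂) y = 0 := by
  refine Subtype.ext (Prod.ext ?_ ?_)
  · rw [hatBracketL_fst]
    change bracketL 0 _ = 0
    simp
  · rw [hatBracketL_snd]
    change cocycleL 0 _ = 0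
    simp

theorem hatBracketL_deg_zero {x y : hatSD ε₁ ε₂} (hx : x ∈ gr ε₁ ε₂ 0) (hy : y ∈ gr ε₁ ε₂ 0) :
    hatBracketL ε₁ ε₂ x y = 0 := by
  obtain ⟨p, c, rfl⟩ := exists_cartan hx
  rw [map_add, map_smul, LinearMap.add_apply, LinearMap.smul_apply, hatBracketL_central, smul_zero,
    add_zero]
  refine Subtype.ext (Prod.ext ?_ ?_)
  · rw [hatBracketL_fst]
    ext1 r
    ext1 i j
    rw [bracketL_cartan]
    by_cases h : y.1.1 r i j = 0
    · simp [h]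
    · have := hy.1 r i j h
      obtain rfl : i = j := Fin.ext (by omega)
      obtain rfl : r = 0 := by omega
      simp
  · rw [hatBracketL_snd, cocycleL_cartan]
    rfl

variable (ε₁ ε₂) in
/-- The element of the Cartan subalgebra that defines the principal gradation. -/
def gradingElement : gr ε₁ ε₂ 0 :=
  -- The entries must differ by 1/2 to give θ weight 1/2, and σ forces the two constants to sum to
  -- 1; hence 1/4 and 3/4.
  cartan ε₁ ε₂ (X + C (1 / 4)) (X + C (3 / 4)) (by
    have : (1 : ℂ[X]) = C (1 / 4) + C (3 / 4) := by
      rw [← C_add]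
      norm_num
    simp only [add_comp, X_comp, C_comp]
    linear_combination -this)

theorem hatBracketL_gradingElement (n : ℤ) (x : hatSD ε₁ ε₂) (hx : x ∈ gr ε₁ ε₂ n) :
    hatBracketL ε₁ ε₂ (gradingElement ε₁ ε₂) x = ((n : ℂ) / 2) • x := by
  refine Subtype.ext (Prod.ext ?_ ?_)
  · rw [hatBracketL_fst]
    ext1 r
    ext1 i j
    rw [gradingElement, bracketL_cartan]
    by_cases h : x.1.1 r i j = 0
    · simp [h]
    · have hn := hx.1 r i j h
      have : ((![X + C (1 / 4), X + C (3 / 4)] : Fin 2 → ℂ[X]) i).comp (X + C (r : ℂ)) -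
          (![X + C (1 / 4), X + C (3 / 4)] : Fin 2 → ℂ[X]) j = C ((n : ℂ) / 2) := by
        rw [← hn]
        fin_cases i <;> fin_cases j <;>
          simp only [Fin.zero_eta, Fin.mk_one, Matrix.cons_val_zero, Matrix.cons_val_one,
            add_comp, X_comp, C_comp, add_sub_add_right_eq_sub, add_sub_cancel_left] <;>
          rw [← sub_eq_zero] <;> ring_nf <;>
          simp only [← C_add, ← C_sub] <;> rw [C_eq_zero] <;> push_cast <;> simp <;> ring
      rw [this]
      simp [smul_eq_C_mul]
  · rw [hatBracketL_snd, gradingElement, cocycleL_cartan]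
    by_cases h : x.1.2 = 0
    · simp [h]
    · simp [hx.2 h]

end SuperCircle

/-! ### The highest weight vector survives in the irreducible quotient -/

namespace SuperCircle

variable {ε₁ ε₂ : ℤˣ} (ξ : Module.Dual ℂ (gr ε₁ ε₂ 0))

/-- The extension of a functional on the Cartan subalgebra by zero. -/
def extendWeight : hatSD ε₁ ε₂ →ₗ[ℂ] ℂ :=
  ξ ∘ₗ (scaleHat ε₁ ε₂ (Pi.single 0 1)).codRestrict (gr ε₁ ε₂ 0) (scaleHat_single_mem ε₁ ε₂ 0)

theorem extendWeight_of_ne {n : ℤ} (hn : n ≠ 0) {x : hatSD ε₁ ε₂} (hx : x ∈ gr ε₁ ε₂ n) :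
    extendWeight ξ x = 0 := by
  have : (scaleHat ε₁ ε₂ (Pi.single 0 1)).codRestrict (gr ε₁ ε₂ 0) (scaleHat_single_mem ε₁ ε₂ 0) x
      = 0 := by
    apply Subtype.ext
    rw [LinearMap.codRestrict_apply, scaleHat_apply ε₁ ε₂ _ hx, Pi.single_eq_of_ne hn, zero_smul]
    rfl
  rw [extendWeight, LinearMap.comp_apply, this, map_zero]

theorem extendWeight_coe (h : gr ε₁ ε₂ 0) : extendWeight ξ h = ξ h := by
  have : (scaleHat ε₁ ε₂ (Pi.single 0 1)).codRestrict (gr ε₁ ε₂ 0) (scaleHat_single_mem ε₁ ε₂ 0) h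
      = h := by
    apply Subtype.ext
    rw [LinearMap.codRestrict_apply, scaleHat_apply ε₁ ε₂ _ h.2, Pi.single_eq_same, one_smul]
  rw [extendWeight, LinearMap.comp_apply, this]

/-- The representation of the enveloping algebra on the model of the Verma module. -/
def vermaRep : Env ε₁ ε₂ →ₐ[ℂ] Module.End ℂ (hatLie ε₁ ε₂).NegEnv :=
  RingQuot.liftAlgHom ℂ ⟨TensorAlgebra.lift ℂ ((hatLie ε₁ ε₂).vermaAct (extendWeight ξ)), by
    intro a b h
    induction h with
    | @super m n x y hx hy =>
      have := (hatLie ε₁ ε₂).vermaAct_super (χ := extendWeight ξ)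
        (fun n hn x hx => extendWeight_of_ne ξ hn hx)
        (fun x hx y hy => by
          change extendWeight ξ (hatBracketL ε₁ ε₂ x y) = 0
          rw [hatBracketL_deg_zero hx hy, map_zero]) hx hy
      have h2 : eps m n = (((m * n).negOnePow : ℤ) : ℂ) := rfl
      rw [map_mul, map_add, map_zsmul, map_mul, TensorAlgebra.lift_ι_apply,
        TensorAlgebra.lift_ι_apply, TensorAlgebra.lift_ι_apply]
      rw [h2, ← smul_one_mul] at this
      refine this.trans (congrArg (· + _) ?_)
      rw [← smul_one_mul (((m * n).negOnePow : ℤ))]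
      congr 1⟩

theorem vermaRep_toEnv (x : hatSD ε₁ ε₂) :
    vermaRep ξ (toEnv ε₁ ε₂ x) = (hatLie ε₁ ε₂).vermaAct (extendWeight ξ) x := by
  simp [vermaRep, toEnv]

/-- The functional `u ↦` the coefficient of the highest weight vector in `u v`. -/
def hwCoeff : Env ε₁ ε₂ →ₗ[ℂ] ℂ :=
  (hatLie ε₁ ε₂).negAug.toLinearMap ∘ₗ (vermaRep ξ).toLinearMap.flip 1

theorem hwCoeff_apply (u : Env ε₁ ε₂) :
    hwCoeff ξ u = (hatLie ε₁ ε₂).negAug (vermaRep ξ u 1) := rfl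

theorem hwCoeff_one : hwCoeff ξ 1 = 1 := by simp [hwCoeff_apply]

/-- Negative elements act on the model by left multiplication, and the augmentation kills them. -/
theorem hwCoeff_neg_mul {n : ℤ} (hn : n < 0) {y : hatSD ε₁ ε₂} (hy : y ∈ gr ε₁ ε₂ n)
    (u : Env ε₁ ε₂) : hwCoeff ξ (toEnv ε₁ ε₂ y * u) = 0 := by
  rw [hwCoeff_apply, map_mul, Module.End.mul_apply, vermaRep_toEnv,
    (hatLie ε₁ ε₂).vermaAct_neg (fun n hn x hx => extendWeight_of_ne ξ hn hx) hn hy, map_mul,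
    GradedLieSuper.negAug_toNegEnv, zero_mul]

theorem vermaRep_one_of_mem {u : Env ε₁ ε₂} (hu : u ∈ vermaIdeal ε₁ ε₂ ξ) :
    vermaRep ξ u 1 = 0 := by
  let K : Submodule (Env ε₁ ε₂) (Env ε₁ ε₂) :=
    { carrier := {u | vermaRep ξ u 1 = 0}
      zero_mem' := by simp
      add_mem' := fun {a b} ha hb => by
        simp only [Set.mem_ofPred_eq] at *
        rw [map_add, LinearMap.add_apply, ha, hb, add_zero]
      smul_mem' := fun a u hu => by
        simp only [Set.mem_ofPred_eq] at *
        rw [smul_eq_mul, map_mul, Module.End.mul_apply, hu, map_zero] }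
  have : vermaIdeal ε₁ ε₂ ξ ≤ K := by
    refine Submodule.span_le.2 ?_
    rintro _ (⟨n, hn, x, hx, rfl⟩ | ⟨h, rfl⟩)
    · change vermaRep ξ _ 1 = 0
      rw [vermaRep_toEnv, GradedLieSuper.vermaAct_one, extendWeight_of_ne ξ hn.ne' hx,
        (hatLie ε₁ ε₂).toNegEnv_of_nonneg hn.le hx]
      simp
    · change vermaRep ξ _ 1 = 0
      rw [map_sub, LinearMap.sub_apply, vermaRep_toEnv, GradedLieSuper.vermaAct_one,
        extendWeight_coe, (hatLie ε₁ ε₂).toNegEnv_of_nonneg le_rfl h.2, AlgHom.commutes]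
      simp [Algebra.algebraMap_eq_smul_one]
  exact this hu

theorem hwCoeff_of_mem {u : Env ε₁ ε₂} (hu : u ∈ vermaIdeal ε₁ ε₂ ξ) : hwCoeff ξ u = 0 := by
  rw [hwCoeff_apply, vermaRep_one_of_mem ξ hu, map_zero]

/-- The highest weight vector of the Verma module. -/
def vermaVector : Verma ε₁ ε₂ ξ := (vermaIdeal ε₁ ε₂ ξ).mkQ 1

theorem mkQ_eq_smul_vermaVector (u : Env ε₁ ε₂) :
    (vermaIdeal ε₁ ε₂ ξ).mkQ u = u • vermaVector ξ := by
  rw [vermaVector, ← map_smul, smul_eq_mul, mul_one]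

/-- The highest weight of the grading element. -/
abbrev topWeight : ℂ := ξ (gradingElement ε₁ ε₂)

section HighestWeight

variable {L : Type} [AddCommGroup L] [Module ℂ L] [Module (Env ε₁ ε₂) L]
  [IsScalarTower ℂ (Env ε₁ ε₂) L]

/-- `v` is a generating highest weight vector of weight `ξ`. -/
structure IsHighestWeight (v : L) : Prop where
  pos : ∀ n > 0, ∀ x ∈ gr ε₁ ε₂ n, envAct ε₁ ε₂ L x v = 0
  zero : ∀ h : gr ε₁ ε₂ 0, envAct ε₁ ε₂ L h v = ξ h • v
  gen : ∀ w : L, ∃ u : Env ε₁ ε₂, w = u • v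

variable {ξ} {v : L} (hv : IsHighestWeight ξ v)

include hv

theorem IsHighestWeight.span_pos : ∀ n > 0, ∀ x ∈ (hatLie ε₁ ε₂).deg n,
    ∀ w ∈ Submodule.span ℂ {v}, envAct ε₁ ε₂ L x w = 0 := by
  intro n hn x hx w hw
  obtain ⟨a, rfl⟩ := Submodule.mem_span_singleton.1 hw
  rw [map_smul, hv.pos n hn x hx, smul_zero]

theorem IsHighestWeight.span_zero : ∀ x ∈ (hatLie ε₁ ε₂).deg 0,
    ∀ w ∈ Submodule.span ℂ {v}, envAct ε₁ ε₂ L x w ∈ Submodule.span ℂ {v} := by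
  intro x hx w hw
  obtain ⟨a, rfl⟩ := Submodule.mem_span_singleton.1 hw
  rw [map_smul, hv.zero ⟨x, hx⟩]
  exact Submodule.smul_mem _ _ (Submodule.smul_mem _ _ (Submodule.mem_span_singleton_self _))

theorem IsHighestWeight.span_eigen : ∀ w ∈ Submodule.span ℂ {v},
    envAct ε₁ ε₂ L (gradingElement ε₁ ε₂) w = topWeight ξ • w := by
  intro w hw
  obtain ⟨a, rfl⟩ := Submodule.mem_span_singleton.1 hw
  rw [map_smul, hv.zero, smul_comm]

/-- The words in negative elements applied to v span the module. Those of degree 0 are multiples of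
v; those of negative degree are killed by ψ and have a different eigenvalue under the grading
element. -/
theorem IsHighestWeight.decomposition {ψ : Env ε₁ ε₂ →ₗ[ℂ] ℂ}
    (hψ : ∀ n < 0, ∀ y ∈ gr ε₁ ε₂ n, ∀ u, ψ (toEnv ε₁ ε₂ y * u) = 0) (w : L) :
    ∃ (c : ℂ) (u : Env ε₁ ε₂), w = c • v + u • v ∧ ψ u = 0 ∧
      u • v ∈ awayFrom (envAct ε₁ ε₂ L (gradingElement ε₁ ε₂)) (topWeight ξ) := by
  have hword : ∀ k w, (hatLie ε₁ ε₂).NegWord (envAct ε₁ ε₂ L) (Submodule.span ℂ {v}) k w →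
      ∃ u : Env ε₁ ε₂, w = u • v ∧ (k < 0 → ψ u = 0) := by
    intro k w hw
    induction hw with
    | base hw =>
      obtain ⟨a, rfl⟩ := Submodule.mem_span_singleton.1 hw
      exact ⟨algebraMap ℂ _ a, by rw [algebraMap_smul], fun h => absurd h (lt_irrefl _)⟩
    | @act k l y w hl hy hw ih =>
      obtain ⟨u, rfl, -⟩ := ih
      refine ⟨toEnv ε₁ ε₂ y * u, ?_, fun _ => hψ l hl y hy u⟩
      rw [envAct_apply, mul_smul]
  let P : Submodule ℂ L :=
    { carrier := {w | ∃ (c : ℂ) (u : Env ε₁ ε₂), w = c • v + u • v ∧ ψ u = 0 ∧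
        u • v ∈ awayFrom (envAct ε₁ ε₂ L (gradingElement ε₁ ε₂)) (topWeight ξ)}
      zero_mem' := ⟨0, 0, by simp, by simp, by simp⟩
      add_mem' := by
        rintro _ _ ⟨c, u, rfl, h1, h2⟩ ⟨c', u', rfl, h1', h2'⟩
        refine ⟨c + c', u + u', ?_, ?_, ?_⟩
        · rw [add_smul, add_smul]
          abel
        · rw [map_add, h1, h1', add_zero]
        · rw [add_smul]
          exact add_mem h2 h2'
      smul_mem' := by
        rintro a _ ⟨c, u, rfl, h1, h2⟩
        refine ⟨a * c, a • u, ?_, ?_, ?_⟩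
        · rw [smul_add, mul_smul, smul_assoc]
        · rw [map_smul, h1, smul_zero]
        · rw [smul_assoc]
          exact Submodule.smul_mem _ _ h2 }
  have hle : ⨆ k, (hatLie ε₁ ε₂).negSpan (envAct ε₁ ε₂ L) (Submodule.span ℂ {v}) k ≤ P := by
    refine iSup_le fun k => Submodule.span_le.2 fun w hw => ?_
    rcases GradedLieSuper.NegWord.base_or_lt hw with ⟨-, hw'⟩ | hk
    · obtain ⟨a, rfl⟩ := Submodule.mem_span_singleton.1 hw'
      exact ⟨a, 0, by simp, by simp, by simp⟩
    · obtain ⟨u, rfl, hu⟩ := hword k w hw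
      refine ⟨0, u, by simp, hu hk, ?_⟩
      refine mem_awayFrom_of_eigen (ν := topWeight ξ + (k : ℂ) / 2) ?_
        (GradedLieSuper.negWord_eigen (envAct_isRep _) (gradingElement ε₁ ε₂).2
          hatBracketL_gradingElement hv.span_eigen hw)
      have : (k : ℂ) ≠ 0 := by exact_mod_cast hk.ne
      intro h
      apply this
      linear_combination -2 * h
  apply hle
  obtain ⟨u, rfl⟩ := hv.gen w
  refine smul_mem_of_envAct_mem (fun x w hw => GradedLieSuper.act_mem_iSup_negSpan
    (envAct_isRep _) hv.span_zero hv.span_pos x hw) u ?_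
  exact Submodule.mem_iSup_of_mem 0 (Submodule.subset_span
    (.base (Submodule.mem_span_singleton_self _)))

/-- If the coefficient of v in u v were nonzero, a polynomial in the grading element would isolate v
inside N, and N would be the whole module. -/
theorem IsHighestWeight.coeff_eq_zero {ψ : Env ε₁ ε₂ →ₗ[ℂ] ℂ}
    (hψ : ∀ n < 0, ∀ y ∈ gr ε₁ ε₂ n, ∀ u, ψ (toEnv ε₁ ε₂ y * u) = 0)
    (hker : ∀ u : Env ε₁ ε₂, u • v = 0 → ψ u = 0) (hψ1 : ψ 1 = 1)
    {N : Submodule (Env ε₁ ε₂) L} (hN : N ≠ ⊤) {u : Env ε₁ ε₂} (hu : u • v ∈ N) : ψ u = 0 := by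
  obtain ⟨c, u', h, h1, q, hq, hqu⟩ := hv.decomposition hψ (u • v)
  have hc : ψ u = c := by
    have := hker (u - (c • 1 + u')) (by
      rw [sub_smul, add_smul, smul_assoc, one_smul, h, sub_self])
    rw [map_sub, map_add, h1, add_zero, map_smul, hψ1, sub_eq_zero] at this
    simpa using this
  rw [hc]
  by_contra hc0
  apply hN
  -- The polynomial q kills the lower part of u v and multiplies v by a nonzero scalar.
  have h2 : (c * q.eval (topWeight ξ)) • v ∈ N := by
    have h3 : aeval (envAct ε₁ ε₂ L (gradingElement ε₁ ε₂)) q (u • v) ∈ N := by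
      rw [aeval_envAct]
      exact N.smul_mem _ hu
    rwa [h, map_add, hqu, add_zero, map_smul, aeval_eigen (hv.zero _), smul_smul] at h3
  have h4 : v ∈ N := by
    have h5 := N.smul_mem (algebraMap ℂ (Env ε₁ ε₂) (c * q.eval (topWeight ξ))⁻¹) h2
    rwa [algebraMap_smul, smul_smul, inv_mul_cancel₀ (mul_ne_zero hc0 hq), one_smul] at h5
  rw [eq_top_iff]
  intro w _
  obtain ⟨a, rfl⟩ := hv.gen w
  exact N.smul_mem _ h4

/-- A submodule generated by singular vectors of smaller weight does not contain the highest weight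
vector unless the latter vanishes. -/
theorem IsHighestWeight.eq_zero_of_mem_span {W : Submodule ℂ L}
    (h0 : ∀ h ∈ gr ε₁ ε₂ 0, ∀ w ∈ W, envAct ε₁ ε₂ L h w ∈ W)
    (hpos : ∀ n > 0, ∀ x ∈ gr ε₁ ε₂ n, ∀ w ∈ W, envAct ε₁ ε₂ L x w = 0) {m : ℤ} (hm : m < 0)
    (heig : ∀ w ∈ W, envAct ε₁ ε₂ L (gradingElement ε₁ ε₂) w = (topWeight ξ + (m : ℂ) / 2) • w)
    {w : L} (hw : w ∈ W) (hvw : v ∈ Submodule.span (Env ε₁ ε₂) {w}) : w = 0 := by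
  obtain ⟨u, hu⟩ := Submodule.mem_span_singleton.1 hvw
  have h2 : v ∈ ⨆ k, (hatLie ε₁ ε₂).negSpan (envAct ε₁ ε₂ L) W k := by
    rw [← hu]
    refine smul_mem_of_envAct_mem (fun x w hw => GradedLieSuper.act_mem_iSup_negSpan
      (envAct_isRep _) h0 hpos x hw) u ?_
    exact Submodule.mem_iSup_of_mem 0 (Submodule.subset_span (.base hw))
  -- The weights that occur are the top weight plus (m + k)/2 with m < 0 and k ≤ 0, so the top
  -- weight is never attained.
  have h3 : ⨆ k, (hatLie ε₁ ε₂).negSpan (envAct ε₁ ε₂ L) W k ≤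
      awayFrom (envAct ε₁ ε₂ L (gradingElement ε₁ ε₂)) (topWeight ξ) := by
    refine iSup_le fun k => Submodule.span_le.2 fun w hw => ?_
    refine mem_awayFrom_of_eigen ?_ (GradedLieSuper.negWord_eigen (envAct_isRep _)
      (gradingElement ε₁ ε₂).2 hatBracketL_gradingElement heig hw)
    intro h
    have : ((m + k : ℤ) : ℂ) = 0 := by
      push_cast
      linear_combination -2 * h
    have h4 : m + k = 0 := by exact_mod_cast this
    have := GradedLieSuper.NegWord.le hw
    omega
  -- So v = 0, and since v generates, the module is zero and w with it.
  have h4 := eq_zero_of_mem_awayFrom (hv.zero _) (h3 h2)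
  obtain ⟨u, rfl⟩ := hv.gen w
  rw [h4, smul_zero]

end HighestWeight

theorem vermaVector_pos {n : ℤ} (hn : 0 < n) {x : hatSD ε₁ ε₂} (hx : x ∈ gr ε₁ ε₂ n) :
    envAct ε₁ ε₂ _ x (vermaVector ξ) = 0 := by
  rw [envAct_apply, ← mkQ_eq_smul_vermaVector, Submodule.mkQ_apply, Submodule.Quotient.mk_eq_zero]
  exact Submodule.subset_span (.inl ⟨n, hn, x, hx, rfl⟩)

theorem vermaVector_zero (h : gr ε₁ ε₂ 0) :
    envAct ε₁ ε₂ _ h (vermaVector ξ) = ξ h • vermaVector ξ := by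
  have h1 : (vermaIdeal ε₁ ε₂ ξ).mkQ (toEnv ε₁ ε₂ h - algebraMap ℂ (Env ε₁ ε₂) (ξ h)) = 0 := by
    rw [Submodule.mkQ_apply, Submodule.Quotient.mk_eq_zero]
    exact Submodule.subset_span (.inr ⟨h, rfl⟩)
  rw [mkQ_eq_smul_vermaVector, sub_smul, sub_eq_zero] at h1
  rw [envAct_apply, h1, algebraMap_smul]

theorem vermaVector_isHighestWeight : IsHighestWeight ξ (vermaVector ξ) where
  pos _ hn _ hx := vermaVector_pos ξ hn hx
  zero h := vermaVector_zero ξ h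
  gen w := by
    obtain ⟨u, rfl⟩ := (vermaIdeal ε₁ ε₂ ξ).mkQ_surjective w
    exact ⟨u, mkQ_eq_smul_vermaVector ξ u⟩

/-- All proper submodules lie in one subspace on which the coefficient of v vanishes, whereas that
coefficient is 1 at v. -/
theorem vermaVector_notMem : vermaVector ξ ∉ maxSubmodule ε₁ ε₂ ξ := by
  -- Requiring the vanishing for all left multiples makes K a left ideal, so its image can contain a
  -- supremum of submodules.
  let K : Submodule (Env ε₁ ε₂) (Env ε₁ ε₂) :=
    { carrier := {u | ∀ a, hwCoeff ξ (a * u) = 0}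
      zero_mem' := by simp
      add_mem' := fun {a b} ha hb c => by rw [mul_add, map_add, ha, hb, add_zero]
      smul_mem' := fun a u hu c => by rw [smul_eq_mul, ← mul_assoc, hu] }
  have h1 : maxSubmodule ε₁ ε₂ ξ ≤ K.map (vermaIdeal ε₁ ε₂ ξ).mkQ := by
    refine sSup_le fun N hN w hw => ?_
    obtain ⟨u, rfl⟩ := (vermaIdeal ε₁ ε₂ ξ).mkQ_surjective w
    refine Submodule.mem_map_of_mem fun a => ?_
    refine (vermaVector_isHighestWeight ξ).coeff_eq_zero
      (fun n hn y hy u => hwCoeff_neg_mul ξ hn hy u) (fun u hu => hwCoeff_of_mem ξ ?_)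
      (hwCoeff_one ξ) hN (u := a * u) ?_
    · rwa [← mkQ_eq_smul_vermaVector, Submodule.mkQ_apply, Submodule.Quotient.mk_eq_zero] at hu
    · rw [← mkQ_eq_smul_vermaVector, ← smul_eq_mul, map_smul]
      exact N.smul_mem _ hw
  intro h
  obtain ⟨u, hu, hu'⟩ := h1 h
  have h2 : u - 1 ∈ vermaIdeal ε₁ ε₂ ξ := by
    rw [← Submodule.Quotient.mk_eq_zero, ← Submodule.mkQ_apply, map_sub, hu', vermaVector, sub_self]
  have h3 := hwCoeff_of_mem ξ h2
  have h4 := hu 1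
  rw [one_mul] at h4
  rw [map_sub, h4, hwCoeff_one] at h3
  norm_num at h3

theorem hwVector_ne_zero : hwVector ε₁ ε₂ ξ ≠ 0 := by
  intro h
  rw [hwVector, Submodule.mkQ_apply, Submodule.Quotient.mk_eq_zero] at h
  exact vermaVector_notMem ξ h

theorem hwVector_pos {n : ℤ} (hn : 0 < n) {x : hatSD ε₁ ε₂} (hx : x ∈ gr ε₁ ε₂ n) :
    envAct ε₁ ε₂ _ x (hwVector ε₁ ε₂ ξ) = 0 := by
  have := vermaVector_pos ξ hn hx
  rw [envAct_apply] at this ⊢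
  change _ • (maxSubmodule ε₁ ε₂ ξ).mkQ (vermaVector ξ) = 0
  rw [← map_smul, this, map_zero]

theorem hwVector_zero (h : gr ε₁ ε₂ 0) :
    envAct ε₁ ε₂ _ h (hwVector ε₁ ε₂ ξ) = ξ h • hwVector ε₁ ε₂ ξ := by
  have := vermaVector_zero ξ h
  rw [envAct_apply] at this ⊢
  change _ • (maxSubmodule ε₁ ε₂ ξ).mkQ (vermaVector ξ) = _
  rw [← map_smul, this]
  rfl

theorem hwVector_isHighestWeight : IsHighestWeight ξ (hwVector ε₁ ε₂ ξ) where
  pos _ hn _ hx := hwVector_pos ξ hn hx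
  zero h := hwVector_zero ξ h
  gen w := by
    obtain ⟨w, rfl⟩ := (maxSubmodule ε₁ ε₂ ξ).mkQ_surjective w
    obtain ⟨u, rfl⟩ := (vermaIdeal ε₁ ε₂ ξ).mkQ_surjective w
    exact ⟨u, by rw [mkQ_eq_smul_vermaVector, map_smul]; rfl⟩

/-- Singular vectors of the irreducible module whose weight is not the highest one vanish. -/
theorem eq_zero_of_singular {W : Submodule ℂ (Irr ε₁ ε₂ ξ)}
    (h0 : ∀ h ∈ gr ε₁ ε₂ 0, ∀ w ∈ W, envAct ε₁ ε₂ _ h w ∈ W)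
    (hpos : ∀ n > 0, ∀ x ∈ gr ε₁ ε₂ n, ∀ w ∈ W, envAct ε₁ ε₂ _ x w = 0) {m : ℤ} (hm : m < 0)
    (heig : ∀ w ∈ W, envAct ε₁ ε₂ _ (gradingElement ε₁ ε₂) w = (topWeight ξ + (m : ℂ) / 2) • w)
    {w : Irr ε₁ ε₂ ξ} (hw : w ∈ W) : w = 0 := by
  let N : Submodule (Env ε₁ ε₂) (Irr ε₁ ε₂ ξ) := Submodule.span _ {w}
  -- If the preimage of the submodule generated by w is proper, it is absorbed by the maximal
  -- submodule and w = 0. Otherwise w generates v, which its lower weight forbids unless w = 0.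
  by_cases hN : N.comap (maxSubmodule ε₁ ε₂ ξ).mkQ = ⊤
  · have h1 : hwVector ε₁ ε₂ ξ ∈ N := by
      have : vermaVector ξ ∈ N.comap (maxSubmodule ε₁ ε₂ ξ).mkQ := by
        rw [hN]
        trivial
      exact this
    exact (hwVector_isHighestWeight ξ).eq_zero_of_mem_span h0 hpos hm heig hw h1
  · have h1 : N.comap (maxSubmodule ε₁ ε₂ ξ).mkQ ≤ maxSubmodule ε₁ ε₂ ξ := le_sSup hN
    obtain ⟨w', rfl⟩ := (maxSubmodule ε₁ ε₂ ξ).mkQ_surjective w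
    have : w' ∈ maxSubmodule ε₁ ε₂ ξ := h1 (Submodule.mem_span_singleton_self _)
    rw [Submodule.mkQ_apply, Submodule.Quotient.mk_eq_zero]
    exact this

end SuperCircle

/-! ### Generating series of functionals on polynomials -/

namespace SuperCircle

/-- The series `μ(e^{x w})` attached to a linear functional `μ` on polynomials in `w`. -/
def genSeries (μ : ℂ[X] →ₗ[ℂ] ℂ) : PowerSeries ℂ :=
  PowerSeries.mk fun n => μ (X ^ n) / n.factorial

theorem genSeries_add (μ ν : ℂ[X] →ₗ[ℂ] ℂ) : genSeries (μ + ν) = genSeries μ + genSeries ν := by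
  ext n; simp [genSeries, add_div]

theorem genSeries_sub (μ ν : ℂ[X] →ₗ[ℂ] ℂ) : genSeries (μ - ν) = genSeries μ - genSeries ν := by
  ext n; simp [genSeries, sub_div]

theorem genSeries_smul (c : ℂ) (μ : ℂ[X] →ₗ[ℂ] ℂ) : genSeries (c • μ) = c • genSeries μ := by
  ext n; simp [genSeries, mul_div_assoc]

theorem genSeries_eq_zero {μ : ℂ[X] →ₗ[ℂ] ℂ} : genSeries μ = 0 ↔ ∀ p, μ p = 0 := by
  constructor
  · intro h p
    have : ∀ n, μ (X ^ n) = 0 := fun n => by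
      have := congr_arg (PowerSeries.coeff n) h
      simpa [genSeries, Nat.factorial_ne_zero] using this
    induction p using Polynomial.induction_on' with
    | add p q hp hq => rw [map_add, hp, hq, add_zero]
    | monomial n a => rw [← C_mul_X_pow_eq_monomial, ← smul_eq_C_mul, map_smul, this, smul_zero]
  · intro h
    ext n
    simp [genSeries, h]

theorem derivative_genSeries (μ : ℂ[X] →ₗ[ℂ] ℂ) :
    PowerSeries.derivative ℂ (genSeries μ) = genSeries (μ ∘ₗ LinearMap.mulLeft ℂ X) := by
  ext n
  have h : ((n.factorial : ℕ) : ℂ) ≠ 0 := by exact_mod_cast n.factorial_ne_zero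
  have h' : ((n : ℂ) + 1) ≠ 0 := by exact_mod_cast n.succ_ne_zero
  rw [PowerSeries.coeff_derivative]
  simp only [genSeries, PowerSeries.coeff_mk, LinearMap.comp_apply, LinearMap.mulLeft_apply,
    ← pow_succ', Nat.factorial_succ]
  push_cast
  field_simp

/-- Since d/dx e^{xw} = w e^{xw}, a constant-coefficient operator p(d/dx) multiplies the argument of
μ by p(w). -/
theorem diffOp_genSeries (p : ℂ[X]) (μ : ℂ[X] →ₗ[ℂ] ℂ) :
    diffOp p (genSeries μ) = genSeries (μ ∘ₗ LinearMap.mulLeft ℂ p) := by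
  induction p using Polynomial.induction_on' with
  | add p q hp hq =>
    have : μ ∘ₗ LinearMap.mulLeft ℂ (p + q) =
        μ ∘ₗ LinearMap.mulLeft ℂ p + μ ∘ₗ LinearMap.mulLeft ℂ q := by
      ext1; ext; simp [add_mul]
    rw [this, genSeries_add, ← hp, ← hq, diffOp, map_add]
    rfl
  | monomial n a =>
    have h : ∀ n : ℕ, ∀ μ, ((PowerSeries.derivative ℂ :
        Derivation ℂ (PowerSeries ℂ) (PowerSeries ℂ)).toLinearMap ^ n) (genSeries μ) =
          genSeries (μ ∘ₗ LinearMap.mulLeft ℂ (X ^ n)) := by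
      intro n
      induction n with
      | zero =>
        intro μ
        have : μ ∘ₗ LinearMap.mulLeft ℂ (X ^ 0) = μ := by ext1; ext; simp
        rw [this, pow_zero]
        rfl
      | succ n ih =>
        intro μ
        rw [pow_succ, Module.End.mul_apply]
        have : (PowerSeries.derivative ℂ :
            Derivation ℂ (PowerSeries ℂ) (PowerSeries ℂ)).toLinearMap (genSeries μ) =
              genSeries (μ ∘ₗ LinearMap.mulLeft ℂ X) := derivative_genSeries μ
        rw [this, ih]
        congr 1
        ext1; ext; simp [pow_succ']
    rw [diffOp, aeval_monomial, Module.End.mul_apply, h]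
    have : μ ∘ₗ LinearMap.mulLeft ℂ (monomial n a) = a • (μ ∘ₗ LinearMap.mulLeft ℂ (X ^ n)) := by
      ext1
      ext
      simp only [LinearMap.comp_apply, LinearMap.smul_apply, LinearMap.mulLeft_apply, ← map_smul,
        ← smul_mul_assoc]
      rw [smul_eq_C_mul, C_mul_X_pow_eq_monomial]
    rw [this, genSeries_smul]
    rfl

/-- Since e^{ax} e^{xw} = e^{x(w + a)}; at the level of coefficients this is the binomial theorem.
-/
theorem expSeries_mul_genSeries (a : ℂ) (μ : ℂ[X] →ₗ[ℂ] ℂ) :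
    expSeries a * genSeries μ = genSeries (μ ∘ₗ (aeval (X + C a)).toLinearMap) := by
  ext n
  have h : ((n.factorial : ℕ) : ℂ) ≠ 0 := by exact_mod_cast n.factorial_ne_zero
  rw [PowerSeries.coeff_mul]
  simp only [genSeries, expSeries, PowerSeries.coeff_mk, PowerSeries.coeff_rescale,
    PowerSeries.coeff_exp, LinearMap.comp_apply, AlgHom.toLinearMap_apply, map_pow, aeval_X]
  rw [add_comm X, (Commute.all (C a) X).add_pow', map_sum, Finset.sum_div]
  refine Finset.sum_congr rfl fun ij hij => ?_
  have hn : ij.1 + ij.2 = n := Finset.HasAntidiagonal.mem_antidiagonal.1 hij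
  have h1 : ((ij.1.factorial : ℕ) : ℂ) ≠ 0 := by exact_mod_cast ij.1.factorial_ne_zero
  have h2 : ((ij.2.factorial : ℕ) : ℂ) ≠ 0 := by exact_mod_cast ij.2.factorial_ne_zero
  have h3 : ((n.choose ij.1 : ℕ) : ℂ) * ij.1.factorial * ij.2.factorial = n.factorial := by
    rw [← hn, Nat.choose_symm_add]
    exact_mod_cast Nat.add_choose_mul_factorial_mul_factorial ij.1 ij.2
  rw [map_nsmul, ← C_pow, ← smul_eq_C_mul, map_smul, nsmul_eq_mul, smul_eq_mul, ← h3]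
  have h4 : ((n.choose ij.1 : ℕ) : ℂ) ≠ 0 := fun h0 => h (by rw [← h3, h0]; ring)
  simp
  field_simp

variable {ε₁ ε₂ : ℤˣ} (ξ : Module.Dual ℂ (gr ε₁ ε₂ 0))

/-- The functional `p ↦ ξ(∂_θ θ p(D) - θ ∂_θ p(-D - 1))`. -/
def weightFun : ℂ[X] →ₗ[ℂ] ℂ where
  toFun p := ξ (cartan ε₁ ε₂ p _ rfl)
  map_add' p q := by
    rw [← map_add]
    congr 1
    refine Subtype.ext (Subtype.ext (Prod.ext ?_ ?_))
    · ext1 r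
      ext1 i j
      by_cases hr : r = 0
      · subst hr
        fin_cases i <;> fin_cases j <;> (simp [cartan, diagOp]; try ring)
      · simp [cartan, diagOp, Finsupp.single_eq_of_ne hr]
    · simp [cartan]
  map_smul' c p := by
    rw [RingHom.id_apply, ← map_smul]
    congr 1
    refine Subtype.ext (Subtype.ext (Prod.ext ?_ ?_))
    · ext1 r
      ext1 i j
      by_cases hr : r = 0
      · subst hr
        fin_cases i <;> fin_cases j <;> simp [cartan, diagOp]
      · simp [cartan, diagOp, Finsupp.single_eq_of_ne hr]
    · simp [cartan]

theorem weight_cartan (p q : ℂ[X]) (h : q = -p.comp (-X - 1)) :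
    ξ (cartan ε₁ ε₂ p q h) = weightFun ξ p := by
  subst h
  rfl

theorem Delta0_eq : Delta0 ε₁ ε₂ ξ = genSeries ((-1 / 2 : ℂ) •
    (weightFun ξ ∘ₗ ((aeval dHalf).toLinearMap - (aeval (-dHalf)).toLinearMap))) := by
  ext n
  simp only [Delta0, genSeries, PowerSeries.coeff_mk, weight_cartan, sinhCoeff, LinearMap.smul_apply,
    LinearMap.comp_apply, LinearMap.sub_apply, AlgHom.toLinearMap_apply, map_pow, aeval_X]
  rw [← smul_eq_C_mul, map_smul, smul_eq_mul, smul_eq_mul]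
  field_simp

theorem Delta1_eq : Delta1 ε₁ ε₂ ξ = genSeries ((1 / 2 : ℂ) •
    (weightFun ξ ∘ₗ ((aeval dHalf).toLinearMap + (aeval (-dHalf)).toLinearMap))) := by
  ext n
  simp only [Delta1, genSeries, PowerSeries.coeff_mk, weight_cartan, coshCoeff, LinearMap.smul_apply,
    LinearMap.comp_apply, LinearMap.add_apply, AlgHom.toLinearMap_apply, map_pow, aeval_X]
  rw [← smul_eq_C_mul, map_neg, map_smul, smul_eq_mul, smul_eq_mul]
  field_simp

theorem diffOp_Delta0 (β : ℂ[X]) : diffOp β (Delta0 ε₁ ε₂ ξ) = 0 ↔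
    ∀ p, weightFun ξ ((β * p).comp dHalf - (β * p).comp (-dHalf)) = 0 := by
  rw [Delta0_eq, diffOp_genSeries, genSeries_eq_zero]
  refine forall_congr' fun p => ?_
  simp [aeval_def, eval₂_eq_eval_map, comp, -mul_comp]

/-- The functional whose generating series enters the condition on `α`. -/
def weightFun' : ℂ[X] →ₗ[ℂ] ℂ :=
  weightFun ξ ∘ₗ ((aeval (-X : ℂ[X])).toLinearMap - LinearMap.id)

/-- Regroup as e^{x/2}(Δ₀ + Δ₁) + e^{-x/2}(Δ₀ - Δ₁). In each bracket only one of the substitutions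
±(w + 1/2) survives, and the exponential translates it to -w or w. The constant 2c is the series of
2c times evaluation at 0. -/
theorem combined_series_eq (c : ℂ) :
    (expSeries (1 / 2) + expSeries (-(1 / 2))) * Delta0 ε₁ ε₂ ξ +
      (expSeries (1 / 2) - expSeries (-(1 / 2))) * Delta1 ε₁ ε₂ ξ - PowerSeries.C (2 * c) =
    genSeries (weightFun' ξ - (2 * c) • (aeval (0 : ℂ)).toLinearMap) := by
  have hC : PowerSeries.C (2 * c) = genSeries ((2 * c) • (aeval (0 : ℂ)).toLinearMap) := by
    ext n
    rw [PowerSeries.coeff_C]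
    by_cases hn : n = 0
    · subst hn
      simp [genSeries]
    · simp [genSeries, hn]
  rw [Delta0_eq, Delta1_eq, add_mul, sub_mul, expSeries_mul_genSeries, expSeries_mul_genSeries,
    expSeries_mul_genSeries, expSeries_mul_genSeries, hC, ← genSeries_add, ← genSeries_sub,
    ← genSeries_add, ← genSeries_sub]
  congr 1
  refine LinearMap.ext fun p => ?_
  have hcomp : ∀ (q : ℂ[X]) (a : ℂ), aeval q (aeval (X + C a) p) = aeval (q + C a) p := by
    intro q a
    rw [← aeval_algHom_apply]
    simp
  have e1 : dHalf + C (-(1 / 2)) = X := by simp [dHalf]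
  have e2 : -dHalf + C (1 / 2) = -X := by simp [dHalf]
  simp only [weightFun', LinearMap.sub_apply, LinearMap.add_apply, LinearMap.smul_apply,
    LinearMap.comp_apply, AlgHom.toLinearMap_apply, hcomp, e1, e2, map_sub, map_add, aeval_X_left,
    AlgHom.id_apply, LinearMap.id_apply, smul_eq_mul]
  ring

theorem diffOp_combined (α : ℂ[X]) (c : ℂ) : diffOp α
    ((expSeries (1 / 2) + expSeries (-(1 / 2))) * Delta0 ε₁ ε₂ ξ +
      (expSeries (1 / 2) - expSeries (-(1 / 2))) * Delta1 ε₁ ε₂ ξ - PowerSeries.C (2 * c)) = 0 ↔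
    ∀ p, weightFun ξ (α * p - (α * p).comp (-X)) + 2 * c * (α * p).eval 0 = 0 := by
  rw [combined_series_eq, diffOp_genSeries, genSeries_eq_zero]
  refine forall_congr' fun p => ?_
  have : aeval (-X : ℂ[X]) (α * p) = (α * p).comp (-X) := rfl
  simp only [weightFun', LinearMap.sub_apply, LinearMap.smul_apply,
    LinearMap.comp_apply, AlgHom.toLinearMap_apply, LinearMap.mulLeft_apply, this,
    LinearMap.id_apply, smul_eq_mul, coe_aeval_eq_eval, map_sub]
  rw [← neg_eq_zero]
  constructor <;> intro h <;> linear_combination h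

end SuperCircle

/-! ### Elements t^r F(D) of the fixed subalgebra and the Cartan action on them -/

namespace SuperCircle

variable (ε₁ ε₂ : ℤˣ)

/-- The polynomial `-w - r - 1`. -/
def reflect (r : ℤ) : ℂ[X] := -X - C ((r : ℂ) + 1)

theorem reflect_comp (r : ℤ) : (reflect r).comp (reflect r) = X := by
  simp only [reflect, sub_comp, neg_comp, X_comp, C_comp]
  ring

/-- The constant polynomial `ε₁ ^ r`. -/
def signPow (r : ℤ) : ℂ[X] := C (((ε₁ ^ r : ℤˣ) : ℤ) : ℂ)

theorem signPow_mul_self (r : ℤ) : signPow ε₁ r * signPow ε₁ r = 1 := by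
  rcases Int.units_eq_one_or (ε₁ ^ r) with h | h <;> simp [signPow, h]

theorem signPow_comp (r : ℤ) (p : ℂ[X]) : (signPow ε₁ r).comp p = signPow ε₁ r := by
  simp [signPow]

/-- The constant polynomial `ε₁ ^ r ε₂`. -/
def signTwist (r : ℤ) : ℂ[X] := signPow ε₁ r * C ((ε₂ : ℤ) : ℂ)

theorem signTwist_mul_self (r : ℤ) : signTwist ε₁ ε₂ r * signTwist ε₁ ε₂ r = 1 := by
  have h : (C ((ε₂ : ℤ) : ℂ) : ℂ[X]) * C ((ε₂ : ℤ) : ℂ) = 1 := by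
    rcases Int.units_eq_one_or ε₂ with h | h <;> simp [h]
  rw [signTwist]
  linear_combination signPow_mul_self ε₁ r * (C ((ε₂ : ℤ) : ℂ) : ℂ[X]) ^ 2 + h

theorem signTwist_comp (r : ℤ) (p : ℂ[X]) : (signTwist ε₁ ε₂ r).comp p = signTwist ε₁ ε₂ r := by
  simp [signTwist, signPow]

theorem sigmaMat_eq (r : ℤ) (F : Mat) : sigmaMat ε₁ ε₂ r F =
    !![signPow ε₁ r * (F 1 1).comp (reflect r), -(signTwist ε₁ ε₂ r * (F 0 1).comp (reflect r));
      signTwist ε₁ ε₂ r * (F 1 0).comp (reflect r), signPow ε₁ r * (F 0 0).comp (reflect r)] := rfl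

theorem sigma_single {r : ℤ} {F : Mat} (h : sigmaMat ε₁ ε₂ r F = -F) :
    sigma ε₁ ε₂ (Finsupp.single r F) = -Finsupp.single r F := by
  ext1 s
  rw [sigma_apply, Finsupp.neg_apply]
  by_cases hs : r = s
  · subst hs
    rw [Finsupp.single_eq_same, h]
  · rw [Finsupp.single_eq_of_ne (Ne.symm hs), sigmaMat_zero, neg_zero]

/-- The polynomial `p(w) - ε₁ ^ r ε₂ p(-w - r - 1)`. -/
def lowPoly (r : ℤ) : ℂ[X] →ₗ[ℂ] ℂ[X] :=
  LinearMap.id - LinearMap.mulLeft ℂ (signTwist ε₁ ε₂ r) ∘ₗ (aeval (reflect r)).toLinearMap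

/-- The polynomial `p(w) + ε₁ ^ r ε₂ p(-w - r - 1)`. -/
def upPoly (r : ℤ) : ℂ[X] →ₗ[ℂ] ℂ[X] :=
  LinearMap.id + LinearMap.mulLeft ℂ (signTwist ε₁ ε₂ r) ∘ₗ (aeval (reflect r)).toLinearMap

theorem lowPoly_apply (r : ℤ) (p : ℂ[X]) :
    lowPoly ε₁ ε₂ r p = p - signTwist ε₁ ε₂ r * p.comp (reflect r) := rfl

theorem upPoly_apply (r : ℤ) (p : ℂ[X]) :
    upPoly ε₁ ε₂ r p = p + signTwist ε₁ ε₂ r * p.comp (reflect r) := rfl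

theorem signTwist_mul_lowPoly_comp (r : ℤ) (p : ℂ[X]) :
    signTwist ε₁ ε₂ r * (lowPoly ε₁ ε₂ r p).comp (reflect r) = -lowPoly ε₁ ε₂ r p := by
  rw [lowPoly_apply, sub_comp, mul_comp, comp_assoc, reflect_comp, comp_X, signTwist_comp]
  linear_combination -p * signTwist_mul_self ε₁ ε₂ r

theorem signTwist_mul_upPoly_comp (r : ℤ) (p : ℂ[X]) :
    signTwist ε₁ ε₂ r * (upPoly ε₁ ε₂ r p).comp (reflect r) = upPoly ε₁ ε₂ r p := by
  rw [upPoly_apply, add_comp, mul_comp, comp_assoc, reflect_comp, comp_X, signTwist_comp]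
  linear_combination p * signTwist_mul_self ε₁ ε₂ r

/-- The element `t ^ r (∂_θ θ p(D) + θ ∂_θ q(D))` of the fixed subalgebra. -/
def diagElt (r : ℤ) : ℂ[X] →ₗ[ℂ] hatSD ε₁ ε₂ where
  toFun p := ⟨(Finsupp.single r !![p, 0; 0, -(signPow ε₁ r * p.comp (reflect r))], 0), by
    refine sigma_single ε₁ ε₂ ?_
    rw [sigmaMat_eq]
    ext1 i j
    fin_cases i <;> fin_cases j
    · simp [comp_assoc, reflect_comp, signPow_comp, ← mul_assoc, signPow_mul_self]
    · simp
    · simp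
    · simp⟩
  map_add' p q := by
    refine Subtype.ext (Prod.ext ?_ (by simp))
    refine Eq.trans (congrArg (Finsupp.single r) ?_) (Finsupp.single_add _ _ _)
    ext1 i j
    fin_cases i <;> fin_cases j <;> simp
    ring
  map_smul' c p := by
    refine Subtype.ext (Prod.ext ?_ (by simp))
    refine Eq.trans (congrArg (Finsupp.single r) ?_) (Finsupp.smul_single _ _ _).symm
    ext1 i j
    fin_cases i <;> fin_cases j <;> simp

/-- The element `t ^ r θ F(D)` of the fixed subalgebra, `F` being the symmetrization of `p`. -/
def lowElt (r : ℤ) : ℂ[X] →ₗ[ℂ] hatSD ε₁ ε₂ where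
  toFun p := ⟨(Finsupp.single r !![0, 0; lowPoly ε₁ ε₂ r p, 0], 0), by
    refine sigma_single ε₁ ε₂ ?_
    rw [sigmaMat_eq]
    ext1 i j
    fin_cases i <;> fin_cases j
    · simp
    · simp
    · simpa using signTwist_mul_lowPoly_comp ε₁ ε₂ r p
    · simp⟩
  map_add' p q := by
    refine Subtype.ext (Prod.ext ?_ (by simp))
    refine Eq.trans (congrArg (Finsupp.single r) ?_) (Finsupp.single_add _ _ _)
    ext1 i j
    fin_cases i <;> fin_cases j <;> simp
  map_smul' c p := by
    refine Subtype.ext (Prod.ext ?_ (by simp))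
    refine Eq.trans (congrArg (Finsupp.single r) ?_) (Finsupp.smul_single _ _ _).symm
    ext1 i j
    fin_cases i <;> fin_cases j <;> simp

/-- The element `t ^ r ∂_θ F(D)` of the fixed subalgebra, `F` being the symmetrization of `p`. -/
def upElt (r : ℤ) : ℂ[X] →ₗ[ℂ] hatSD ε₁ ε₂ where
  toFun p := ⟨(Finsupp.single r !![0, upPoly ε₁ ε₂ r p; 0, 0], 0), by
    refine sigma_single ε₁ ε₂ ?_
    rw [sigmaMat_eq]
    ext1 i j
    fin_cases i <;> fin_cases j
    · simp
    · simpa using signTwist_mul_upPoly_comp ε₁ ε₂ r p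
    · simp
    · simp⟩
  map_add' p q := by
    refine Subtype.ext (Prod.ext ?_ (by simp))
    refine Eq.trans (congrArg (Finsupp.single r) ?_) (Finsupp.single_add _ _ _)
    ext1 i j
    fin_cases i <;> fin_cases j <;> simp
  map_smul' c p := by
    refine Subtype.ext (Prod.ext ?_ (by simp))
    refine Eq.trans (congrArg (Finsupp.single r) ?_) (Finsupp.smul_single _ _ _).symm
    ext1 i j
    fin_cases i <;> fin_cases j <;> simp

theorem diagElt_fst (r : ℤ) (p : ℂ[X]) : (diagElt ε₁ ε₂ r p).1.1 =
    Finsupp.single r !![p, 0; 0, -(signPow ε₁ r * p.comp (reflect r))] := rfl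

theorem lowElt_fst (r : ℤ) (p : ℂ[X]) : (lowElt ε₁ ε₂ r p).1.1 =
    Finsupp.single r !![0, 0; lowPoly ε₁ ε₂ r p, 0] := rfl

theorem upElt_fst (r : ℤ) (p : ℂ[X]) : (upElt ε₁ ε₂ r p).1.1 =
    Finsupp.single r !![0, upPoly ε₁ ε₂ r p; 0, 0] := rfl

theorem single_mem_sdDeg {n r : ℤ} {F : Mat}
    (h : ∀ i j : Fin 2, F i j ≠ 0 → 2 * r + (i : ℤ) - (j : ℤ) = n) :
    Finsupp.single r F ∈ sdDeg n := by
  intro s i j hs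
  by_cases hr : r = s
  · subst hr
    rw [Finsupp.single_eq_same] at hs
    exact h i j hs
  · rw [Finsupp.single_eq_of_ne (Ne.symm hr)] at hs
    exact absurd rfl hs

theorem diagElt_mem (r : ℤ) (p : ℂ[X]) : diagElt ε₁ ε₂ r p ∈ gr ε₁ ε₂ (2 * r) := by
  refine ⟨single_mem_sdDeg fun i j h => ?_, fun h => absurd rfl h⟩
  fin_cases i <;> fin_cases j <;> simp at h ⊢

theorem lowElt_mem (r : ℤ) (p : ℂ[X]) : lowElt ε₁ ε₂ r p ∈ gr ε₁ ε₂ (2 * r + 1) := by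
  refine ⟨single_mem_sdDeg fun i j h => ?_, fun h => absurd rfl h⟩
  fin_cases i <;> fin_cases j <;> simp at h ⊢

theorem upElt_mem (r : ℤ) (p : ℂ[X]) : upElt ε₁ ε₂ r p ∈ gr ε₁ ε₂ (2 * r - 1) := by
  refine ⟨single_mem_sdDeg fun i j h => ?_, fun h => absurd rfl h⟩
  fin_cases i <;> fin_cases j <;> simp at h ⊢

variable {ε₁ ε₂}

theorem eq_diagElt {r : ℤ} (hr : r ≠ 0) {x : hatSD ε₁ ε₂} (hx : x ∈ gr ε₁ ε₂ (2 * r)) :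
    x = diagElt ε₁ ε₂ r (x.1.1 r 0 0) := by
  refine Subtype.ext (Prod.ext ?_ ?_)
  · rw [diagElt_fst]
    ext1 s
    have hσ := DFunLike.congr_fun x.2 s
    rw [sigma_apply, sigmaMat_eq] at hσ
    have h11 := congr_fun (congr_fun hσ 1) 1
    ext1 i j
    by_cases hs : r = s
    · subst hs
      have hij : i ≠ j → x.1.1 r i j = 0 := fun hij => by
        by_contra h0
        have := hx.1 r i j h0
        exact hij (Fin.ext (by omega))
      fin_cases i <;> fin_cases j
      · simp
      · simpa using hij (by simp)
      · simpa using hij (by simp)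
      · simp at h11
        simp [h11]
    · rw [Finsupp.single_eq_of_ne (Ne.symm hs)]
      by_contra h0
      have := hx.1 s i j h0
      omega
  · by_contra h0
    have := hx.2 h0
    omega

/-- Symmetrizing half of an already symmetric polynomial returns it, so every θ-entry allowed by σ
comes from `lowElt`. -/
theorem lowPoly_half {r : ℤ} {F : ℂ[X]} (h : signTwist ε₁ ε₂ r * F.comp (reflect r) = -F) :
    lowPoly ε₁ ε₂ r ((1 / 2 : ℂ) • F) = F := by
  rw [map_smul, lowPoly_apply, h, sub_neg_eq_add, ← two_smul ℂ, smul_smul]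
  norm_num

theorem upPoly_half {r : ℤ} {F : ℂ[X]} (h : signTwist ε₁ ε₂ r * F.comp (reflect r) = F) :
    upPoly ε₁ ε₂ r ((1 / 2 : ℂ) • F) = F := by
  rw [map_smul, upPoly_apply, h, ← two_smul ℂ, smul_smul]
  norm_num

theorem entry_low (x : hatSD ε₁ ε₂) (r : ℤ) :
    signTwist ε₁ ε₂ r * (x.1.1 r 1 0).comp (reflect r) = -x.1.1 r 1 0 := by
  have hσ := DFunLike.congr_fun x.2 r
  rw [sigma_apply, sigmaMat_eq] at hσ
  simpa using congr_fun (congr_fun hσ 1) 0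

theorem entry_up (x : hatSD ε₁ ε₂) (r : ℤ) :
    signTwist ε₁ ε₂ r * (x.1.1 r 0 1).comp (reflect r) = x.1.1 r 0 1 := by
  have hσ := DFunLike.congr_fun x.2 r
  rw [sigma_apply, sigmaMat_eq] at hσ
  simpa using congr_fun (congr_fun hσ 0) 1

theorem eq_lowElt_add_upElt {r : ℤ} {x : hatSD ε₁ ε₂} (hx : x ∈ gr ε₁ ε₂ (2 * r + 1)) :
    x = lowElt ε₁ ε₂ r ((1 / 2 : ℂ) • x.1.1 r 1 0) +
      upElt ε₁ ε₂ (r + 1) ((1 / 2 : ℂ) • x.1.1 (r + 1) 0 1) := by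
  refine Subtype.ext (Prod.ext ?_ ?_)
  · have e : ∀ a b : hatSD ε₁ ε₂, (a + b).1.1 = a.1.1 + b.1.1 := fun _ _ => rfl
    rw [e, lowElt_fst, upElt_fst, lowPoly_half (entry_low x r), upPoly_half (entry_up x (r + 1))]
    ext1 s
    ext1 i j
    have h0 : 2 * s + (i : ℤ) - (j : ℤ) ≠ 2 * r + 1 → x.1.1 s i j = 0 := fun h => by
      by_contra h0
      exact h (hx.1 s i j h0)
    by_cases h1 : r = s
    · subst h1
      fin_cases i <;> fin_cases j <;> simp <;> exact h0 (by simp <;> omega)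
    · by_cases h2 : r + 1 = s
      · subst h2
        fin_cases i <;> fin_cases j <;> simp <;> exact h0 (by simp <;> omega)
      · simp only [Finsupp.add_apply, Finsupp.single_eq_of_ne (Ne.symm h1),
          Finsupp.single_eq_of_ne (Ne.symm h2), add_zero]
        refine h0 ?_
        fin_cases i <;> fin_cases j <;> simp <;> omega
  · by_contra h0
    have := hx.2 fun h => h0 (h.trans (by simp [lowElt, upElt]))
    omega

/-- The bracket stays in degree 2r with r ≠ 0, where an element is determined by its upper left
entry. -/
theorem hatBracketL_cartan_diagElt (f : ℂ[X]) (r : ℤ) (p : ℂ[X]) (hr : r ≠ 0) :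
    hatBracketL ε₁ ε₂ (cartan ε₁ ε₂ f _ rfl) (diagElt ε₁ ε₂ r p) =
      diagElt ε₁ ε₂ r ((f.comp (X + C (r : ℂ)) - f) * p) := by
  have := hatBracketL_mem ε₁ ε₂ (cartan ε₁ ε₂ f _ rfl).2 (diagElt_mem ε₁ ε₂ r p)
  rw [zero_add] at this
  rw [eq_diagElt hr this, hatBracketL_fst, bracketL_cartan, diagElt_fst]
  simp

/-- The Cartan element multiplies F by h(w) + h(-w - r - 1), and the σ-symmetry of F turns this into
the symmetrization of hF. -/
theorem hatBracketL_cartan_lowElt (h : ℂ[X]) (r : ℤ) (p : ℂ[X]) :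
    hatBracketL ε₁ ε₂ (cartan ε₁ ε₂ (-h) _ rfl) (lowElt ε₁ ε₂ r p) =
      lowElt ε₁ ε₂ r (h * lowPoly ε₁ ε₂ r p) := by
  have e : ((-X - 1 : ℂ[X])).comp (X + C (r : ℂ)) = reflect r := by
    simp [reflect]
    ring
  refine Subtype.ext (Prod.ext ?_ ?_)
  · rw [hatBracketL_fst]
    ext1 s
    ext1 i j
    rw [bracketL_cartan, lowElt_fst, lowElt_fst]
    by_cases hs : r = s
    · subst hs
      fin_cases i <;> fin_cases j
      · simp
      · simp
      · have := signTwist_mul_lowPoly_comp ε₁ ε₂ r p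
        simp [comp_assoc, lowPoly_apply ε₁ ε₂ r (_ * _), -sub_comp]
        rw [← sub_eq_zero, show (-X - 1 : ℂ[X]).comp (X + (r : ℂ[X])) = reflect r by
          simpa using e]
        linear_combination h.comp (reflect r) * this
      · simp
    · simp [Finsupp.single_eq_of_ne (Ne.symm hs)]
  · rw [hatBracketL_snd, cocycleL_cartan]
    rfl

/-- As for θ; the argument is translated by -r because the left entry is the one shifted past t^r.
-/
theorem hatBracketL_cartan_upElt (h : ℂ[X]) (r : ℤ) (p : ℂ[X]) :
    hatBracketL ε₁ ε₂ (cartan ε₁ ε₂ (h.comp (X - C (r : ℂ))) _ rfl) (upElt ε₁ ε₂ r p) =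
      upElt ε₁ ε₂ r (h * upPoly ε₁ ε₂ r p) := by
  have e : ((X : ℂ[X]) - C (r : ℂ)).comp (-X - 1) = reflect r := by
    simp [reflect]
    ring
  have e' : ((X : ℂ[X]) - C (r : ℂ)).comp (X + C (r : ℂ)) = X := by
    simp
  refine Subtype.ext (Prod.ext ?_ ?_)
  · rw [hatBracketL_fst]
    ext1 s
    ext1 i j
    rw [bracketL_cartan, upElt_fst, upElt_fst]
    by_cases hs : r = s
    · subst hs
      fin_cases i <;> fin_cases j
      · simp
      · have := signTwist_mul_upPoly_comp ε₁ ε₂ r p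
        simp only [Finsupp.single_eq_same, comp_assoc, e, e', comp_X, Fin.zero_eta, Fin.mk_one,
          Matrix.cons_val_zero, Matrix.cons_val_one, Matrix.of_apply, Matrix.cons_val',
          Matrix.cons_val_fin_one, upPoly_apply ε₁ ε₂ r (_ * _), mul_comp]
        linear_combination h.comp (reflect r) * (-this)
      · simp
      · simp
    · simp [Finsupp.single_eq_of_ne (Ne.symm hs)]
  · rw [hatBracketL_snd, cocycleL_cartan]
    rfl

end SuperCircle

/-! ### Brackets of the basic elements and propagation of annihilators -/

namespace SuperCircle

variable {ε₁ ε₂ : ℤˣ}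

theorem hatBracketL_fst_single {x y : hatSD ε₁ ε₂} {r s : ℤ} {F G : Mat}
    (hx : x.1.1 = Finsupp.single r F) (hy : y.1.1 = Finsupp.single s G) :
    (hatBracketL ε₁ ε₂ x y).1.1 = Finsupp.single (r + s) (superComm r s F G) := by
  rw [hatBracketL_fst, hx, hy, bracketL_apply, bracket_single]

theorem bracket_low_up (r s : ℤ) (p p' : ℂ[X]) :
    (hatBracketL ε₁ ε₂ (lowElt ε₁ ε₂ r p) (upElt ε₁ ε₂ s p')).1.1 (r + s) 0 0 =
      (upPoly ε₁ ε₂ s p').comp (X + C (r : ℂ)) * lowPoly ε₁ ε₂ r p := by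
  rw [hatBracketL_fst_single (lowElt_fst ε₁ ε₂ r p) (upElt_fst ε₁ ε₂ s p')]
  simp [superComm, shift]

theorem bracket_up_low (r s : ℤ) (p p' : ℂ[X]) :
    (hatBracketL ε₁ ε₂ (upElt ε₁ ε₂ r p) (lowElt ε₁ ε₂ s p')).1.1 (r + s) 0 0 =
      (upPoly ε₁ ε₂ r p).comp (X + C (s : ℂ)) * lowPoly ε₁ ε₂ s p' := by
  rw [hatBracketL_fst_single (upElt_fst ε₁ ε₂ r p) (lowElt_fst ε₁ ε₂ s p')]
  simp [superComm, shift]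

theorem bracket_diag_low (r s : ℤ) (p p' : ℂ[X]) :
    (hatBracketL ε₁ ε₂ (diagElt ε₁ ε₂ r p) (lowElt ε₁ ε₂ s p')).1.1 (r + s) 1 0 =
      -(signPow ε₁ r * p.comp ((reflect r).comp (X + C (s : ℂ)))) * lowPoly ε₁ ε₂ s p' -
        (lowPoly ε₁ ε₂ s p').comp (X + C (r : ℂ)) * p := by
  rw [hatBracketL_fst_single (diagElt_fst ε₁ ε₂ r p) (lowElt_fst ε₁ ε₂ s p')]
  simp [superComm, shift, signPow_comp, comp_assoc]

theorem bracket_diag_up (r s : ℤ) (p p' : ℂ[X]) :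
    (hatBracketL ε₁ ε₂ (diagElt ε₁ ε₂ r p) (upElt ε₁ ε₂ s p')).1.1 (r + s) 0 1 =
      p.comp (X + C (s : ℂ)) * upPoly ε₁ ε₂ s p' +
        (upPoly ε₁ ε₂ s p').comp (X + C (r : ℂ)) * (signPow ε₁ r * p.comp (reflect r)) := by
  rw [hatBracketL_fst_single (diagElt_fst ε₁ ε₂ r p) (upElt_fst ε₁ ε₂ s p')]
  simp [superComm, shift]

theorem bracket_diag_diag (r s : ℤ) (p p' : ℂ[X]) :
    (hatBracketL ε₁ ε₂ (diagElt ε₁ ε₂ r p) (diagElt ε₁ ε₂ s p')).1.1 (r + s) 0 0 =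
      p.comp (X + C (s : ℂ)) * p' - p'.comp (X + C (r : ℂ)) * p := by
  rw [hatBracketL_fst_single (diagElt_fst ε₁ ε₂ r p) (diagElt_fst ε₁ ε₂ s p')]
  simp [superComm, shift]

theorem hatBracketL_low_low (r s : ℤ) (p p' : ℂ[X]) :
    hatBracketL ε₁ ε₂ (lowElt ε₁ ε₂ r p) (lowElt ε₁ ε₂ s p') = 0 := by
  refine Subtype.ext (Prod.ext ?_ ?_)
  · rw [hatBracketL_fst_single (lowElt_fst ε₁ ε₂ r p) (lowElt_fst ε₁ ε₂ s p')]
    refine Finsupp.single_eq_zero.2 ?_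
    ext1 i j
    fin_cases i <;> fin_cases j <;> simp [superComm, shift]
  · rw [hatBracketL_snd, cocycleL_apply, lowElt_fst, lowElt_fst, cocycle_eq,
      Finsupp.sum_single_index]
    · by_cases h : s = -r
      · subst h
        simp [strMul, orientedSum]
      · simp [Finsupp.single_eq_of_ne (Ne.symm h), strMul, orientedSum]
    · simp [strMul, orientedSum]

theorem hatBracketL_up_up (r s : ℤ) (p p' : ℂ[X]) :
    hatBracketL ε₁ ε₂ (upElt ε₁ ε₂ r p) (upElt ε₁ ε₂ s p') = 0 := by
  refine Subtype.ext (Prod.ext ?_ ?_)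
  · rw [hatBracketL_fst_single (upElt_fst ε₁ ε₂ r p) (upElt_fst ε₁ ε₂ s p')]
    refine Finsupp.single_eq_zero.2 ?_
    ext1 i j
    fin_cases i <;> fin_cases j <;> simp [superComm, shift]
  · rw [hatBracketL_snd, cocycleL_apply, upElt_fst, upElt_fst, cocycle_eq,
      Finsupp.sum_single_index]
    · by_cases h : s = -r
      · subst h
        simp [strMul, orientedSum]
      · simp [Finsupp.single_eq_of_ne (Ne.symm h), strMul, orientedSum]
    · simp [strMul, orientedSum]

/-- The cocycle is the single term F(-1) G(0), evaluated at the fixed points of the two reflections.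
There σ forces F(-1) = s F(-1) and G(0) = -s G(0) with the same sign s, so one factor vanishes. This
is why c does not enter the condition for α. -/
theorem hatBracketL_up_low_snd (p p' : ℂ[X]) :
    (hatBracketL ε₁ ε₂ (upElt ε₁ ε₂ 1 p) (lowElt ε₁ ε₂ (-1) p')).1.2 = 0 := by
  rw [hatBracketL_snd, upElt_fst, lowElt_fst, cocycleL_single]
  have h1 := congr_arg (eval (-1)) (signTwist_mul_upPoly_comp ε₁ ε₂ 1 p)
  have h2 := congr_arg (eval 0) (signTwist_mul_lowPoly_comp ε₁ ε₂ (-1) p')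
  have e1 : eval (-1) (reflect 1) = (-1 : ℂ) := by simp [reflect]
  have e2 : eval 0 (reflect (-1)) = (0 : ℂ) := by simp [reflect]
  rw [eval_mul, eval_comp, e1] at h1
  rw [eval_mul, eval_comp, e2, eval_neg] at h2
  have e3 : ∀ x y : ℂ, eval x (signTwist ε₁ ε₂ 1) = eval y (signTwist ε₁ ε₂ (-1)) := by
    intro x y
    rcases Int.units_eq_one_or ε₁ with h | h <;> simp [signTwist, signPow, h]
  have key : (upPoly ε₁ ε₂ 1 p).eval (-1) * (lowPoly ε₁ ε₂ (-1) p').eval 0 = 0 := by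
    rw [e3 (-1) 0] at h1
    linear_combination (1 / 2 : ℂ) * (-(lowPoly ε₁ ε₂ (-1) p').eval 0 * h1 + (upPoly ε₁ ε₂ 1 p).eval (-1) * h2)
  have : Finset.Ico (-1 : ℤ) 0 = {-1} := by decide
  simp [orientedSum, this, str, evalMat, Matrix.mul_apply, key]

/-- For r = 0 the sum defining the cocycle is empty. -/
theorem hatBracketL_low_up_snd (p p' : ℂ[X]) :
    (hatBracketL ε₁ ε₂ (lowElt ε₁ ε₂ 0 p) (upElt ε₁ ε₂ 0 p')).1.2 = 0 := by
  rw [hatBracketL_snd, lowElt_fst, cocycleL_single_zero]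

theorem extendWeight_eq (ξ : Module.Dual ℂ (gr ε₁ ε₂ 0)) {x : hatSD ε₁ ε₂} (hx : x ∈ gr ε₁ ε₂ 0)
    (h2 : x.1.2 = 0) : extendWeight ξ x = weightFun ξ (x.1.1 0 0 0) := by
  obtain ⟨p, c, rfl⟩ := exists_cartan hx
  have hc : c = 0 := by simpa [cartan, central] using h2
  subst hc
  rw [zero_smul, add_zero, extendWeight_coe, weight_cartan]
  simp [cartan, diagOp]

theorem lowPoly_of_parity {α : ℂ[X]} (h : HasParity (-(ε₁ * ε₂)) α) :
    signTwist ε₁ ε₂ (-1) * α.comp (reflect (-1)) = -α := by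
  have e : reflect (-1) = -X := by simp [reflect]
  rw [e, h]
  rcases Int.units_eq_one_or ε₁ with h | h <;> rcases Int.units_eq_one_or ε₂ with h' | h' <;>
    simp [signTwist, signPow, h, h']

theorem dHalf_comp_reflect : dHalf.comp (reflect 0) = -dHalf := by
  rw [← dHalf_comp]
  simp [reflect]

/-- The reflection w ↦ -w - 1 becomes negation in the variable w + 1/2. -/
theorem upPoly_of_parity {β : ℂ[X]} (h : HasParity ε₂ β) :
    signTwist ε₁ ε₂ 0 * (β.comp dHalf).comp (reflect 0) = β.comp dHalf := by
  have : (β.comp (-X)).comp dHalf = β.comp (-dHalf) := by rw [comp_assoc]; simp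
  rw [comp_assoc, dHalf_comp_reflect, ← this, h]
  rcases Int.units_eq_one_or ε₂ with h' | h' <;> simp [signTwist, signPow, h']

section Module

variable {ξ : Module.Dual ℂ (gr ε₁ ε₂ 0)}
  {L : Type} [AddCommGroup L] [Module ℂ L] [Module (Env ε₁ ε₂) L]
  [IsScalarTower ℂ (Env ε₁ ε₂) L] {v : L}

variable (ε₁ ε₂) in
/-- The elements that annihilate `v`. -/
def annih (v : L) : Submodule ℂ (hatSD ε₁ ε₂) := LinearMap.ker ((envAct ε₁ ε₂ L).flip v)

theorem mem_annih {x : hatSD ε₁ ε₂} : x ∈ annih ε₁ ε₂ v ↔ envAct ε₁ ε₂ L x v = 0 := Iff.rfl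

theorem bracket_mem_annih {m n : ℤ} {x y : hatSD ε₁ ε₂} (hx : x ∈ gr ε₁ ε₂ m)
    (hy : y ∈ gr ε₁ ε₂ n) (hxv : x ∈ annih ε₁ ε₂ v) (hyv : y ∈ annih ε₁ ε₂ v) :
    hatBracketL ε₁ ε₂ x y ∈ annih ε₁ ε₂ v := by
  rw [mem_annih] at *
  have := envAct_isRep L hx hy v
  rw [hxv, hyv, map_zero, map_zero, smul_zero, zero_add] at this
  exact this.symm

theorem IsHighestWeight.cartan_bracket_mem (hv : IsHighestWeight ξ v) {n : ℤ} (h : gr ε₁ ε₂ 0)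
    {y : hatSD ε₁ ε₂} (hy : y ∈ gr ε₁ ε₂ n) (hyv : y ∈ annih ε₁ ε₂ v) :
    hatBracketL ε₁ ε₂ h y ∈ annih ε₁ ε₂ v := by
  rw [mem_annih] at *
  have := envAct_isRep L h.2 hy v
  rw [hyv, hv.zero, map_zero, map_smul, hyv, smul_zero, smul_zero, zero_add] at this
  exact this.symm

/-- The polynomials p for which t^r p kills v form an ideal: the bracket with the Cartan element of
w² gives closure under multiplication by w. -/
theorem IsHighestWeight.diagElt_mul_mem (hv : IsHighestWeight ξ v) {r : ℤ} (hr : r ≠ 0) {p : ℂ[X]}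
    (hp : diagElt ε₁ ε₂ r p ∈ annih ε₁ ε₂ v) (h : ℂ[X]) :
    diagElt ε₁ ε₂ r (h * p) ∈ annih ε₁ ε₂ v := by
  have hX : ∀ q, diagElt ε₁ ε₂ r q ∈ annih ε₁ ε₂ v → diagElt ε₁ ε₂ r (X * q) ∈ annih ε₁ ε₂ v := by
    intro q hq
    have h1 := hv.cartan_bracket_mem (cartan ε₁ ε₂ (X ^ 2) _ rfl) (diagElt_mem ε₁ ε₂ r q) hq
    rw [hatBracketL_cartan_diagElt _ _ _ hr] at h1
    have hr' : (r : ℂ) ≠ 0 := by exact_mod_cast hr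
    -- Solve (w + r)² - w² = 2rw + r² for w, using r ≠ 0.
    have e : X * q = (1 / (2 * (r : ℂ))) • (((X ^ 2 : ℂ[X]).comp (X + C (r : ℂ)) - X ^ 2) * q +
        (-(r : ℂ) ^ 2) • q) := by
      have h2 : C (1 / (2 * (r : ℂ))) * (2 * C (r : ℂ)) = 1 := by
        rw [← C_ofNat, ← C_mul, ← C_mul]
        field_simp
        simp
      rw [smul_eq_C_mul, smul_eq_C_mul, pow_comp, X_comp, C_neg, C_pow]
      linear_combination -X * q * h2
    rw [e, map_smul, map_add, map_smul]
    exact Submodule.smul_mem _ _ (add_mem h1 (Submodule.smul_mem _ _ hq))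
  induction h using Polynomial.induction_on' with
  | add a b ha hb =>
    rw [add_mul, map_add]
    exact add_mem ha hb
  | monomial n a =>
    rw [← C_mul_X_pow_eq_monomial, mul_assoc, ← smul_eq_C_mul, map_smul]
    refine Submodule.smul_mem _ _ ?_
    induction n with
    | zero => simpa using hp
    | succ n ih =>
      rw [pow_succ', mul_assoc]
      exact hX _ ih

theorem IsHighestWeight.lowElt_mul_mem (hv : IsHighestWeight ξ v) {r : ℤ} {p : ℂ[X]}
    (hp : lowElt ε₁ ε₂ r p ∈ annih ε₁ ε₂ v) (h : ℂ[X]) :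
    lowElt ε₁ ε₂ r (h * lowPoly ε₁ ε₂ r p) ∈ annih ε₁ ε₂ v := by
  rw [← hatBracketL_cartan_lowElt]
  exact hv.cartan_bracket_mem _ (lowElt_mem ε₁ ε₂ r p) hp

theorem IsHighestWeight.upElt_mul_mem (hv : IsHighestWeight ξ v) {r : ℤ} {p : ℂ[X]}
    (hp : upElt ε₁ ε₂ r p ∈ annih ε₁ ε₂ v) (h : ℂ[X]) :
    upElt ε₁ ε₂ r (h * upPoly ε₁ ε₂ r p) ∈ annih ε₁ ε₂ v := by
  rw [← hatBracketL_cartan_upElt]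
  exact hv.cartan_bracket_mem _ (upElt_mem ε₁ ε₂ r p) hp

theorem comp_X_add_C_ne_zero {p : ℂ[X]} (hp : p ≠ 0) (a : ℂ) : p.comp (X + C a) ≠ 0 := by
  intro h
  apply hp
  have : (p.comp (X + C a)).comp (X - C a) = p := by rw [comp_assoc]; simp
  rw [← this, h, zero_comp]

theorem X_linear_ne_zero (a : ℂ) : (2 * X + C a : ℂ[X]) ≠ 0 := by
  intro h
  have := congr_arg (fun p => coeff p 1) h
  simp at this

/-- If no nonzero annihilator existed at r + s, the brackets with h = 1 and h = w would both vanish;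
eliminating between them leaves s p(w + s) p'(w) = 0. -/
theorem IsHighestWeight.diag_step (hv : IsHighestWeight ξ v) {r s : ℤ} (hr : r < 0) (hs : s < 0)
    {p p' : ℂ[X]} (hp0 : p ≠ 0) (hp : diagElt ε₁ ε₂ r p ∈ annih ε₁ ε₂ v) (hp0' : p' ≠ 0)
    (hp' : diagElt ε₁ ε₂ s p' ∈ annih ε₁ ε₂ v) :
    ∃ q ≠ 0, diagElt ε₁ ε₂ (r + s) q ∈ annih ε₁ ε₂ v := by
  by_contra! H
  have key : ∀ h, (h * p).comp (X + C (s : ℂ)) * p' - p'.comp (X + C (r : ℂ)) * (h * p) = 0 := by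
    intro h
    by_contra h0
    refine H _ h0 ?_
    rw [← bracket_diag_diag (ε₁ := ε₁) (ε₂ := ε₂)]
    have h1 := hatBracketL_mem ε₁ ε₂ (diagElt_mem ε₁ ε₂ r (h * p)) (diagElt_mem ε₁ ε₂ s p')
    rw [← mul_add] at h1
    rw [← eq_diagElt (by omega) h1]
    exact bracket_mem_annih (diagElt_mem ε₁ ε₂ _ _) (diagElt_mem ε₁ ε₂ _ _)
      (hv.diagElt_mul_mem hr.ne hp h) hp'
  have h1 := key 1
  have h2 := key X
  rw [one_mul] at h1
  rw [mul_comp, X_comp] at h2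
  have h3 : C (s : ℂ) * (p.comp (X + C (s : ℂ)) * p') = 0 := by linear_combination h2 - X * h1
  have hs' : (s : ℂ) ≠ 0 := by exact_mod_cast hs.ne
  exact mul_ne_zero (C_ne_zero.2 hs') (mul_ne_zero (comp_X_add_C_ne_zero hp0 _) hp0') h3

/-- Comparing h = 1 and h = w as in the diagonal case leaves the nonzero factor 2w + r + s + 1 times
two nonzero polynomials. -/
theorem IsHighestWeight.low_step (hv : IsHighestWeight ξ v) {r s : ℤ} (hr : r < 0)
    {p p' : ℂ[X]} (hp0 : p ≠ 0) (hp : diagElt ε₁ ε₂ r p ∈ annih ε₁ ε₂ v)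
    (hp0' : lowPoly ε₁ ε₂ s p' ≠ 0) (hp' : lowElt ε₁ ε₂ s p' ∈ annih ε₁ ε₂ v) :
    ∃ q, lowPoly ε₁ ε₂ (r + s) q ≠ 0 ∧ lowElt ε₁ ε₂ (r + s) q ∈ annih ε₁ ε₂ v := by
  by_contra! H
  have key : ∀ h, -(signPow ε₁ r * (h * p).comp ((reflect r).comp (X + C (s : ℂ)))) *
      lowPoly ε₁ ε₂ s p' - (lowPoly ε₁ ε₂ s p').comp (X + C (r : ℂ)) * (h * p) = 0 := by
    intro h
    by_contra h0
    rw [← bracket_diag_low (ε₁ := ε₁) (ε₂ := ε₂)] at h0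
    have h1 := hatBracketL_mem ε₁ ε₂ (diagElt_mem ε₁ ε₂ r (h * p)) (lowElt_mem ε₁ ε₂ s p')
    rw [← add_assoc, ← mul_add] at h1
    have h2 := eq_lowElt_add_upElt h1
    have h3 : (hatBracketL ε₁ ε₂ (diagElt ε₁ ε₂ r (h * p)) (lowElt ε₁ ε₂ s p')).1.1 (r + s + 1) 0 1
        = 0 := by
      rw [hatBracketL_fst_single (diagElt_fst ε₁ ε₂ r _) (lowElt_fst ε₁ ε₂ s p'),
        Finsupp.single_eq_of_ne (by omega)]
      rfl
    rw [h3, smul_zero, map_zero, add_zero] at h2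
    refine H _ ?_ (h2 ▸ bracket_mem_annih (diagElt_mem ε₁ ε₂ _ _) (lowElt_mem ε₁ ε₂ _ _)
      (hv.diagElt_mul_mem hr.ne hp h) hp')
    rwa [lowPoly_half (entry_low _ _)]
  have h1 := key 1
  have h2 := key X
  rw [one_mul] at h1
  rw [mul_comp, X_comp] at h2
  have e : (reflect r).comp (X + C (s : ℂ)) = -X - C (s + r + 1 : ℂ) := by
    simp [reflect]
    ring
  rw [e] at h1 h2
  have h3 : (2 * X + C (s + r + 1 : ℂ)) * ((lowPoly ε₁ ε₂ s p').comp (X + C (r : ℂ)) * p) = 0 := by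
    linear_combination -h2 + (-X - C (s + r + 1 : ℂ)) * h1
  exact mul_ne_zero (X_linear_ne_zero _) (mul_ne_zero (comp_X_add_C_ne_zero hp0' _) hp0) h3

theorem IsHighestWeight.up_step (hv : IsHighestWeight ξ v) {r s : ℤ} (hr : r < 0)
    {p p' : ℂ[X]} (hp0 : p ≠ 0) (hp : diagElt ε₁ ε₂ r p ∈ annih ε₁ ε₂ v)
    (hp0' : upPoly ε₁ ε₂ s p' ≠ 0) (hp' : upElt ε₁ ε₂ s p' ∈ annih ε₁ ε₂ v) :
    ∃ q, upPoly ε₁ ε₂ (r + s) q ≠ 0 ∧ upElt ε₁ ε₂ (r + s) q ∈ annih ε₁ ε₂ v := by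
  by_contra! H
  have key : ∀ h, (h * p).comp (X + C (s : ℂ)) * upPoly ε₁ ε₂ s p' +
      (upPoly ε₁ ε₂ s p').comp (X + C (r : ℂ)) * (signPow ε₁ r * (h * p).comp (reflect r)) = 0 := by
    intro h
    by_contra h0
    rw [← bracket_diag_up (ε₁ := ε₁) (ε₂ := ε₂)] at h0
    have h1 := hatBracketL_mem ε₁ ε₂ (diagElt_mem ε₁ ε₂ r (h * p)) (upElt_mem ε₁ ε₂ s p')
    rw [show 2 * r + (2 * s - 1) = 2 * (r + s - 1) + 1 by ring] at h1
    have h2 := eq_lowElt_add_upElt h1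
    have h3 : (hatBracketL ε₁ ε₂ (diagElt ε₁ ε₂ r (h * p)) (upElt ε₁ ε₂ s p')).1.1 (r + s - 1) 1 0
        = 0 := by
      rw [hatBracketL_fst_single (diagElt_fst ε₁ ε₂ r _) (upElt_fst ε₁ ε₂ s p'),
        Finsupp.single_eq_of_ne (by omega)]
      rfl
    rw [h3, smul_zero, map_zero, zero_add, sub_add_cancel] at h2
    refine H _ ?_ (h2 ▸ bracket_mem_annih (diagElt_mem ε₁ ε₂ _ _) (upElt_mem ε₁ ε₂ _ _)
      (hv.diagElt_mul_mem hr.ne hp h) hp')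
    rwa [upPoly_half (entry_up _ _)]
  have h1 := key 1
  have h2 := key X
  rw [one_mul] at h1
  rw [mul_comp, X_comp, mul_comp, X_comp] at h2
  have h3 : (2 * X + C (s + r + 1 : ℂ)) * (p.comp (X + C (s : ℂ)) * upPoly ε₁ ε₂ s p') = 0 := by
    have e : (X : ℂ[X]) + C (s : ℂ) - reflect r = 2 * X + C (s + r + 1 : ℂ) := by
      simp [reflect]
      ring
    rw [← e]
    linear_combination h2 - reflect r * h1
  exact mul_ne_zero (X_linear_ne_zero _) (mul_ne_zero (comp_X_add_C_ne_zero hp0 _) hp0') h3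

end Module

end SuperCircle

/-! ### Finite orbits, and annihilators in degree -1/2 -/

namespace SuperCircle

theorem finiteDimensional_range_of_ideal {L : Type} [AddCommGroup L] [Module ℂ L]
    (T : ℂ[X] →ₗ[ℂ] L) {p : ℂ[X]} (hp : p ≠ 0) (h : ∀ q, T (q * p) = 0) :
    FiniteDimensional ℂ (LinearMap.range T) := by
  have : FiniteDimensional ℂ (degreeLT ℂ p.natDegree) :=
    Module.Finite.equiv (degreeLTEquiv ℂ p.natDegree).symm
  refine Submodule.finiteDimensional_of_le (S₂ := (degreeLT ℂ p.natDegree).map T) ?_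
  rintro _ ⟨q, rfl⟩
  refine ⟨q % p, ?_, ?_⟩
  · refine mem_degreeLT.2 ?_
    rw [← degree_eq_natDegree hp]
    exact EuclideanDomain.mod_lt q hp
  · conv_rhs => rw [← EuclideanDomain.div_add_mod q p]
    rw [map_add, mul_comm, h, zero_add]

theorem not_injective_of_finiteDimensional {L : Type} [AddCommGroup L] [Module ℂ L]
    (T : ℂ[X] →ₗ[ℂ] L) {P : Submodule ℂ L} [FiniteDimensional ℂ P] (h : ∀ q, T q ∈ P) :
    ∃ q ≠ 0, T q = 0 := by
  by_contra! H
  have hinj : Function.Injective (T.codRestrict P h) := by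
    rw [injective_iff_map_eq_zero]
    intro q hq
    by_contra h0
    exact H q h0 (congr_arg Subtype.val hq)
  have := Module.Finite.of_injective _ hinj
  exact Polynomial.not_finite this

variable {ε₁ ε₂ : ℤˣ} {ξ : Module.Dual ℂ (gr ε₁ ε₂ 0)}

section Module

variable {L : Type} [AddCommGroup L] [Module ℂ L] [Module (Env ε₁ ε₂) L]
  [IsScalarTower ℂ (Env ε₁ ε₂) L] {v : L}

/-- Bracketing the two given elements yields a diagonal annihilator at t^{-1}. Repeated brackets
with it lower the power of t by one in each of the three types. -/
theorem IsHighestWeight.exists_annih (hv : IsHighestWeight ξ v) {a b : ℂ[X]}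
    (ha0 : lowPoly ε₁ ε₂ (-1) a ≠ 0) (ha : lowElt ε₁ ε₂ (-1) a ∈ annih ε₁ ε₂ v)
    (hb0 : upPoly ε₁ ε₂ 0 b ≠ 0) (hb : upElt ε₁ ε₂ 0 b ∈ annih ε₁ ε₂ v) (k : ℕ) :
    (∃ p ≠ 0, diagElt ε₁ ε₂ (-(k + 1 : ℤ)) p ∈ annih ε₁ ε₂ v) ∧
    (∃ p, lowPoly ε₁ ε₂ (-(k + 1 : ℤ)) p ≠ 0 ∧ lowElt ε₁ ε₂ (-(k + 1 : ℤ)) p ∈ annih ε₁ ε₂ v) ∧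
    ∃ p, upPoly ε₁ ε₂ (-(k : ℤ)) p ≠ 0 ∧ upElt ε₁ ε₂ (-(k : ℤ)) p ∈ annih ε₁ ε₂ v := by
  have h1 : ∃ p ≠ 0, diagElt ε₁ ε₂ (-1) p ∈ annih ε₁ ε₂ v := by
    refine ⟨_, mul_ne_zero (comp_X_add_C_ne_zero hb0 ((-1 : ℤ) : ℂ)) ha0, ?_⟩
    have h2 := hatBracketL_mem ε₁ ε₂ (lowElt_mem ε₁ ε₂ (-1) a) (upElt_mem ε₁ ε₂ 0 b)
    have h3 := eq_diagElt (r := -1) (by omega) h2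
    have h4 := bracket_low_up (ε₁ := ε₁) (ε₂ := ε₂) (-1) 0 a b
    rw [add_zero] at h4
    rw [← h4, ← h3]
    exact bracket_mem_annih (lowElt_mem ε₁ ε₂ _ _) (upElt_mem ε₁ ε₂ _ _) ha hb
  obtain ⟨p, hp0, hp⟩ := h1
  induction k with
  | zero => exact ⟨⟨p, hp0, hp⟩, ⟨a, ha0, ha⟩, b, hb0, hb⟩
  | succ k ih =>
    obtain ⟨⟨q, hq0, hq⟩, ⟨c, hc0, hc⟩, d, hd0, hd⟩ := ih
    have e : -(((k + 1 : ℕ) : ℤ) + 1) = -1 + -(k + 1 : ℤ) := by push_cast; ring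
    have e' : -((k + 1 : ℕ) : ℤ) = -1 + -(k : ℤ) := by push_cast; ring
    rw [e, e']
    exact ⟨hv.diag_step (by omega) (by omega) hp0 hp hq0 hq, hv.low_step (by omega) hp0 hp hc0 hc,
      hv.up_step (by omega) hp0 hp hd0 hd⟩

/-- In negative degree 2r the component is one diagonal family, in degree 2r + 1 a θ-family at t^r
plus a ∂_θ-family at t^{r+1}. Each factors through ℂ[w]/(p) for a nonzero p. -/
theorem IsHighestWeight.finOrbit (hv : IsHighestWeight ξ v) {a b : ℂ[X]}
    (ha0 : lowPoly ε₁ ε₂ (-1) a ≠ 0) (ha : lowElt ε₁ ε₂ (-1) a ∈ annih ε₁ ε₂ v)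
    (hb0 : upPoly ε₁ ε₂ 0 b ≠ 0) (hb : upElt ε₁ ε₂ 0 b ∈ annih ε₁ ε₂ v) :
    (hatLie ε₁ ε₂).FinOrbit (envAct ε₁ ε₂ L) v := by
  have H := hv.exists_annih ha0 ha hb0 hb
  intro n
  change FiniteDimensional ℂ ((gr ε₁ ε₂ n).map ((envAct ε₁ ε₂ L).flip v))
  rcases lt_or_ge n 0 with hn | hn
  · rcases Int.even_or_odd' n with ⟨r, rfl | rfl⟩
    · obtain ⟨⟨p, hp0, hp⟩, -⟩ := H (-r - 1).toNat
      rw [show -(((-r - 1).toNat : ℤ) + 1) = r by omega] at hp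
      have := finiteDimensional_range_of_ideal ((envAct ε₁ ε₂ L).flip v ∘ₗ diagElt ε₁ ε₂ r) hp0
        (fun q => hv.diagElt_mul_mem (by omega) hp q)
      refine Submodule.finiteDimensional_of_le
        (S₂ := LinearMap.range ((envAct ε₁ ε₂ L).flip v ∘ₗ diagElt ε₁ ε₂ r)) ?_
      rintro _ ⟨x, hx, rfl⟩
      rw [eq_diagElt (by omega) hx]
      exact ⟨_, rfl⟩
    · obtain ⟨-, ⟨p, hp0, hp⟩, -⟩ := H (-r - 1).toNat
      obtain ⟨-, -, q, hq0, hq⟩ := H (-r - 1).toNat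
      rw [show -(((-r - 1).toNat : ℤ) + 1) = r by omega] at hp0 hp
      rw [show -((-r - 1).toNat : ℤ) = r + 1 by omega] at hq0 hq
      have := finiteDimensional_range_of_ideal ((envAct ε₁ ε₂ L).flip v ∘ₗ lowElt ε₁ ε₂ r) hp0
        (fun q => hv.lowElt_mul_mem hp q)
      have := finiteDimensional_range_of_ideal ((envAct ε₁ ε₂ L).flip v ∘ₗ upElt ε₁ ε₂ (r + 1)) hq0
        (fun p => hv.upElt_mul_mem hq p)
      refine Submodule.finiteDimensional_of_le
        (S₂ := LinearMap.range ((envAct ε₁ ε₂ L).flip v ∘ₗ lowElt ε₁ ε₂ r) ⊔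
          LinearMap.range ((envAct ε₁ ε₂ L).flip v ∘ₗ upElt ε₁ ε₂ (r + 1))) ?_
      rintro _ ⟨x, hx, rfl⟩
      rw [eq_lowElt_add_upElt hx, map_add]
      exact Submodule.add_mem_sup ⟨_, rfl⟩ ⟨_, rfl⟩
  · refine Submodule.finiteDimensional_of_le (S₂ := Submodule.span ℂ {v}) ?_
    rintro _ ⟨x, hx, rfl⟩
    rw [LinearMap.flip_apply]
    rcases hn.eq_or_lt with rfl | hn
    · rw [hv.zero ⟨x, hx⟩]
      exact Submodule.smul_mem _ _ (Submodule.mem_span_singleton_self _)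
    · rw [hv.pos n hn x hx]
      exact zero_mem _

theorem finOrbit_smul {w : L} (h : (hatLie ε₁ ε₂).FinOrbit (envAct ε₁ ε₂ L) w) (c : ℂ) :
    (hatLie ε₁ ε₂).FinOrbit (envAct ε₁ ε₂ L) (c • w) := by
  intro n
  have := h n
  refine Submodule.finiteDimensional_of_le
    (S₂ := ((hatLie ε₁ ε₂).deg n).map ((envAct ε₁ ε₂ L).flip w)) ?_
  rintro _ ⟨x, hx, rfl⟩
  rw [LinearMap.flip_apply, map_smul]
  exact Submodule.smul_mem _ _ ⟨x, hx, rfl⟩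

theorem IsHighestWeight.finiteDimensional (hv : IsHighestWeight ξ v)
    (h : (hatLie ε₁ ε₂).FinOrbit (envAct ε₁ ε₂ L) v) (n : ℤ) :
    FiniteDimensional ℂ (Submodule.span ℂ {w | ∃ u, IsMonomial ε₁ ε₂ n u ∧ w = u • v}) := by
  have := GradedLieSuper.finiteDimensional_negSpan (W := Submodule.span ℂ {v}) (envAct_isRep L)
    (fun w hw => by
      obtain ⟨a, rfl⟩ := Submodule.mem_span_singleton.1 hw
      exact finOrbit_smul h a) n
  refine Submodule.finiteDimensional_of_le
    (S₂ := (hatLie ε₁ ε₂).negSpan (envAct ε₁ ε₂ L) (Submodule.span ℂ {v}) n)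
    (Submodule.span_le.2 ?_)
  rintro _ ⟨u, hu, rfl⟩
  induction hu with
  | one =>
    rw [one_smul]
    exact Submodule.subset_span (.base (Submodule.mem_span_singleton_self _))
  | @mul m n x u hx hu ih =>
    have h1 := GradedLieSuper.act_mem_negSpan (envAct_isRep L) hv.span_zero hv.span_pos hx
      (ih (GradedLieSuper.finiteDimensional_negSpan (envAct_isRep L) (fun w hw => by
        obtain ⟨a, rfl⟩ := Submodule.mem_span_singleton.1 hw
        exact finOrbit_smul h a) n))
    rwa [envAct_apply, ← mul_smul, add_comm] at h1

/-- The bracket has degree n - 1, so only n = 1 can contribute, through its weight. -/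
theorem IsHighestWeight.act_act (hv : IsHighestWeight ξ v) {n : ℤ} (hn : 0 < n) {x y : hatSD ε₁ ε₂}
    (hx : x ∈ gr ε₁ ε₂ n) (hy : y ∈ gr ε₁ ε₂ (-1)) :
    envAct ε₁ ε₂ L x (envAct ε₁ ε₂ L y v) = extendWeight ξ (hatBracketL ε₁ ε₂ x y) • v := by
  have h1 := hatBracketL_mem ε₁ ε₂ hx hy
  rw [envAct_isRep L hx hy, hv.pos n hn x hx, map_zero, smul_zero, zero_add]
  by_cases h : n = 1
  · subst h
    have := hv.zero ⟨_, h1⟩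
    rw [← extendWeight_coe] at this
    exact this
  · rw [extendWeight_of_ne ξ (n := n + -1) (by omega) h1, zero_smul]
    exact hv.pos _ (by omega) _ h1

/-- A vector of degree `-1/2` is annihilated by the positive part only if it vanishes. -/
theorem IsHighestWeight.mem_annih_iff (hv : IsHighestWeight ξ v) (hv0 : v ≠ 0)
    (hs : ∀ W : Submodule ℂ L, (∀ h ∈ gr ε₁ ε₂ 0, ∀ w ∈ W, envAct ε₁ ε₂ L h w ∈ W) →
      (∀ n > 0, ∀ x ∈ gr ε₁ ε₂ n, ∀ w ∈ W, envAct ε₁ ε₂ L x w = 0) →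
      (∀ w ∈ W, envAct ε₁ ε₂ L (gradingElement ε₁ ε₂) w =
        (topWeight ξ + ((-1 : ℤ) : ℂ) / 2) • w) → ∀ w ∈ W, w = 0)
    {y : hatSD ε₁ ε₂} (hy : y ∈ gr ε₁ ε₂ (-1)) : y ∈ annih ε₁ ε₂ v ↔
      ∀ x ∈ gr ε₁ ε₂ 1, extendWeight ξ (hatBracketL ε₁ ε₂ x y) = 0 := by
  constructor
  · intro h x hx
    have h1 := hv.act_act one_pos hx hy
    rw [mem_annih] at h
    rw [h, map_zero] at h1
    exact (smul_eq_zero.1 h1.symm).resolve_right hv0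
  · intro h
    -- All singular vectors among the y v are taken at once: y v need not be a Cartan eigenvector,
    -- whereas this space is stable under the Cartan subalgebra.
    let W : Submodule ℂ L := ((gr ε₁ ε₂ (-1)).map ((envAct ε₁ ε₂ L).flip v)) ⊓
        ⨅ (n : Set.Ioi (0 : ℤ)), ⨅ (x : gr ε₁ ε₂ n), LinearMap.ker (envAct ε₁ ε₂ L x)
    have hmem : ∀ w, w ∈ W ↔ (∃ z ∈ gr ε₁ ε₂ (-1), envAct ε₁ ε₂ L z v = w) ∧
        ∀ n > 0, ∀ x ∈ gr ε₁ ε₂ n, envAct ε₁ ε₂ L x w = 0 := by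
      intro w
      simp only [W, Submodule.mem_inf, Submodule.mem_map, Submodule.mem_iInf, LinearMap.mem_ker,
        Subtype.forall, Set.mem_Ioi, LinearMap.flip_apply]
    have hmap : ∀ g ∈ gr ε₁ ε₂ 0, ∀ z ∈ gr ε₁ ε₂ (-1), ∃ z' ∈ gr ε₁ ε₂ (-1),
        envAct ε₁ ε₂ L g (envAct ε₁ ε₂ L z v) = envAct ε₁ ε₂ L z' v := by
      intro g hg z hz
      have h1 := hatBracketL_mem ε₁ ε₂ hg hz
      rw [zero_add] at h1
      refine ⟨ξ ⟨g, hg⟩ • z + hatBracketL ε₁ ε₂ g z,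
        (gr ε₁ ε₂ (-1)).add_mem ((gr ε₁ ε₂ (-1)).smul_mem _ hz) h1, ?_⟩
      rw [envAct_isRep L hg hz, hv.zero ⟨g, hg⟩, eps_even_left _ (by simp), one_smul, map_smul,
        map_add, map_smul]
      rfl
    refine hs W ?_ ?_ ?_ _ ((hmem _).2 ⟨⟨y, hy, rfl⟩, ?_⟩)
    · intro g hg w hw
      obtain ⟨⟨z, hz, rfl⟩, hw2⟩ := (hmem w).1 hw
      obtain ⟨z', hz', e⟩ := hmap g hg z hz
      refine (hmem _).2 ⟨⟨z', hz', e.symm⟩, fun n hn x hx => ?_⟩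
      have h1 := hatBracketL_mem ε₁ ε₂ hx hg
      rw [add_zero] at h1
      rw [envAct_isRep L hx hg, hw2 n hn x hx, map_zero, smul_zero, zero_add]
      exact hw2 n hn _ h1
    · intro n hn x hx w hw
      exact ((hmem w).1 hw).2 n hn x hx
    · intro w hw
      obtain ⟨⟨z, hz, rfl⟩, -⟩ := (hmem w).1 hw
      rw [envAct_isRep L (gradingElement ε₁ ε₂).2 hz, hv.zero, eps_even_left _ (by simp), one_smul,
        map_smul]
      have : (hatLie ε₁ ε₂).br (gradingElement ε₁ ε₂) z = (((-1 : ℤ) : ℂ) / 2) • z :=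
        hatBracketL_gradingElement _ _ hz
      rw [this, map_smul, LinearMap.smul_apply, ← add_smul]
    · intro n hn x hx
      change envAct ε₁ ε₂ L x (envAct ε₁ ε₂ L y v) = 0
      rw [hv.act_act hn hx hy]
      by_cases h1 : n = 1
      · subst h1
        rw [h x hx, zero_smul]
      · rw [extendWeight_of_ne ξ (n := n + -1) (by omega) (hatBracketL_mem ε₁ ε₂ hx hy), zero_smul]

end Module

theorem mem_annih_hwVector_iff {y : hatSD ε₁ ε₂} (hy : y ∈ gr ε₁ ε₂ (-1)) :
    y ∈ annih ε₁ ε₂ (hwVector ε₁ ε₂ ξ) ↔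
      ∀ x ∈ gr ε₁ ε₂ 1, extendWeight ξ (hatBracketL ε₁ ε₂ x y) = 0 :=
  (hwVector_isHighestWeight ξ).mem_annih_iff (hwVector_ne_zero ξ)
    (fun _ h0 hpos heig _ hw => eq_zero_of_singular ξ h0 hpos (by norm_num) heig hw) hy

/-- In degree 1/2 only t ∂_θ b(D) pairs nontrivially with t^{-1} θ α(D). The upper left entry of the
bracket is b(w - 1) α(w), symmetrized in b; with p(w) = b(w - 1) the parity of α turns this into αp
minus its reflection. -/
theorem lowElt_mem_annih_iff {α : ℂ[X]} (hα : HasParity (-(ε₁ * ε₂)) α) :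
    lowElt ε₁ ε₂ (-1) ((1 / 2 : ℂ) • α) ∈ annih ε₁ ε₂ (hwVector ε₁ ε₂ ξ) ↔
      ∀ p, weightFun ξ (α * p - (α * p).comp (-X)) = 0 := by
  have hα' := lowPoly_half (lowPoly_of_parity hα)
  have key : ∀ b, extendWeight ξ (hatBracketL ε₁ ε₂ (upElt ε₁ ε₂ 1 b)
      (lowElt ε₁ ε₂ (-1) ((1 / 2 : ℂ) • α))) =
        weightFun ξ (α * b.comp (X - 1) - (α * b.comp (X - 1)).comp (-X)) := by
    intro b
    rw [extendWeight_eq ξ (hatBracketL_mem ε₁ ε₂ (upElt_mem ε₁ ε₂ 1 b) (lowElt_mem ε₁ ε₂ (-1) _))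
      (hatBracketL_up_low_snd _ _)]
    have h1 := bracket_up_low (ε₁ := ε₁) (ε₂ := ε₂) 1 (-1) b ((1 / 2 : ℂ) • α)
    rw [show (1 : ℤ) + -1 = 0 by norm_num] at h1
    rw [h1, hα', upPoly_apply]
    congr 1
    have e1 : (X : ℂ[X]) + C ((-1 : ℤ) : ℂ) = X - 1 := by simp [sub_eq_add_neg]
    have e2 : (reflect 1).comp (X - 1) = -X - 1 := by
      simp [reflect]
      ring
    have e3 : (X - 1 : ℂ[X]).comp (-X) = -X - 1 := by simp
    have hs : signTwist ε₁ ε₂ 1 = C (((ε₁ * ε₂ : ℤˣ) : ℤ) : ℂ) := by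
      simp [signTwist, signPow]
    have hp : α.comp (-X) = C (((-(ε₁ * ε₂) : ℤˣ) : ℤ) : ℂ) * α := hα
    rw [e1, add_comp, mul_comp, signTwist_comp, comp_assoc, e2, mul_comp, comp_assoc, e3, hp, hs]
    simp only [Units.val_neg, Int.cast_neg, C_neg]
    ring
  rw [mem_annih_hwVector_iff (lowElt_mem ε₁ ε₂ (-1) _)]
  constructor
  · intro h p
    have := h _ (upElt_mem ε₁ ε₂ 1 (p.comp (X + 1)))
    rw [key] at this
    simpa [comp_assoc] using this
  · intro h x hx
    rw [eq_lowElt_add_upElt (r := 0) hx, map_add, LinearMap.add_apply, hatBracketL_low_low, zero_add,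
      zero_add, key, h]

/-- Here only θ F(D) pairs nontrivially with ∂_θ β(D + 1/2), and all polynomials are written in the
variable w + 1/2. -/
theorem upElt_mem_annih_iff {β : ℂ[X]} (hβ : HasParity ε₂ β) :
    upElt ε₁ ε₂ 0 ((1 / 2 : ℂ) • β.comp dHalf) ∈ annih ε₁ ε₂ (hwVector ε₁ ε₂ ξ) ↔
      ∀ p, weightFun ξ ((β * p).comp dHalf - (β * p).comp (-dHalf)) = 0 := by
  have hβ' := upPoly_half (upPoly_of_parity (ε₁ := ε₁) hβ)
  have hd : dHalf.comp (X - C (1 / 2)) = X := by simp [dHalf]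
  have key : ∀ p, extendWeight ξ (hatBracketL ε₁ ε₂ (lowElt ε₁ ε₂ 0 (p.comp dHalf))
      (upElt ε₁ ε₂ 0 ((1 / 2 : ℂ) • β.comp dHalf))) =
        weightFun ξ ((β * p).comp dHalf - (β * p).comp (-dHalf)) := by
    intro p
    rw [extendWeight_eq ξ (hatBracketL_mem ε₁ ε₂ (lowElt_mem ε₁ ε₂ 0 _) (upElt_mem ε₁ ε₂ 0 _))
      (hatBracketL_low_up_snd _ _)]
    have h1 := bracket_low_up (ε₁ := ε₁) (ε₂ := ε₂) 0 0 (p.comp dHalf)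
      ((1 / 2 : ℂ) • β.comp dHalf)
    rw [add_zero] at h1
    rw [h1, hβ', lowPoly_apply, comp_assoc p, dHalf_comp_reflect]
    congr 1
    have e0 : (X : ℂ[X]) + C ((0 : ℤ) : ℂ) = X := by simp
    have hs : signTwist ε₁ ε₂ 0 = C ((ε₂ : ℤ) : ℂ) := by simp [signTwist, signPow]
    have hp : β.comp (-dHalf) = C ((ε₂ : ℤ) : ℂ) * β.comp dHalf := by
      have : (β.comp (-X)).comp dHalf = β.comp (-dHalf) := by rw [comp_assoc]; simp
      rw [← this, show β.comp (-X) = C ((ε₂ : ℤ) : ℂ) * β from hβ, mul_comp, C_comp]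
    rw [e0, comp_X, mul_comp, mul_comp, hp, hs]
    ring
  rw [mem_annih_hwVector_iff (upElt_mem ε₁ ε₂ 0 _)]
  constructor
  · intro h p
    rw [← key]
    exact h _ (lowElt_mem ε₁ ε₂ 0 (p.comp dHalf))
  · intro h x hx
    rw [eq_lowElt_add_upElt (r := 0) hx, map_add, LinearMap.add_apply, hatBracketL_up_up, add_zero]
    have := key (((1 / 2 : ℂ) • x.1.1 0 1 0).comp (X - C (1 / 2)))
    have e : (X - C (1 / 2) : ℂ[X]).comp dHalf = X := by simp [dHalf]
    rw [comp_assoc, e, comp_X, h] at this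
    exact this

/-- The exponent, `0` or `1`, of the given parity. -/
def parityExp (ε : ℤˣ) : ℕ := if ε = 1 then 0 else 1

theorem hasParity_mul_sq (ε : ℤˣ) (p : ℂ[X]) : HasParity ε (X ^ parityExp ε * p.comp (X ^ 2)) := by
  have h : (p.comp (X ^ 2)).comp (-X) = p.comp (X ^ 2) := by rw [comp_assoc]; simp
  rcases Int.units_eq_one_or ε with rfl | rfl
  · simp [HasParity, parityExp, h]
  · have : (-1 : ℤˣ) ≠ 1 := by decide
    simp [HasParity, parityExp, h, this]

theorem mul_sq_ne_zero (ε : ℤˣ) {p : ℂ[X]} (hp : p ≠ 0) : X ^ parityExp ε * p.comp (X ^ 2) ≠ 0 := by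
  refine mul_ne_zero (pow_ne_zero _ X_ne_zero) fun h => ?_
  rw [← expand_eq_comp_X_pow] at h
  exact hp ((expand_eq_zero two_pos).1 h)

/-- The linear map `p ↦ w ^ e p(w ^ 2)` onto the polynomials of the given parity. -/
def parityMap (ε : ℤˣ) : ℂ[X] →ₗ[ℂ] ℂ[X] :=
  LinearMap.mulLeft ℂ (X ^ parityExp ε) ∘ₗ (aeval (X ^ 2 : ℂ[X])).toLinearMap

theorem act_mem_irrGr {n : ℤ} {x : hatSD ε₁ ε₂} (hx : x ∈ gr ε₁ ε₂ n) :
    envAct ε₁ ε₂ _ x (hwVector ε₁ ε₂ ξ) ∈ irrGr ε₁ ε₂ ξ n := by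
  refine Submodule.subset_span ⟨toEnv ε₁ ε₂ x * 1, ?_, by rw [mul_one]; rfl⟩
  have := IsMonomial.mul hx (IsMonomial.one (ε₁ := ε₁) (ε₂ := ε₂))
  rwa [add_zero] at this

theorem HasParity.X_sq_mul {ε : ℤˣ} {p : ℂ[X]} (h : HasParity ε p) : HasParity ε (X ^ 2 * p) := by
  have h' : p.comp (-X) = C ((ε : ℤ) : ℂ) * p := h
  rw [HasParity, mul_comp, h']
  simp
  ring

end SuperCircle

/-! ### The two directions of the criterion -/

namespace SuperCircle

variable {ε₁ ε₂ : ℤˣ} {ξ : Module.Dual ℂ (gr ε₁ ε₂ 0)}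

/-- An infinite-dimensional family of elements applied to v lands in one finite-dimensional
component. -/
theorem exists_mem_annih {n : ℤ} [FiniteDimensional ℂ (irrGr ε₁ ε₂ ξ n)]
    (T : ℂ[X] →ₗ[ℂ] hatSD ε₁ ε₂) (hT : ∀ q, T q ∈ gr ε₁ ε₂ n) :
    ∃ q ≠ 0, T q ∈ annih ε₁ ε₂ (hwVector ε₁ ε₂ ξ) :=
  not_injective_of_finiteDimensional (P := irrGr ε₁ ε₂ ξ n)
    ((envAct ε₁ ε₂ (Irr ε₁ ε₂ ξ)).flip (hwVector ε₁ ε₂ ξ) ∘ₗ T) fun q => act_mem_irrGr (hT q)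

theorem exists_low_polynomial (h : IsQuasifinite ε₁ ε₂ ξ) :
    ∃ α : ℂ[X], α ≠ 0 ∧ HasParity (-(ε₁ * ε₂)) α ∧
      ∀ p, weightFun ξ (α * p - (α * p).comp (-X)) = 0 := by
  have := h (-1)
  have e : (2 * (-1) + 1 : ℤ) = -1 := by norm_num
  obtain ⟨q, hq, hq'⟩ := exists_mem_annih (ξ := ξ) (n := -1)
    -- Restricting to polynomials of the right parity makes symmetrization return the polynomial
    -- itself, so a nonzero kernel element gives a nonzero α.
    (lowElt ε₁ ε₂ (-1) ∘ₗ ((1 / 2 : ℂ) • parityMap (-(ε₁ * ε₂))))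
    (fun q => e ▸ lowElt_mem ε₁ ε₂ (-1) _)
  have hp := hasParity_mul_sq (-(ε₁ * ε₂)) q
  refine ⟨X ^ parityExp (-(ε₁ * ε₂)) * q.comp (X ^ 2), mul_sq_ne_zero _ hq, hp, ?_⟩
  exact (lowElt_mem_annih_iff hp).1 hq'

theorem exists_up_polynomial (h : IsQuasifinite ε₁ ε₂ ξ) :
    ∃ β : ℂ[X], β ≠ 0 ∧ HasParity ε₂ β ∧
      ∀ p, weightFun ξ ((β * p).comp dHalf - (β * p).comp (-dHalf)) = 0 := by
  have := h (-1)
  obtain ⟨q, hq, hq'⟩ := exists_mem_annih (ξ := ξ) (n := -1)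
    (upElt ε₁ ε₂ 0 ∘ₗ ((1 / 2 : ℂ) • ((aeval dHalf).toLinearMap ∘ₗ parityMap ε₂)))
    (fun q => upElt_mem ε₁ ε₂ 0 _)
  have hp := hasParity_mul_sq ε₂ q
  refine ⟨X ^ parityExp ε₂ * q.comp (X ^ 2), mul_sq_ne_zero _ hq, hp, ?_⟩
  exact (upElt_mem_annih_iff hp).1 hq'

theorem isQuasifinite_of_polynomials {α β : ℂ[X]} (hα : α ≠ 0) (hβ : β ≠ 0)
    (hα' : HasParity (-(ε₁ * ε₂)) α) (hβ' : HasParity ε₂ β)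
    (ha : ∀ p, weightFun ξ (α * p - (α * p).comp (-X)) = 0)
    (hb : ∀ p, weightFun ξ ((β * p).comp dHalf - (β * p).comp (-dHalf)) = 0) :
    IsQuasifinite ε₁ ε₂ ξ := by
  have hv := hwVector_isHighestWeight ξ
  refine fun n => hv.finiteDimensional (hv.finOrbit ?_ ((lowElt_mem_annih_iff hα').2 ha) ?_
    ((upElt_mem_annih_iff hβ').2 hb)) n
  · rwa [lowPoly_half (lowPoly_of_parity hα')]
  · rw [upPoly_half (upPoly_of_parity hβ')]
    exact comp_X_add_C_ne_zero hβ _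

/-- Testing the hypothesis on w² p makes the term with c vanish, since it is a value at 0. -/
theorem weightFun_X_sq_mul {α : ℂ[X]} {c : ℂ}
    (h : ∀ p, weightFun ξ (α * p - (α * p).comp (-X)) + 2 * c * (α * p).eval 0 = 0) (p : ℂ[X]) :
    weightFun ξ (X ^ 2 * α * p - (X ^ 2 * α * p).comp (-X)) = 0 := by
  have := h (X ^ 2 * p)
  rw [show α * (X ^ 2 * p) = X ^ 2 * α * p by ring] at this
  simpa using this

end SuperCircle

end

theorem mainTheorem3 (ε₁ ε₂ : ℤˣ) (ξ : Module.Dual ℂ (SuperCircle.gr ε₁ ε₂ 0)) :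
    SuperCircle.IsQuasifinite ε₁ ε₂ ξ ↔
      ∃ α β : Polynomial ℂ, α ≠ 0 ∧ β ≠ 0 ∧
        SuperCircle.HasParity (-(ε₁ * ε₂)) α ∧ SuperCircle.HasParity ε₂ β ∧
        SuperCircle.diffOp β (SuperCircle.Delta0 ε₁ ε₂ ξ) = 0 ∧
        SuperCircle.diffOp α
          ((SuperCircle.expSeries (1 / 2) + SuperCircle.expSeries (-(1 / 2))) *
              SuperCircle.Delta0 ε₁ ε₂ ξ +
            (SuperCircle.expSeries (1 / 2) - SuperCircle.expSeries (-(1 / 2))) *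
              SuperCircle.Delta1 ε₁ ε₂ ξ -
            PowerSeries.C (2 * SuperCircle.centralCharge ε₁ ε₂ ξ)) = 0 := by
  simp only [SuperCircle.diffOp_Delta0, SuperCircle.diffOp_combined]
  constructor
  · intro h
    obtain ⟨α, hα, hα', ha⟩ := SuperCircle.exists_low_polynomial h
    obtain ⟨β, hβ, hβ', hb⟩ := SuperCircle.exists_up_polynomial h
    -- The factor w² keeps the parity and vanishes at 0, which absorbs the constant 2c.
    refine ⟨Polynomial.X ^ 2 * α, β, mul_ne_zero (pow_ne_zero 2 Polynomial.X_ne_zero) hα, hβ,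
      hα'.X_sq_mul, hβ', hb, fun p => ?_⟩
    have := ha (Polynomial.X ^ 2 * p)
    rw [show α * (Polynomial.X ^ 2 * p) = Polynomial.X ^ 2 * α * p by ring] at this
    rw [this]
    simp
  · rintro ⟨α, β, hα, hβ, hα', hβ', hb, ha⟩
    -- The annihilator is built from w²α rather than α, as the equation for α itself still contains
    -- c.
    exact SuperCircle.isQuasifinite_of_polynomials
      (mul_ne_zero (pow_ne_zero 2 Polynomial.X_ne_zero) hα) hβ hα'.X_sq_mul hβ'
      (SuperCircle.weightFun_X_sq_mul ha) hb
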